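/- Let $R$ be a reduced irreducible (crystallographic) root system in a real vector space $\mathfrak h^*_{\mathbb R}$, with simple roots $\alpha_1,\dots,\alpha_n$, positive roots $R^+$, coroots $\alpha^\vee$, Weyl group $W$ generated by the simple reflections $s_1,\dots,s_n$, length function $\ell(w)=\#\{\alpha\in R^+ : w\alpha\notin R^+\}$, weight lattice $P=\{\lambda : \langle\lambda,\alpha^\vee\rangle\in\mathbb Z \text{ for all }\alpha\in R\}$ and $\rho=\frac12\sum_{\alpha\in R^+}\alpha\in P$. Put $W_0(t)=\sum_{w\in W}t^{\ell(w)}$ and let $\mathbb K=\mathbb Z[q,q^{-1}][W_0(q^2)^{-1}]$. The affine Hecke algebra $\tilde H$ is the $\mathbb K$-algebra with generators $T_i$ ($1\le i\le n$) and $x^\lambda$ ($\lambda\in P$) and relations $$\underbrace{T_iT_jT_i\cdots}_{m_{ij}}=\underbrace{T_jT_iT_j\cdots}_{m_{ij}}\ (i\ne j),\qquad T_i^2=(q-q^{-1})T_i+1,\qquad x^0=1,\quad x^\lambda x^\mu=x^{\lambda+\mu},$$ $$x^\lambda T_i=T_ix^{s_i\lambda}+(q-q^{-1})\frac{x^\lambda-x^{s_i\lambda}}{1-x^{-\alpha_i}},$$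 where $m_{ij}$ is the order of $s_is_j$. For $w\in W$ let $T_w=T_{i_1}\cdots T_{i_p}$, where $w=s_{i_1}\cdots s_{i_p}$ is a reduced word, and let $$\mathbf 1_0=\frac1{W_0(q^2)}\sum_{w\in W}q^{\ell(w)}T_w,\qquad \varepsilon_0=\frac1{W_0(q^{-2})}\sum_{w\in W}(-q)^{-\ell(w)}T_w,\qquad A_\mu=\varepsilon_0x^\mu\mathbf 1_0\quad(\mu\in P).$$ Let $W$ act on the group algebra $\mathbb K[P]$ by $w x^\mu=x^{w\mu}$, let $\mathbb K[P]^W$ be the algebra of invariants, $\mathcal A=\{f\in\mathbb K[P] : wf=(-1)^{\ell(w)}f \text{ for all } w\in W\}$, $a_\mu=\sum_{w\in W}(-1)^{\ell(w)}x^{w\mu}$, and $s_\lambda=a_{\lambda+\rho}/a_\rho$ for $\lambda\in P$. Then $\mathbb K[P]$ embeds in $\tilde H$, the center of $\tilde H$ is $Z(\tilde H)=\mathbb K[P]^W$, this is a free $\mathbb K$-module, $Z(\tilde H)\mathbf 1_0=\mathbf 1_0\tilde H\mathbf 1_0$, and each $s_\lambda$ ($\lambda\in P$) is a well-defined element of $\mathbb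 K[P]^W$ (the unique $s\in\mathbb K[P]$ with $a_\rho s=a_{\lambda+\rho}$). The maps $$\Phi_1\colon \mathbb K[P]^W\to\mathbf 1_0\tilde H\mathbf 1_0,\ f\mapsto f\mathbf 1_0,\qquad \Phi_2\colon\mathbf 1_0\tilde H\mathbf 1_0\to\varepsilon_0\tilde H\mathbf 1_0,\ h\mapsto A_\rho h,$$ are isomorphisms of $\mathbb K$-modules ($\Phi_1$ is the Satake isomorphism), and the composite $\tilde\Phi=\Phi_2\Phi_1\colon f\mapsto A_\rho f\mathbf 1_0$ sends $s_\lambda$ to $A_{\lambda+\rho}$ for every $\lambda\in P$. It generalizes the isomorphism of $\mathbb K$-modules $\Phi\colon\mathbb K[P]^W\to\mathcal A$, $f\mapsto a_\rho f$, $s_\lambda\mapsto a_{\lambda+\rho}$, in the sense that $|W|\,\tilde\Phi(f)=\varepsilon_0\,\Phi(f)\,\mathbf 1_0$ for all $f\in\mathbb K[P]^W$. -/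

import Mathlib

noncomputable section

namespace Satake

open RootPairing

section Weyl

variable {ι V V' : Type*} [AddCommGroup V] [Module ℝ V] [AddCommGroup V'] [Module ℝ V']
variable (R : RootPairing ι ℝ V V')

/-- A Weyl group element of a finite root system is determined by its permutation of the roots. -/
theorem finite_weylGroup [Finite ι] [R.IsRootSystem] : Finite R.weylGroup := by
  refine Finite.of_injective (fun w : R.weylGroup => (R.weylGroupToPerm w : Equiv.Perm ι)) ?_
  intro w w' h
  apply Subtype.ext
  apply Equiv.weightHom_injective R
  apply LinearEquiv.toLinearMap_injective
  refine LinearMap.ext_on_range (v := R.root) IsRootSystem.span_root_eq_top ?_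
  intro i
  have h1 := R.weylGroup_apply_root w i
  have h2 := R.weylGroup_apply_root w' i
  have h3 : R.weylGroupToPerm w i = R.weylGroupToPerm w' i := by
    have := congrArg (fun e : Equiv.Perm ι => e i) h
    exact this
  rw [h3, ← h2] at h1
  exact h1

instance weylGroupFintype [Finite ι] [R.IsRootSystem] : Fintype R.weylGroup :=
  letI := finite_weylGroup R
  Fintype.ofFinite _

/-- The weight lattice `P`: the vectors `v` with `⟨v, αᵢ^∨⟩ ∈ ℤ` for all roots `αᵢ`. -/
def weightLattice : AddSubgroup V where
  carrier := {v | ∀ i, ∃ n : ℤ, R.coroot' i v = n}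
  zero_mem' := fun i => ⟨0, by simp⟩
  add_mem' := by
    intro v w hv hw i
    obtain ⟨m, hm⟩ := hv i
    obtain ⟨n, hn⟩ := hw i
    exact ⟨m + n, by rw [map_add, hm, hn]; push_cast; ring⟩
  neg_mem' := by
    intro v hv i
    obtain ⟨m, hm⟩ := hv i
    exact ⟨-m, by rw [map_neg, hm]; push_cast; ring⟩

variable {R} in
/-- The integer `⟨v, αᵢ^∨⟩` for a weight `v`. -/
def weightPairing (v : weightLattice R) (i : ι) : ℤ := (v.2 i).choose

theorem weightPairing_spec (v : weightLattice R) (i : ι) :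
    R.coroot' i (v : V) = weightPairing v i := (v.2 i).choose_spec

variable [R.IsCrystallographic]

/-- Every root, as an element of the weight lattice. -/
def rootWeight (i : ι) : weightLattice R :=
  ⟨R.root i, fun j => ⟨R.pairingIn ℤ i j, by
    rw [R.root_coroot'_eq_pairing]; exact (R.algebraMap_pairingIn ℤ i j).symm⟩⟩

theorem weylGroup_smul_mem (w : R.weylGroup) (v : V) (hv : v ∈ weightLattice R) :
    w • v ∈ weightLattice R := by
  obtain ⟨w, hw⟩ := w
  revert v
  induction hw using weylGroup.induction with
  | mem i =>
    intro v hv j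
    obtain ⟨m, hm⟩ := hv i
    obtain ⟨n, hn⟩ := hv j
    refine ⟨n - m * R.pairingIn ℤ i j, ?_⟩
    have h1 : (⟨Equiv.reflection R i, R.reflection_mem_weylGroup i⟩ : R.weylGroup) • v
        = R.reflection i v := rfl
    have h2 : R.pairing i j = (R.pairingIn ℤ i j : ℝ) := (R.algebraMap_pairingIn ℤ i j).symm
    rw [h1, R.reflection_apply, map_sub, map_smul, R.root_coroot'_eq_pairing, hm, hn, h2]
    push_cast
    rw [smul_eq_mul]
  | one => intro v hv; simpa using hv
  | mul x y hx hy ihx ihy =>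
    intro v hv
    have := ihx _ (ihy v hv)
    rwa [← mul_smul] at this

/-- The Weyl group acts on the weight lattice. -/
instance weightAction : DistribMulAction R.weylGroup (weightLattice R) where
  smul w v := ⟨w • (v : V), weylGroup_smul_mem R w v v.2⟩
  one_smul v := Subtype.ext (one_smul _ (v : V))
  mul_smul w w' v := Subtype.ext (mul_smul w w' (v : V))
  smul_zero w := Subtype.ext (smul_zero w)
  smul_add w v v' := Subtype.ext (smul_add w (v : V) (v' : V))

end Weyl

section Base

variable {ι V V' : Type*} [AddCommGroup V] [Module ℝ V] [AddCommGroup V'] [Module ℝ V']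
variable {R : RootPairing ι ℝ V V'} (b : R.Base)

/-- The length of `w`: the number of positive roots that `w` makes negative. -/
def length (w : R.weylGroup) : ℕ := {i | b.IsPos i ∧ ¬ b.IsPos (R.weylGroupToPerm w i)}.ncard

/-- The simple reflection `sᵢ`. -/
def simpleReflection (i : b.support) : R.weylGroup := weylGroup.ofIdx R i

/-- The element `s_{i₁} ⋯ s_{iₚ}` of the Weyl group. -/
def wordProd (l : List b.support) : R.weylGroup := (l.map (simpleReflection b)).prod

variable [Finite ι]

theorem exists_word [R.IsCrystallographic] [R.IsReduced] (w : R.weylGroup) :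
    ∃ l, wordProd b l = w := by
  have hmul : ∀ l l', wordProd b (l ++ l') = wordProd b l * wordProd b l' := by
    intro l l'; simp [wordProd]
  have conj : ∀ i j : ι, weylGroup.ofIdx R (R.reflectionPerm j i)
      = weylGroup.ofIdx R j * weylGroup.ofIdx R i * weylGroup.ofIdx R j := by
    intro i j
    apply Subtype.ext
    apply Equiv.weightHom_injective R
    have h : ∀ k, Equiv.weightHom R (weylGroup.ofIdx R k : R.Aut) = R.reflection k :=
      fun k => Equiv.reflection_weightEquiv R k
    rw [Subgroup.coe_mul, Subgroup.coe_mul, map_mul, map_mul, h, h, h]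
    exact R.reflection_reflectionPerm
  have refl : ∀ i : ι, ∃ l, wordProd b l = weylGroup.ofIdx R i := by
    intro i
    refine b.induction_reflect i (p := fun i => ∃ l, wordProd b l = weylGroup.ofIdx R i) ?_ ?_ ?_
    · rintro i ⟨l, hl⟩
      exact ⟨l ++ l ++ l, by rw [hmul, hmul, hl, conj]⟩
    · intro i hi
      exact ⟨[⟨i, hi⟩], by simp [wordProd, simpleReflection]⟩
    · rintro i j ⟨l, hl⟩ hj
      refine ⟨[⟨j, hj⟩] ++ l ++ [⟨j, hj⟩], ?_⟩
      rw [hmul, hmul, hl, conj]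
      simp [wordProd, simpleReflection]
  obtain ⟨w, hw⟩ := w
  induction hw using weylGroup.induction with
  | mem i => exact refl i
  | one => exact ⟨[], rfl⟩
  | mul x y hx hy ihx ihy =>
    obtain ⟨l, hl⟩ := ihx
    obtain ⟨l', hl'⟩ := ihy
    exact ⟨l ++ l', by rw [hmul, hl, hl']; rfl⟩

theorem exists_reducedWord [R.IsCrystallographic] [R.IsReduced] (w : R.weylGroup) :
    ∃ l, wordProd b l = w ∧ ∀ l', wordProd b l' = w → l.length ≤ l'.length := by
  have hne : {l | wordProd b l = w}.Nonempty := exists_word b w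
  refine ⟨Function.argminOn List.length _ hne, Function.argminOn_mem List.length _ hne, ?_⟩
  intro l' hl'
  exact Function.argminOn_le List.length {l | wordProd b l = w} hl'

/-- A reduced word for `w`: a word in the simple reflections of minimal length with product `w`. -/
def reducedWord [R.IsCrystallographic] [R.IsReduced] (w : R.weylGroup) : List b.support :=
  (exists_reducedWord b w).choose

/-- Half the sum of the positive roots, as a vector. -/
def halfSum : V := (2⁻¹ : ℝ) • ∑ i ∈ (Set.toFinite {i | b.IsPos i}).toFinset, R.root i

theorem coroot_halfSum [R.IsCrystallographic] [R.IsReduced] (j : ι) (hj : j ∈ b.support) :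
    R.coroot' j (halfSum b) = 1 := by
  classical
  set S := (Set.toFinite {i | b.IsPos i}).toFinset with hS
  have hmem : ∀ i, i ∈ S ↔ b.IsPos i := by intro i; simp [hS]
  have hjS : j ∈ S := (hmem j).2 (Base.isPos_of_mem_support hj)
  have hstab : ∀ i ∈ S.erase j, R.reflectionPerm j i ∈ S.erase j := by
    intro i hi
    obtain ⟨hij, hi⟩ := Finset.mem_erase.1 hi
    have hpos := ((hmem i).1 hi).reflectionPerm hj hij
    refine Finset.mem_erase.2 ⟨?_, (hmem _).2 hpos⟩
    intro h
    have hi' : i = R.reflectionPerm j j := by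
      rw [← R.reflectionPerm_self j i, h]
    let := R.indexNeg
    have h2 : b.IsPos (-j) := by rw [R.indexNeg_neg, ← hi']; exact (hmem i).1 hi
    rw [Base.IsPos.neg_iff_not] at h2
    exact h2 (Base.isPos_of_mem_support hj)
  have hsum : ∑ i ∈ S.erase j, R.coroot' j (R.root i) = 0 := by
    have h1 : ∑ i ∈ S.erase j, R.coroot' j (R.root i)
        = ∑ i ∈ S.erase j, R.coroot' j (R.root (R.reflectionPerm j i)) := by
      refine (Finset.sum_nbij' (fun i => R.reflectionPerm j i) (fun i => R.reflectionPerm j i)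
        hstab hstab ?_ ?_ ?_).symm
      · intro i _; simp
      · intro i _; simp
      · intro i _; rfl
    have h2 : ∀ i, R.coroot' j (R.root (R.reflectionPerm j i)) = - R.coroot' j (R.root i) := by
      intro i
      rw [R.root_reflectionPerm, R.reflection_apply, map_sub, map_smul, smul_eq_mul,
        R.root_coroot'_eq_pairing, R.root_coroot'_eq_pairing, R.pairing_same]
      ring
    simp_rw [h2, Finset.sum_neg_distrib] at h1
    linarith
  have : R.coroot' j (halfSum b) = 2⁻¹ * ∑ i ∈ S, R.coroot' j (R.root i) := by
    simp only [halfSum, map_smul, map_sum, smul_eq_mul, ← hS]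
  rw [this, ← Finset.add_sum_erase _ _ hjS, hsum, R.root_coroot'_eq_pairing, R.pairing_same]
  norm_num

theorem halfSum_mem [R.IsCrystallographic] [R.IsReduced] : halfSum b ∈ weightLattice R := by
  intro i
  have hi := b.coroot_mem_span_int i
  have key : ∀ x ∈ Submodule.span ℤ (R.coroot '' b.support),
      ∃ n : ℤ, R.toLinearMap (halfSum b) x = n := by
    intro x hx
    induction hx using Submodule.span_induction with
    | mem x hx =>
      obtain ⟨j, hj, rfl⟩ := hx
      exact ⟨1, by simpa using coroot_halfSum b j hj⟩
    | zero => exact ⟨0, by simp⟩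
    | add x y _ _ hx hy =>
      obtain ⟨m, hm⟩ := hx
      obtain ⟨n, hn⟩ := hy
      exact ⟨m + n, by rw [map_add, hm, hn]; push_cast; ring⟩
    | smul a x _ hx =>
      obtain ⟨m, hm⟩ := hx
      exact ⟨a * m, by rw [map_zsmul, hm]; push_cast; simp⟩
  exact key _ hi

/-- `ρ`, half the sum of the positive roots, as an element of the weight lattice. -/
def rho [R.IsCrystallographic] [R.IsReduced] : weightLattice R := ⟨halfSum b, halfSum_mem b⟩

variable [R.IsRootSystem]

/-- The Poincaré polynomial `W₀(t) = ∑_{w ∈ W} t^{ℓ(w)}`. -/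
def poincare {A : Type*} [CommRing A] (t : A) : A := ∑ w : R.weylGroup, t ^ length b w

/-- The coefficient ring `𝕂 = ℤ[q, q⁻¹]` with the inverse of `W₀(q²)` adjoined. -/
abbrev Coeff : Type :=
  Localization.Away (poincare b (LaurentPolynomial.T 2 : LaurentPolynomial ℤ))

/-- `q ∈ 𝕂`. -/
def q : Coeff b := algebraMap (LaurentPolynomial ℤ) _ (LaurentPolynomial.T 1)

/-- `q⁻¹ ∈ 𝕂`. -/
def qInv : Coeff b := algebraMap (LaurentPolynomial ℤ) _ (LaurentPolynomial.T (-1))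

/-- The group algebra `𝕂[P]` of the weight lattice. -/
abbrev GroupAlg : Type _ := AddMonoidAlgebra (Coeff b) (weightLattice R)

/-- The monomial `x^μ ∈ 𝕂[P]`. -/
def monomial (μ : weightLattice R) : GroupAlg b := AddMonoidAlgebra.single μ 1

variable [R.IsCrystallographic]

/-- The action of `w ∈ W` on `𝕂[P]`, `x^μ ↦ x^{wμ}`. -/
def weylAct (w : R.weylGroup) : GroupAlg b →ₐ[Coeff b] GroupAlg b :=
  AddMonoidAlgebra.mapDomainAlgHom (Coeff b) (Coeff b)
    (DistribSMul.toAddMonoidHom (weightLattice R) w)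

/-- The symmetric functions `𝕂[P]^W`. -/
def symmetric : Subalgebra (Coeff b) (GroupAlg b) where
  carrier := {f | ∀ w, weylAct b w f = f}
  mul_mem' := by intro f g hf hg w; rw [map_mul, hf w, hg w]
  add_mem' := by intro f g hf hg w; rw [map_add, hf w, hg w]
  algebraMap_mem' := by intro r w; exact AlgHom.commutes _ r

/-- The alternating functions, `w f = (-1)^{ℓ(w)} f`. -/
def alternating : Submodule (Coeff b) (GroupAlg b) where
  carrier := {f | ∀ w, weylAct b w f = (-1 : Coeff b) ^ length b w • f}
  add_mem' := by intro f g hf hg w; rw [map_add, hf w, hg w, smul_add]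
  zero_mem' := by intro w; rw [map_zero, smul_zero]
  smul_mem' := by intro r f hf w; rw [map_smul, hf w, smul_comm]

/-- `a_μ = ∑_{w ∈ W} (-1)^{ℓ(w)} x^{wμ}`. -/
def altSum (μ : weightLattice R) : GroupAlg b :=
  ∑ w : R.weylGroup, (-1 : Coeff b) ^ length b w • weylAct b w (monomial b μ)

end Base

section Hecke

/-- The product `a b a b ⋯` with `n` factors. -/
def altProd {A : Type*} [Monoid A] : ℕ → A → A → A
  | 0, _, _ => 1
  | n + 1, a, b => a * altProd n b a

variable {ι V V' : Type*} [AddCommGroup V] [Module ℝ V] [AddCommGroup V'] [Module ℝ V']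
variable {R : RootPairing ι ℝ V V'} [R.IsCrystallographic] (b : R.Base)

/-- The quotient `(x^μ - x^{sᵢμ}) / (1 - x^{-αᵢ})` written out as a sum of monomials:
with `d = ⟨μ, αᵢ^∨⟩` it is `∑_{0 ≤ j < d} x^{μ - jαᵢ}` if `d ≥ 0`, and
`-∑_{1 ≤ j ≤ -d} x^{μ + jαᵢ}` if `d < 0`. -/
def divDiff {A : Type*} [Ring A] (x : weightLattice R → A) (i : ι) (μ : weightLattice R) : A :=
  if 0 ≤ weightPairing μ i then
    ∑ j ∈ Finset.range (weightPairing μ i).toNat, x (μ - j • rootWeight R i)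
  else
    -∑ j ∈ Finset.range (-weightPairing μ i).toNat, x (μ + (j + 1) • rootWeight R i)

theorem ofIdx_smul_weight (i : ι) (μ : weightLattice R) :
    weylGroup.ofIdx R i • μ = μ - weightPairing μ i • rootWeight R i := by
  apply Subtype.ext
  change R.reflection i (μ : V) = _
  rw [R.reflection_apply, weightPairing_spec]
  simp [rootWeight, Int.cast_smul_eq_zsmul]

/-- `divDiff` is the quotient that its description promises. -/
theorem divDiff_mul {A : Type*} [Ring A] (x : weightLattice R → A)
    (hx : ∀ μ ν, x (μ + ν) = x μ * x ν) (i : ι) (μ : weightLattice R) :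
    divDiff x i μ * (1 - x (-rootWeight R i)) = x μ - x (weylGroup.ofIdx R i • μ) := by
  rw [ofIdx_smul_weight]
  have hstep : ∀ ν, x ν * (1 - x (-rootWeight R i)) = x ν - x (ν - rootWeight R i) := by
    intro ν; rw [mul_sub, mul_one, ← hx, ← sub_eq_add_neg]
  unfold divDiff
  split_ifs with h
  · obtain ⟨n, hn⟩ := Int.eq_ofNat_of_zero_le h
    rw [hn, Finset.sum_mul]
    simp only [hstep, Int.toNat_natCast, natCast_zsmul]
    have := Finset.sum_range_sub' (fun j : ℕ => x (μ - j • rootWeight R i)) n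
    simp only [zero_smul, sub_zero] at this
    rw [← this]
    refine Finset.sum_congr rfl fun j _ => ?_
    congr 2
    rw [succ_nsmul]; abel
  · obtain ⟨n, hn⟩ := Int.eq_ofNat_of_zero_le (show 0 ≤ -weightPairing μ i by omega)
    have hn' : weightPairing μ i = -(n : ℤ) := by omega
    rw [hn, hn', neg_mul, Finset.sum_mul]
    simp only [hstep, Int.toNat_natCast, neg_smul, natCast_zsmul, sub_neg_eq_add]
    have := Finset.sum_range_sub (fun j : ℕ => x (μ + j • rootWeight R i)) n
    simp only [zero_smul, add_zero] at this
    rw [← neg_sub (x (μ + n • rootWeight R i)), ← this]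
    congr 1
    refine Finset.sum_congr rfl fun j _ => ?_
    congr 2
    rw [succ_nsmul]; abel

variable [Finite ι] [R.IsRootSystem]

/-- The generators `Tᵢ` (`αᵢ` a simple root) and `x^μ` (`μ ∈ P`) of the affine Hecke algebra. -/
inductive Gen (b : R.Base) where
  | T (i : b.support) : Gen b
  | X (μ : weightLattice R) : Gen b

/-- `Tᵢ` in the free algebra. -/
def freeT (i : b.support) : FreeAlgebra (Coeff b) (Gen b) := FreeAlgebra.ι _ (Gen.T i)

/-- `x^μ` in the free algebra. -/
def freeX (μ : weightLattice R) : FreeAlgebra (Coeff b) (Gen b) := FreeAlgebra.ι _ (Gen.X μ)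

/-- The defining relations of the affine Hecke algebra.  The number `mᵢⱼ` of factors in the braid
relation is the order of `sᵢsⱼ`. -/
inductive Rel : FreeAlgebra (Coeff b) (Gen b) → FreeAlgebra (Coeff b) (Gen b) → Prop
  | braid (i j : b.support) (hij : i ≠ j) :
      Rel (altProd (orderOf (simpleReflection b i * simpleReflection b j)) (freeT b i) (freeT b j))
        (altProd (orderOf (simpleReflection b i * simpleReflection b j)) (freeT b j) (freeT b i))
  | quadratic (i : b.support) :
      Rel (freeT b i * freeT b i) ((q b - qInv b) • freeT b i + 1)
  | x_zero : Rel (freeX b 0) 1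
  | x_add (μ ν : weightLattice R) : Rel (freeX b μ * freeX b ν) (freeX b (μ + ν))
  | cross (i : b.support) (μ : weightLattice R) :
      Rel (freeX b μ * freeT b i)
        (freeT b i * freeX b (simpleReflection b i • μ)
          + (q b - qInv b) • divDiff (freeX b) (i : ι) μ)

/-- The affine Hecke algebra `H̃` over `𝕂`. -/
def AffineHecke : Type _ := RingQuot (Rel b)

instance : Ring (AffineHecke b) := inferInstanceAs (Ring (RingQuot (Rel b)))

instance : Algebra (Coeff b) (AffineHecke b) :=
  inferInstanceAs (Algebra (Coeff b) (RingQuot (Rel b)))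

/-- The quotient map from the free algebra. -/
def mkHecke : FreeAlgebra (Coeff b) (Gen b) →ₐ[Coeff b] AffineHecke b :=
  RingQuot.mkAlgHom (Coeff b) (Rel b)

/-- The generator `Tᵢ` of `H̃`. -/
def heckeT (i : b.support) : AffineHecke b := mkHecke b (freeT b i)

/-- The canonical map `𝕂[P] → H̃`, `x^μ ↦ x^μ`. -/
def heckeX : GroupAlg b →ₐ[Coeff b] AffineHecke b :=
  AddMonoidAlgebra.lift (Coeff b) (AffineHecke b) (weightLattice R)
    { toFun := fun μ => mkHecke b (freeX b μ.toAdd)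
      map_one' := (RingQuot.mkAlgHom_rel (Coeff b) Rel.x_zero).trans (map_one _)
      map_mul' := fun μ ν => ((map_mul (mkHecke b) _ _).symm.trans
        (RingQuot.mkAlgHom_rel (Coeff b) (Rel.x_add μ.toAdd ν.toAdd))).symm }

variable [R.IsReduced]

/-- `T_w = T_{i₁} ⋯ T_{iₚ}` for a reduced word `w = s_{i₁} ⋯ s_{iₚ}`, `w ∈ W`. -/
def heckeTw (w : R.weylGroup) : AffineHecke b := ((reducedWord b w).map (heckeT b)).prod

/-- The idempotent `𝟏₀ = W₀(q²)⁻¹ ∑_{w ∈ W} q^{ℓ(w)} T_w`. -/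
def one0 : AffineHecke b :=
  Ring.inverse (poincare b (q b ^ 2)) • ∑ w : R.weylGroup, q b ^ length b w • heckeTw b w

/-- The idempotent `ε₀ = W₀(q⁻²)⁻¹ ∑_{w ∈ W} (-q)^{-ℓ(w)} T_w`. -/
def eps0 : AffineHecke b :=
  Ring.inverse (poincare b (qInv b ^ 2)) •
    ∑ w : R.weylGroup, (-qInv b) ^ length b w • heckeTw b w

/-- The submodule `e H̃ f` of `H̃`. -/
def corner (e f : AffineHecke b) : Submodule (Coeff b) (AffineHecke b) :=
  LinearMap.range (LinearMap.mulLeftRight (Coeff b) (e, f))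

/-- `A_μ = ε₀ x^μ 𝟏₀`. -/
def bigA (μ : weightLattice R) : AffineHecke b := eps0 b * heckeX b (monomial b μ) * one0 b

end Hecke

end Satake

end

noncomputable section

set_option linter.unusedSectionVars false

namespace Satake

open RootPairing

/-! ### The Weyl group as a permutation group of the roots, and its action on weights. -/

section WeylCombinatorics

variable {ι V V' : Type*} [AddCommGroup V] [Module ℝ V] [AddCommGroup V'] [Module ℝ V']
variable {R : RootPairing ι ℝ V V'}

/-! The affine Hecke algebra is studied through its polynomial representation on the fraction field
of `𝕂[P]`: `x^μ` acts by multiplication, and `Tᵢ` by a Demazure–Lusztig operator, a combination of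
the identity and `sᵢ` whose coefficients add up to `q` (`rep`, `opT_apply`). The hard part of its
existence is the braid relation. With `C = 1 + qT`, it follows once the Kazhdan–Lusztig elements of
the two alternating words agree (`altProd_comm_of_dihedralKL`). For two simple roots this is checked
in types `A₁ × A₁`, `A₂`, `B₂` and `G₂`, using mainly the identity `kappa_mul_kappa`.

By Matsumoto's theorem (`prod_map_eq_of_reduced`) `T_w` does not depend on the reduced word, so the
`T_w f` with `f ∈ 𝕂[P]` span `H̃`. The operator of `T_w` is triangular for the length, with nonzero
coefficient at `w`, and Weyl group elements are linearly independent over the fractions. Hence the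
representation is faithful (`eq_zero_of_rep_eq_zero`). In particular `H̃` is torsion-free over `𝕂`,
and the embedding of `𝕂[P]` and the description of the center follow by evaluating operators.

The Satake isomorphism comes from acting on the constant `1`: `f 𝟏₀` sends `1` to `f`, one has `H̃
𝟏₀ = 𝕂[P] 𝟏₀`, and `Tᵢ f = q f` exactly when `sᵢ f = f`. The classical isomorphism `f ↦ a_ρ f` and
the freeness of `𝕂[P]^W` are independent of `H̃`: they use orbit sums and leading terms for the
height `⟨μ, 2ρ^∨⟩`.

The link is that `f ↦ ε₀ f 𝟏₀` is alternating (`sandwich_weylAct`). If `sᵢ f = f`, then `f` commutes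
with `Tᵢ`, which acts as `q` on `𝟏₀` and as `-q⁻¹` on `ε₀`, so `(q + q⁻¹) ε₀ f 𝟏₀ = 0`. Consequently
`ε₀ (a_ρ f) 𝟏₀ = |W| A_ρ f 𝟏₀` for symmetric `f`. Taking `f = s_λ` and cancelling `|W|` gives `A_ρ
s_λ 𝟏₀ = A_{λ+ρ}`. These elements exhaust `ε₀ H̃ 𝟏₀`, which is surjectivity of `Φ₂`. Injectivity
holds because `A_ρ` does not kill `1`: otherwise every `A_μ` would, and `ε₀` would act by zero. -/

theorem root_weylGroupToPerm (w : R.weylGroup) (i : ι) :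
    R.root (R.weylGroupToPerm w i) = w • R.root i := (R.weylGroup_apply_root w i).symm

theorem weylGroupToPerm_ofIdx (i j : ι) :
    R.weylGroupToPerm (weylGroup.ofIdx R i) j = R.reflectionPerm i j := by
  apply R.root.injective
  rw [root_weylGroupToPerm, R.root_reflectionPerm]
  rfl

theorem weylGroupToPerm_mul (w w' : R.weylGroup) (i : ι) :
    R.weylGroupToPerm (w * w') i = R.weylGroupToPerm w (R.weylGroupToPerm w' i) := by
  rw [map_mul]; rfl

theorem weylGroupToPerm_inv_apply (w : R.weylGroup) (i : ι) :
    R.weylGroupToPerm w⁻¹ (R.weylGroupToPerm w i) = i := by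
  rw [← weylGroupToPerm_mul, inv_mul_cancel, map_one]; rfl

theorem weylGroupToPerm_apply_inv (w : R.weylGroup) (i : ι) :
    R.weylGroupToPerm w (R.weylGroupToPerm w⁻¹ i) = i := by
  rw [← weylGroupToPerm_mul, mul_inv_cancel, map_one]; rfl

/-- The index of the root opposite to `αᵢ`. -/
theorem root_reflectionPerm_self (i : ι) : R.root (R.reflectionPerm i i) = - R.root i := by
  rw [R.root_reflectionPerm, R.reflection_apply_self]

theorem weylGroupToPerm_reflectionPerm_self (w : R.weylGroup) (i : ι) :
    R.weylGroupToPerm w (R.reflectionPerm i i)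
      = R.reflectionPerm (R.weylGroupToPerm w i) (R.weylGroupToPerm w i) := by
  apply R.root.injective
  rw [root_weylGroupToPerm, root_reflectionPerm_self, root_reflectionPerm_self,
    root_weylGroupToPerm, smul_neg]

theorem isPos_reflectionPerm_self_iff (b : R.Base) (i : ι) :
    b.IsPos (R.reflectionPerm i i) ↔ ¬ b.IsPos i := by
  let := R.indexNeg
  have := Base.IsPos.neg_iff_not b i
  rwa [R.indexNeg_neg] at this

theorem weylGroup_induction {p : R.weylGroup → Prop} (h : ∀ i, p (weylGroup.ofIdx R i))
    (one : p 1) (mul : ∀ x y, p x → p y → p (x * y)) (w : R.weylGroup) : p w := by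
  obtain ⟨w, hw⟩ := w
  induction hw using weylGroup.induction with
  | mem i => exact h i
  | one => exact one
  | mul x y hx hy ihx ihy => exact mul ⟨x, hx⟩ ⟨y, hy⟩ ihx ihy

theorem weylGroup_ext [R.IsRootSystem] {w w' : R.weylGroup}
    (h : ∀ i, R.weylGroupToPerm w i = R.weylGroupToPerm w' i) : w = w' := by
  apply Subtype.ext
  apply Equiv.weightHom_injective R
  apply LinearEquiv.toLinearMap_injective
  refine LinearMap.ext_on_range (v := R.root) IsRootSystem.span_root_eq_top ?_
  intro i
  have h1 := R.weylGroup_apply_root w i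
  have h2 := R.weylGroup_apply_root w' i
  rw [h i, ← h2] at h1
  exact h1

theorem ofIdx_mul_self [R.IsRootSystem] (i : ι) :
    weylGroup.ofIdx R i * weylGroup.ofIdx R i = 1 := by
  apply weylGroup_ext
  intro j
  rw [weylGroupToPerm_mul, weylGroupToPerm_ofIdx, weylGroupToPerm_ofIdx, map_one]
  simp

theorem ofIdx_weylGroupToPerm [R.IsRootSystem] (w : R.weylGroup) (i : ι) :
    weylGroup.ofIdx R (R.weylGroupToPerm w i) = w * weylGroup.ofIdx R i * w⁻¹ := by
  have conj : ∀ i j : ι, weylGroup.ofIdx R (R.reflectionPerm j i)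
      = weylGroup.ofIdx R j * weylGroup.ofIdx R i * weylGroup.ofIdx R j := by
    intro i j
    apply Subtype.ext
    apply Equiv.weightHom_injective R
    have h : ∀ k, Equiv.weightHom R (weylGroup.ofIdx R k : R.Aut) = R.reflection k :=
      fun k => Equiv.reflection_weightEquiv R k
    rw [Subgroup.coe_mul, Subgroup.coe_mul, map_mul, map_mul, h, h, h]
    exact R.reflection_reflectionPerm
  revert i
  refine weylGroup_induction (p := fun w => ∀ i, weylGroup.ofIdx R (R.weylGroupToPerm w i) =
    w * weylGroup.ofIdx R i * w⁻¹) ?_ ?_ ?_ w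
  · intro j i
    rw [weylGroupToPerm_ofIdx, conj, inv_eq_of_mul_eq_one_left (ofIdx_mul_self j)]
  · intro i
    simp
  · intro x y hx hy i
    rw [weylGroupToPerm_mul, hx, hy]
    group

theorem weightPairing_smul (w : R.weylGroup) [R.IsCrystallographic] (μ : weightLattice R) (i : ι) :
    weightPairing (w • μ) (R.weylGroupToPerm w i) = weightPairing μ i := by
  revert i μ
  refine weylGroup_induction (p := fun w => ∀ (μ : weightLattice R) i,
    weightPairing (w • μ) (R.weylGroupToPerm w i) = weightPairing μ i) ?_ ?_ ?_ w
  · intro j μ i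
    rw [weylGroupToPerm_ofIdx]
    have h : R.coroot' (R.reflectionPerm j i) (R.reflection j (μ : V)) = R.coroot' i (μ : V) := by
      rw [R.coroot'_reflectionPerm]
      simp
    have h1 := weightPairing_spec R (weylGroup.ofIdx R j • μ) (R.reflectionPerm j i)
    have h2 := weightPairing_spec R μ i
    have h3 : ((weylGroup.ofIdx R j • μ : weightLattice R) : V) = R.reflection j (μ : V) := rfl
    rw [h3, h, h2] at h1
    exact_mod_cast h1.symm
  · intro μ i
    rw [one_smul, map_one]; rfl
  · intro x y hx hy μ i
    rw [weylGroupToPerm_mul, mul_smul, hx, hy]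

theorem weightPairing_smul_left [R.IsCrystallographic] (w : R.weylGroup) (μ : weightLattice R)
    (i : ι) : weightPairing (w • μ) i = weightPairing μ (R.weylGroupToPerm w⁻¹ i) := by
  rw [← weightPairing_smul w μ, weylGroupToPerm_apply_inv]

/-! ### Inversions, the exchange condition and the longest element. -/

section Length

variable (b : R.Base)

theorem simpleReflection_mul_self [R.IsRootSystem] (i : b.support) :
    simpleReflection b i * simpleReflection b i = 1 := ofIdx_mul_self _

theorem simpleReflection_inv [R.IsRootSystem] (i : b.support) :
    (simpleReflection b i)⁻¹ = simpleReflection b i :=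
  inv_eq_of_mul_eq_one_left (simpleReflection_mul_self b i)

theorem simpleReflection_mul_cancel_left [R.IsRootSystem] (i : b.support) (w : R.weylGroup) :
    simpleReflection b i * (simpleReflection b i * w) = w := by
  rw [← mul_assoc, simpleReflection_mul_self, one_mul]

theorem length_one : length b (1 : R.weylGroup) = 0 := by
  unfold length
  convert Set.ncard_empty ι
  ext i
  simp

variable [Finite ι] [R.IsRootSystem] [R.IsCrystallographic] [R.IsReduced]

/-- The map `α ↦ -w⁻¹α` carries the inversions of `w⁻¹` to those of `w`. -/
theorem length_inv (w : R.weylGroup) : length b w⁻¹ = length b w := by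
  unfold length
  refine Set.ncard_congr (fun i _ => R.reflectionPerm (R.weylGroupToPerm w⁻¹ i)
    (R.weylGroupToPerm w⁻¹ i)) ?_ ?_ ?_
  · rintro i ⟨h1, h2⟩
    refine ⟨(isPos_reflectionPerm_self_iff b _).2 h2, ?_⟩
    rw [weylGroupToPerm_reflectionPerm_self, isPos_reflectionPerm_self_iff,
      weylGroupToPerm_apply_inv]
    exact not_not.2 h1
  · intro i j _ _ h
    have h' := congrArg R.root h
    simp only [root_reflectionPerm_self] at h'
    have h'' := R.root.injective (neg_injective h')
    exact (R.weylGroupToPerm w⁻¹).injective h''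
  · rintro j ⟨h1, h2⟩
    refine ⟨R.reflectionPerm (R.weylGroupToPerm w j) (R.weylGroupToPerm w j), ⟨?_, ?_⟩, ?_⟩
    · exact (isPos_reflectionPerm_self_iff b _).2 h2
    · rw [weylGroupToPerm_reflectionPerm_self, isPos_reflectionPerm_self_iff,
        weylGroupToPerm_inv_apply]
      exact not_not.2 h1
    · apply R.root.injective
      simp only [root_reflectionPerm_self, root_weylGroupToPerm, smul_neg, neg_neg, inv_smul_smul]

theorem isPos_simple (i : b.support) : b.IsPos (i : ι) := Base.isPos_of_mem_support i.2

theorem isPos_simpleReflection (i : b.support) {j : ι} (hj : b.IsPos j) (hij : j ≠ i) :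
    b.IsPos (R.weylGroupToPerm (simpleReflection b i) j) := by
  rw [simpleReflection, weylGroupToPerm_ofIdx]
  exact hj.reflectionPerm i.2 hij

theorem simpleReflection_apply_self (i : b.support) :
    R.weylGroupToPerm (simpleReflection b i) i = R.reflectionPerm i i :=
  weylGroupToPerm_ofIdx _ _

/-- The reflection `sᵢ` permutes the positive roots other than `αᵢ`, so the inversions of `w sᵢ` are
`αᵢ` and the `sᵢ`-images of the inversions of `w`. -/
theorem length_mul_simple_of_pos (w : R.weylGroup) (i : b.support)
    (h : b.IsPos (R.weylGroupToPerm w i)) :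
    length b (w * simpleReflection b i) = length b w + 1 := by
  have hs : ∀ j, R.weylGroupToPerm (simpleReflection b i)
      (R.weylGroupToPerm (simpleReflection b i) j) = j := by
    intro j
    rw [← weylGroupToPerm_mul, simpleReflection_mul_self, map_one]; rfl
  have key : {j | b.IsPos j ∧ ¬ b.IsPos (R.weylGroupToPerm (w * simpleReflection b i) j)} =
      insert (i : ι) (R.weylGroupToPerm (simpleReflection b i) ''
        {j | b.IsPos j ∧ ¬ b.IsPos (R.weylGroupToPerm w j)}) := by
    ext j
    simp only [Set.mem_ofPred_eq, Set.mem_insert_iff, Set.mem_image, weylGroupToPerm_mul]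
    constructor
    · rintro ⟨h1, h2⟩
      by_cases hj : j = i
      · exact Or.inl hj
      · exact Or.inr ⟨_, ⟨isPos_simpleReflection b i h1 hj, h2⟩, hs j⟩
    · rintro (rfl | ⟨k, ⟨h1, h2⟩, rfl⟩)
      · refine ⟨isPos_simple b i, ?_⟩
        rw [simpleReflection_apply_self, weylGroupToPerm_reflectionPerm_self,
          isPos_reflectionPerm_self_iff]
        exact not_not.2 h
      · refine ⟨isPos_simpleReflection b i h1 ?_, by rwa [hs]⟩
        rintro rfl
        exact h2 h
  unfold length
  rw [key, Set.ncard_insert_of_notMem, Set.ncard_image_of_injective _ (Equiv.injective _)]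
  rintro ⟨k, ⟨h1, h2⟩, hk⟩
  have : k = R.reflectionPerm i i := by
    rw [← simpleReflection_apply_self, ← hk, hs]
  rw [this, isPos_reflectionPerm_self_iff] at h1
  exact h1 (isPos_simple b i)

theorem length_mul_simple_of_neg (w : R.weylGroup) (i : b.support)
    (h : ¬ b.IsPos (R.weylGroupToPerm w i)) :
    length b w = length b (w * simpleReflection b i) + 1 := by
  have := length_mul_simple_of_pos b (w * simpleReflection b i) i (by
    rwa [weylGroupToPerm_mul, simpleReflection_apply_self, weylGroupToPerm_reflectionPerm_self,
      isPos_reflectionPerm_self_iff])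
  rwa [mul_assoc, simpleReflection_mul_self, mul_one] at this

theorem length_simple_mul_of_pos (w : R.weylGroup) (i : b.support)
    (h : b.IsPos (R.weylGroupToPerm w⁻¹ i)) :
    length b (simpleReflection b i * w) = length b w + 1 := by
  rw [← length_inv, mul_inv_rev, simpleReflection_inv, length_mul_simple_of_pos b _ i h, length_inv]

theorem length_simple_mul_of_neg (w : R.weylGroup) (i : b.support)
    (h : ¬ b.IsPos (R.weylGroupToPerm w⁻¹ i)) :
    length b w = length b (simpleReflection b i * w) + 1 := by
  rw [← length_inv, length_mul_simple_of_neg b _ i h, ← length_inv, mul_inv_rev, inv_inv,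
    simpleReflection_inv]

theorem neg_one_pow_length_simple_mul {A : Type*} [Ring A] (w : R.weylGroup) (i : b.support) :
    (-1 : A) ^ length b (simpleReflection b i * w) = - (-1) ^ length b w := by
  by_cases h : b.IsPos (R.weylGroupToPerm w⁻¹ i)
  · rw [length_simple_mul_of_pos b w i h, pow_succ]; simp
  · rw [length_simple_mul_of_neg b w i h, pow_succ]; simp

theorem wordProd_cons (i : b.support) (l : List b.support) :
    wordProd b (i :: l) = simpleReflection b i * wordProd b l := by simp [wordProd]

theorem length_wordProd_le (l : List b.support) : length b (wordProd b l) ≤ l.length := by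
  induction l with
  | nil => simp [wordProd, length_one]
  | cons i l ih =>
    rw [wordProd_cons, List.length_cons]
    by_cases h : b.IsPos (R.weylGroupToPerm (wordProd b l)⁻¹ i)
    · rw [length_simple_mul_of_pos b _ i h]; omega
    · have := length_simple_mul_of_neg b _ i h; omega

theorem not_isPos_of_forall_simple {w : R.weylGroup}
    (h : ∀ i : b.support, ¬ b.IsPos (R.weylGroupToPerm w i)) {j : ι} (hj : b.IsPos j) :
    ¬ b.IsPos (R.weylGroupToPerm w j) := by
  refine hj.induction_on_add (p := fun j => ¬ b.IsPos (R.weylGroupToPerm w j))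
    (fun i hi => h ⟨i, hi⟩) ?_
  intro i j k hk hi hj
  have hj' := h ⟨j, hj⟩
  simp only [← isPos_reflectionPerm_self_iff] at hi hj' ⊢
  refine hi.add hj' ?_
  simp only [root_reflectionPerm_self, root_weylGroupToPerm, hk, smul_add]
  abel

/-- Exchange condition. Applying the letters to `αᵢ` from the right, some letter `j` first makes the
root negative. Only `αⱼ` among the positive roots is made negative by `sⱼ`, so the root was `αⱼ` at
that moment, and the letter `j` can be deleted. -/
theorem exists_word_mul_simple_of_neg (l : List b.support) (i : b.support)
    (h : ¬ b.IsPos (R.weylGroupToPerm (wordProd b l) i)) :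
    ∃ l', l'.length + 1 = l.length ∧ wordProd b l * simpleReflection b i = wordProd b l' := by
  induction l with
  | nil => exact absurd (isPos_simple b i) (by simpa [wordProd] using h)
  | cons j l ih =>
    by_cases hl : b.IsPos (R.weylGroupToPerm (wordProd b l) i)
    · refine ⟨l, by simp, ?_⟩
      have hj : R.weylGroupToPerm (wordProd b l) i = j := by
        by_contra hne
        refine h ?_
        rw [wordProd_cons, weylGroupToPerm_mul]
        exact isPos_simpleReflection b j hl hne
      have h2 := ofIdx_weylGroupToPerm (wordProd b l) i
      rw [hj] at h2
      change simpleReflection b j = _ * simpleReflection b i * _ at h2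
      have h3 : simpleReflection b j * wordProd b l = wordProd b l * simpleReflection b i := by
        rw [h2]; group
      rw [wordProd_cons, mul_assoc, ← h3, simpleReflection_mul_cancel_left]
    · obtain ⟨l', h1, h2⟩ := ih hl
      refine ⟨j :: l', by simp [h1], ?_⟩
      rw [wordProd_cons, wordProd_cons, mul_assoc, h2]

theorem wordProd_append (l l' : List b.support) :
    wordProd b (l ++ l') = wordProd b l * wordProd b l' := by simp [wordProd]

theorem wordProd_singleton (i : b.support) : wordProd b [i] = simpleReflection b i := by
  simp [wordProd]

/-- Reconciles the two notions of length: `reducedWord` minimizes the number of letters, while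
`length` counts inversions. -/
theorem exists_word_length_eq (w : R.weylGroup) :
    ∃ l, wordProd b l = w ∧ l.length = length b w := by
  obtain ⟨l, rfl⟩ := exists_word b w
  induction l using List.reverseRecOn with
  | nil => exact ⟨[], rfl, by simp [wordProd, length_one]⟩
  | append_singleton l i ih =>
    obtain ⟨l', h1, h2⟩ := ih
    rw [wordProd_append, wordProd_singleton, ← h1]
    by_cases h : b.IsPos (R.weylGroupToPerm (wordProd b l') i)
    · refine ⟨l' ++ [i], by rw [wordProd_append, wordProd_singleton], ?_⟩
      rw [length_mul_simple_of_pos b _ i h, List.length_append, h1, h2]; rfl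
    · obtain ⟨m, h3, h4⟩ := exists_word_mul_simple_of_neg b l' i h
      refine ⟨m, h4.symm, ?_⟩
      have := length_mul_simple_of_neg b _ i h
      rw [h1] at this ⊢
      omega

theorem wordProd_reducedWord (w : R.weylGroup) : wordProd b (reducedWord b w) = w :=
  (exists_reducedWord b w).choose_spec.1

theorem length_reducedWord (w : R.weylGroup) : (reducedWord b w).length = length b w := by
  obtain ⟨l, h1, h2⟩ := exists_word_length_eq b w
  apply le_antisymm
  · rw [← h2]
    exact (exists_reducedWord b w).choose_spec.2 l h1
  · conv_lhs => rw [← wordProd_reducedWord b w]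
    exact length_wordProd_le b _

theorem exists_descent {w : R.weylGroup} (hw : w ≠ 1) :
    ∃ i : b.support, ¬ b.IsPos (R.weylGroupToPerm w i) := by
  obtain ⟨l, h1, h2⟩ := exists_word_length_eq b w
  rcases List.eq_nil_or_concat l with rfl | ⟨l, i, rfl⟩
  · exact absurd h1.symm hw
  · refine ⟨i, fun h => ?_⟩
    rw [List.concat_eq_append] at h1 h2
    have h3 := length_mul_simple_of_pos b w i h
    rw [← h1, wordProd_append, wordProd_singleton, mul_assoc, simpleReflection_mul_self,
      mul_one, ← wordProd_singleton, ← wordProd_append, h1] at h3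
    have := length_wordProd_le b l
    simp at h2
    omega

theorem exists_left_descent {w : R.weylGroup} (hw : w ≠ 1) :
    ∃ i : b.support, ¬ b.IsPos (R.weylGroupToPerm w⁻¹ i) :=
  exists_descent b (inv_ne_one.2 hw)

/-- Every Weyl group element is built from `1` by length-increasing left multiplications. -/
theorem length_induction {p : R.weylGroup → Prop} (one : p 1)
    (step : ∀ (i : b.support) (w : R.weylGroup), b.IsPos (R.weylGroupToPerm w⁻¹ i) → p w →
      p (simpleReflection b i * w)) (w : R.weylGroup) : p w := by
  induction hn : length b w using Nat.strong_induction_on generalizing w with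
  | _ n ih =>
    by_cases hw : w = 1
    · exact hw ▸ one
    · obtain ⟨i, hi⟩ := exists_left_descent b hw
      have h1 := length_simple_mul_of_neg b w i hi
      have h2 := step i (simpleReflection b i * w) (by
        rw [mul_inv_rev, simpleReflection_inv, weylGroupToPerm_mul, simpleReflection_apply_self,
          weylGroupToPerm_reflectionPerm_self, isPos_reflectionPerm_self_iff]
        exact hi) (ih _ (by omega) _ rfl)
      rwa [simpleReflection_mul_cancel_left] at h2

theorem length_simpleReflection (i : b.support) : length b (simpleReflection b i) = 1 := by
  have := length_mul_simple_of_pos b 1 i (by simpa using isPos_simple b i)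
  rwa [one_mul, length_one] at this

theorem length_eq_zero_iff {w : R.weylGroup} : length b w = 0 ↔ w = 1 := by
  refine ⟨fun h => ?_, fun h => h ▸ length_one b⟩
  by_contra hw
  obtain ⟨i, hi⟩ := exists_descent b hw
  have := length_mul_simple_of_neg b w i hi
  omega

/-- An element of maximal length makes all simple roots negative, hence all positive roots. The
inversions of `w` and of `w₀ w` then partition the positive roots. -/
theorem exists_longest : ∃ w₀ : R.weylGroup, ∀ w : R.weylGroup,
    length b w + length b (w₀ * w) = {i | b.IsPos i}.ncard := by
  obtain ⟨w₀, h0⟩ := Finite.exists_max (length b (R := R))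
  have h1 : ∀ i : b.support, ¬ b.IsPos (R.weylGroupToPerm w₀ i) := by
    intro i hi
    have h2 := length_mul_simple_of_pos b w₀ i hi
    have := h0 (w₀ * simpleReflection b i)
    omega
  have h2 : ∀ j, b.IsPos (R.weylGroupToPerm w₀ j) ↔ ¬ b.IsPos j := by
    intro j
    refine ⟨fun h hj => not_isPos_of_forall_simple b h1 hj h, fun hj => ?_⟩
    rw [← isPos_reflectionPerm_self_iff] at hj
    have := not_isPos_of_forall_simple b h1 hj
    rwa [weylGroupToPerm_reflectionPerm_self, isPos_reflectionPerm_self_iff, not_not] at this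
  refine ⟨w₀, fun w => ?_⟩
  unfold length
  rw [← Set.ncard_union_eq]
  · congr 1
    ext j
    simp only [weylGroupToPerm_mul, h2, Set.mem_union, Set.mem_ofPred_eq]
    tauto
  · rw [Set.disjoint_left]
    rintro j ⟨_, h3⟩ ⟨_, h4⟩
    rw [weylGroupToPerm_mul, h2, not_not] at h4
    exact h3 h4


end Length
end WeylCombinatorics

/-! ### Rank-two parabolic subgroups and Matsumoto's theorem. -/

section Matsumoto

variable {ι V V' : Type*} [AddCommGroup V] [Module ℝ V] [AddCommGroup V'] [Module ℝ V']
variable {R : RootPairing ι ℝ V V'} (b : R.Base)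
variable [Finite ι] [R.IsRootSystem] [R.IsCrystallographic] [R.IsReduced]

theorem repr_root_nonneg {j : ι} (hj : b.IsPos j) (i : b.support) :
    0 ≤ b.toWeightBasis.repr (R.root j) i := by
  classical
  refine hj.induction_on_add (p := fun j => 0 ≤ b.toWeightBasis.repr (R.root j) i) ?_ ?_
  · intro k hk
    have := b.toWeightBasis_repr_root ⟨k, hk⟩
    simp only at this
    rw [this, Finsupp.single_apply]
    split_ifs <;> norm_num
  · intro k l m hm hk hl
    have := b.toWeightBasis_repr_root ⟨l, hl⟩
    simp only at this
    simp only [hm, map_add, Finsupp.add_apply, this, Finsupp.single_apply]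
    split_ifs <;> linarith

theorem repr_root_nonpos {j : ι} (hj : ¬ b.IsPos j) (i : b.support) :
    b.toWeightBasis.repr (R.root j) i ≤ 0 := by
  rw [← isPos_reflectionPerm_self_iff] at hj
  have := repr_root_nonneg b hj i
  rw [root_reflectionPerm_self, map_neg, Finsupp.neg_apply] at this
  linarith

theorem not_isPos_of_repr_nonpos {j : ι} (h : ∀ i, b.toWeightBasis.repr (R.root j) i ≤ 0) :
    ¬ b.IsPos j := by
  intro hj
  refine R.ne_zero j (b.toWeightBasis.repr.injective ?_)
  ext i
  rw [map_zero]
  exact le_antisymm (h i) (repr_root_nonneg b hj i)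

/-- A Weyl group element that makes two simple roots negative makes every positive root in their
span negative. -/
theorem not_isPos_of_mem_span_pair {w : R.weylGroup} {i j : b.support} (hij : i ≠ j)
    (hi : ¬ b.IsPos (R.weylGroupToPerm w i)) (hj : ¬ b.IsPos (R.weylGroupToPerm w j))
    {k : ι} (hk : b.IsPos k) (hs : R.root k ∈ Submodule.span ℝ {R.root i, R.root j}) :
    ¬ b.IsPos (R.weylGroupToPerm w k) := by
  classical
  obtain ⟨x, y, hxy⟩ := Submodule.mem_span_pair.1 hs
  have h1 := repr_root_nonneg b hk i
  have h2 := repr_root_nonneg b hk j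
  rw [← hxy] at h1 h2
  simp [hij, hij.symm] at h1 h2
  apply not_isPos_of_repr_nonpos
  intro l
  rw [root_weylGroupToPerm, ← hxy, smul_add, smul_comm w x, smul_comm w y, ← root_weylGroupToPerm,
    ← root_weylGroupToPerm, map_add, map_smul, map_smul, Finsupp.add_apply, Finsupp.smul_apply,
    Finsupp.smul_apply, smul_eq_mul, smul_eq_mul]
  have h3 := repr_root_nonpos b hi l
  have h4 := repr_root_nonpos b hj l
  nlinarith

/-- The alternating word `i j i ⋯` with `n` letters. -/
def altList {A : Type*} : ℕ → A → A → List A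
  | 0, _, _ => []
  | n + 1, a, b => a :: altList n b a

theorem length_altList {A : Type*} (n : ℕ) (x y : A) : (altList n x y).length = n := by
  induction n generalizing x y with
  | zero => rfl
  | succ n ih => simp [altList, ih]

theorem prod_map_altList {A M : Type*} [Monoid M] (f : A → M) (n : ℕ) (x y : A) :
    ((altList n x y).map f).prod = altProd n (f x) (f y) := by
  induction n generalizing x y with
  | zero => rfl
  | succ n ih => simp [altList, altProd, ih]

/-- The letter with which `altList n x y` continues. -/
def altNext {A : Type*} : ℕ → A → A → A
  | 0, a, _ => a
  | n + 1, a, b => altNext n b a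

theorem altList_succ {A : Type*} (n : ℕ) (x y : A) :
    altList (n + 1) x y = altList n x y ++ [altNext n x y] := by
  induction n generalizing x y with
  | zero => rfl
  | succ n ih =>
    rw [altList, ih y x]
    rfl

theorem altNext_eq_or {A : Type*} (n : ℕ) (x y : A) : altNext n x y = x ∨ altNext n x y = y := by
  induction n generalizing x y with
  | zero => exact Or.inl rfl
  | succ n ih => exact (ih y x).symm

/-- Translates between braid relations for two involutions and powers of their product: the two
alternating products with `n` factors agree exactly when `(st)^n = 1`. -/
theorem altProd_eq_pow_mul {G : Type*} [Group G] {s t : G} (hs : s * s = 1) (ht : t * t = 1)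
    (n : ℕ) : altProd n s t = (s * t) ^ n * altProd n t s := by
  have hconj : ∀ n, s * (s * t) ^ n * s = ((s * t) ^ n)⁻¹ := by
    intro n
    have hs' : s⁻¹ = s := inv_eq_of_mul_eq_one_left hs
    have ht' : t⁻¹ = t := inv_eq_of_mul_eq_one_left ht
    have h1 : s * (s * t) * s⁻¹ = (s * t)⁻¹ := by
      rw [mul_inv_rev, hs', ht', ← mul_assoc, hs, one_mul]
    rw [← inv_pow, ← h1, conj_pow, hs']
  induction n with
  | zero => simp [altProd]
  | succ n ih =>
    have h1 : (s * t) ^ (n + 1) * altProd (n + 1) t s = (s * t) ^ n * s * altProd n s t := by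
      rw [altProd, pow_succ]
      calc (s * t) ^ n * (s * t) * (t * altProd n s t)
          = (s * t) ^ n * s * (t * t) * altProd n s t := by group
        _ = _ := by rw [ht, mul_one]
    rw [h1, ih, altProd]
    have h2 := hconj n
    calc s * altProd n t s = (s * t) ^ n * ((s * t) ^ n)⁻¹ * s * altProd n t s := by group
      _ = (s * t) ^ n * (s * (s * t) ^ n * s) * s * altProd n t s := by rw [h2]
      _ = (s * t) ^ n * s * (s * t) ^ n * (s * s) * altProd n t s := by group
      _ = _ := by rw [hs]; group

theorem pow_eq_one_of_altProd_eq {G : Type*} [Group G] {s t : G} (hs : s * s = 1) (ht : t * t = 1)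
    {n : ℕ} (h : altProd n s t = altProd n t s) : (s * t) ^ n = 1 := by
  rw [altProd_eq_pow_mul hs ht] at h
  exact mul_eq_right.1 h

theorem wordProd_altList (n : ℕ) (i j : b.support) :
    wordProd b (altList n i j) = altProd n (simpleReflection b i) (simpleReflection b j) :=
  prod_map_altList _ _ _ _

theorem smul_mem_span_pair (i j : b.support) {v : V}
    (hv : v ∈ Submodule.span ℝ {R.root i, R.root j}) :
    simpleReflection b i • v ∈ Submodule.span ℝ {R.root i, R.root j} := by
  change R.reflection i v ∈ _
  rw [R.reflection_apply]
  exact Submodule.sub_mem _ hv (Submodule.smul_mem _ _ (Submodule.subset_span (by simp)))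

theorem wordProd_altList_smul_mem_span_pair (n : ℕ) (i j : b.support) {v : V}
    (hv : v ∈ Submodule.span ℝ {R.root i, R.root j}) :
    wordProd b (altList n i j) • v ∈ Submodule.span ℝ {R.root i, R.root j} := by
  induction n generalizing i j with
  | zero => simpa [altList, wordProd] using hv
  | succ n ih =>
    rw [altList, wordProd_cons, mul_smul]
    refine smul_mem_span_pair b i j ?_
    rw [Set.pair_comm] at hv ⊢
    exact ih j i hv

/-- If prepending `sᵢ` made the root negative, that root would be `αᵢ`. This would yield a braid
relation with fewer factors than the order of `sᵢ sⱼ`, which is impossible. -/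
theorem isPos_wordProd_altList (n : ℕ) (i j : b.support)
    (hn : n < orderOf (simpleReflection b i * simpleReflection b j)) :
    b.IsPos (R.weylGroupToPerm (wordProd b (altList n i j)) (altNext n i j : b.support)) := by
  induction n generalizing i j with
  | zero => simpa [altList, wordProd, altNext] using isPos_simple b i
  | succ n ih =>
    have hord : orderOf (simpleReflection b j * simpleReflection b i) =
        orderOf (simpleReflection b i * simpleReflection b j) := by
      rw [← orderOf_inv, mul_inv_rev, simpleReflection_inv, simpleReflection_inv]
    have h1 := ih j i (by omega)
    rw [altList, wordProd_cons, weylGroupToPerm_mul, altNext]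
    refine isPos_simpleReflection b i h1 fun h => ?_
    have h2 := ofIdx_weylGroupToPerm (wordProd b (altList n j i)) (altNext n j i : b.support)
    rw [h] at h2
    change simpleReflection b i = _ * simpleReflection b (altNext n j i) * _ at h2
    have h3 : wordProd b (altList (n + 1) i j) = wordProd b (altList (n + 1) j i) := by
      rw [altList_succ n j i, wordProd_append, wordProd_singleton, altList, wordProd_cons, h2]
      group
    rw [wordProd_altList, wordProd_altList] at h3
    have h4 := pow_eq_one_of_altProd_eq (simpleReflection_mul_self b i)
      (simpleReflection_mul_self b j) h3
    have := orderOf_le_of_pow_eq_one (Nat.succ_pos n) h4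
    omega

/-- When `i` and `j` are both left descents, `w⁻¹` makes every positive root in the plane of `αᵢ`,
`αⱼ` negative. So the letters of the alternating word can be stripped one at a time, each lowering
the length. -/
theorem length_altList_inv_mul {w : R.weylGroup} {i j : b.support} (hij : i ≠ j)
    (hi : ¬ b.IsPos (R.weylGroupToPerm w⁻¹ i)) (hj : ¬ b.IsPos (R.weylGroupToPerm w⁻¹ j)) (n : ℕ)
    (hn : n ≤ orderOf (simpleReflection b i * simpleReflection b j)) :
    length b w = n + length b ((wordProd b (altList n i j))⁻¹ * w) := by
  induction n with
  | zero => simp [altList, wordProd]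
  | succ n ih =>
    have h1 : ¬ b.IsPos (R.weylGroupToPerm (((wordProd b (altList n i j))⁻¹ * w)⁻¹)
        (altNext n i j : b.support)) := by
      rw [mul_inv_rev, inv_inv, weylGroupToPerm_mul]
      refine not_isPos_of_mem_span_pair b hij hi hj (isPos_wordProd_altList b n i j (by omega)) ?_
      rw [root_weylGroupToPerm]
      refine wordProd_altList_smul_mem_span_pair b n i j (Submodule.subset_span ?_)
      rcases altNext_eq_or n i j with h | h <;> simp [h]
    have h2 := length_simple_mul_of_neg b _ _ h1
    rw [altList_succ, wordProd_append, wordProd_singleton, mul_inv_rev, simpleReflection_inv,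
      mul_assoc, ih (by omega)]
    omega

/-- **Matsumoto's theorem**: a family that satisfies the braid relations takes the same product
over any two reduced words of the same element. -/
theorem prod_map_eq_of_reduced {M : Type*} [Monoid M] (f : b.support → M)
    (hf : ∀ i j, i ≠ j → altProd (orderOf (simpleReflection b i * simpleReflection b j)) (f i) (f j)
      = altProd (orderOf (simpleReflection b i * simpleReflection b j)) (f j) (f i))
    {l l' : List b.support} (h : wordProd b l = wordProd b l')
    (hl : l.length = length b (wordProd b l)) (hl' : l'.length = length b (wordProd b l')) :
    (l.map f).prod = (l'.map f).prod := by
  have htail : ∀ (i : b.support) (u : List b.support),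
      (i :: u).length = length b (wordProd b (i :: u)) →
      u.length = length b (wordProd b u) ∧
        ¬ b.IsPos (R.weylGroupToPerm (wordProd b (i :: u))⁻¹ i) := by
    intro i u hu
    have hle := length_wordProd_le b u
    have hneg : ¬ b.IsPos (R.weylGroupToPerm (wordProd b (i :: u))⁻¹ i) := by
      intro hpos
      have := length_simple_mul_of_pos b _ i hpos
      rw [wordProd_cons, simpleReflection_mul_cancel_left, ← wordProd_cons] at this
      simp at hu
      omega
    have := length_simple_mul_of_neg b _ i hneg
    rw [wordProd_cons, simpleReflection_mul_cancel_left, ← wordProd_cons] at this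
    simp at hu
    exact ⟨by omega, hneg⟩
  induction hn : l.length using Nat.strong_induction_on generalizing l l' with
  | _ n ih =>
  have hlen : l.length = l'.length := by rw [hl, hl', h]
  have hcons : ∀ (i : b.support) (u v : List b.support), (i :: u).length = n →
      wordProd b (i :: u) = wordProd b (i :: v) →
      (i :: u).length = length b (wordProd b (i :: u)) →
      (i :: v).length = length b (wordProd b (i :: v)) →
      ((i :: u).map f).prod = ((i :: v).map f).prod := by
    intro i u v hun huv hu hv
    rw [wordProd_cons, wordProd_cons] at huv
    have := ih u.length (by simp at hun; omega) (mul_left_cancel huv) (htail i u hu).1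
      (htail i v hv).1 rfl
    simp [this]
  match l, l' with
  | [], [] => rfl
  | [], _ :: _ => simp at hlen
  | _ :: _, [] => simp at hlen
  | i :: u, j :: v =>
    by_cases hij : i = j
    · subst hij
      exact hcons i u v hn h hl hl'
    set m := orderOf (simpleReflection b i * simpleReflection b j) with hm
    have hmpos : 0 < m := orderOf_pos _
    have hji : orderOf (simpleReflection b j * simpleReflection b i) = m := by
      rw [hm, ← orderOf_inv, mul_inv_rev, simpleReflection_inv, simpleReflection_inv]
    have hdi := (htail i u hl).2
    have hdj := (htail j v hl').2
    rw [← h] at hdj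
    -- Different first letters are both left descents, so `w` has reduced words that begin with
    -- either side of the braid relation and share the tail `t`. Each given word is compared with
    -- the one that has the same first letter, where induction applies.
    obtain ⟨t, ht1, ht2⟩ := exists_word_length_eq b
      ((wordProd b (altList m i j))⁻¹ * wordProd b (i :: u))
    have hbraid : wordProd b (altList m i j) = wordProd b (altList m j i) := by
      rw [wordProd_altList, wordProd_altList,
        altProd_eq_pow_mul (simpleReflection_mul_self b i) (simpleReflection_mul_self b j),
        hm, pow_orderOf_eq_one, one_mul]
    have hwi : wordProd b (altList m i j ++ t) = wordProd b (i :: u) := by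
      rw [wordProd_append, ht1, mul_inv_cancel_left]
    have hwj : wordProd b (altList m j i ++ t) = wordProd b (i :: u) := by
      rw [wordProd_append, ← hbraid, ht1, mul_inv_cancel_left]
    have hlt := length_altList_inv_mul b hij hdi hdj m le_rfl
    rw [← ht2] at hlt
    obtain ⟨k, hk⟩ : ∃ k, m = k + 1 := ⟨m - 1, by omega⟩
    have e1 : altList m i j ++ t = i :: (altList k j i ++ t) := by rw [hk]; rfl
    have e2 : altList m j i ++ t = j :: (altList k i j ++ t) := by rw [hk]; rfl
    have p1 := hcons i u (altList k j i ++ t) hn (by rw [← e1, hwi]) hl (by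
      rw [← e1, hwi, List.length_append, length_altList, hlt])
    have p2 := hcons j v (altList k i j ++ t) (by rw [← hlen, hn]) (by rw [← e2, hwj, h]) hl' (by
      rw [← e2, hwj, List.length_append, length_altList, hlt])
    rw [p1, p2, ← e1, ← e2, List.map_append, List.map_append, List.prod_append, List.prod_append,
      prod_map_altList, prod_map_altList, hf i j hij]

end Matsumoto

/-! ### Braid relations by way of dihedral Kazhdan–Lusztig elements. -/

section KazhdanLusztig

variable {K A : Type*} [CommRing K] [Ring A] [Algebra K A]

/-- The Kazhdan–Lusztig element of the alternating word `u v u ⋯` with `n` letters, in the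
normalization `u = 1 + q Tᵢ`, `Q = q²`. -/
def dihedralKL (Q : K) : ℕ → A → A → A
  | 0, _, _ => 0
  | 1, u, _ => u
  | n + 2, u, v => u * dihedralKL Q (n + 1) v u - Q • dihedralKL Q n u v

/-- Since `(1 + qT)T = q(1 + qT)`, multiplying the previous sum by `1 + qT` yields the wanted terms
together with `q²` times the sum two steps back. The recursion subtracts exactly this surplus. -/
theorem dihedralKL_eq_sum {q q' : K} (hq : q * q' = 1) {T S : A}
    (hT : T * T = (q - q') • T + 1) (hS : S * S = (q - q') • S + 1) (n : ℕ) :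
    dihedralKL (q ^ 2) n (1 + q • T) (1 + q • S)
      = ∑ r ∈ Finset.range n, q ^ r • ((1 + q • T) * altProd r S T) := by
  induction n using Nat.strong_induction_on generalizing T S with
  | _ n ih =>
  match n with
  | 0 => simp [dihedralKL]
  | 1 => simp [dihedralKL, altProd]
  | n + 2 =>
    rw [dihedralKL, ih (n + 1) (by omega) hS hT, ih n (by omega) hT hS]
    have h1 : ∀ r, (1 + q • S) * altProd r T S = altProd r T S + q • altProd (r + 1) S T := by
      intro r
      rw [add_mul, one_mul, smul_mul_assoc, altProd]
    have h2 : ∀ r, (1 + q • T) * altProd (r + 1) T S = q • ((1 + q • T) * altProd r S T) := by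
      intro r
      have : (1 + q • T) * T = q • (1 + q • T) := by
        rw [add_mul, smul_mul_assoc, hT, one_mul, smul_add, smul_add, smul_smul, smul_smul,
          mul_sub, hq, sub_smul, one_smul]
        abel
      rw [altProd, ← mul_assoc, this, smul_mul_assoc]
    have h3 : (1 + q • T) * ∑ r ∈ Finset.range (n + 1), q ^ r • ((1 + q • S) * altProd r T S)
        = ∑ r ∈ Finset.range (n + 1), q ^ r • ((1 + q • T) * altProd r T S)
          + ∑ r ∈ Finset.range (n + 1), q ^ (r + 1) • ((1 + q • T) * altProd (r + 1) S T) := by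
      rw [Finset.mul_sum, ← Finset.sum_add_distrib]
      refine Finset.sum_congr rfl fun r _ => ?_
      rw [h1, mul_smul_comm, mul_add, smul_add, mul_smul_comm, smul_smul, ← pow_succ]
    rw [h3, Finset.sum_range_succ' (fun r => q ^ r • ((1 + q • T) * altProd r T S)),
      Finset.sum_range_succ' (fun r => q ^ r • ((1 + q • T) * altProd r S T)) (n + 1),
      Finset.smul_sum]
    have h4 : ∑ r ∈ Finset.range n, q ^ (r + 1) • ((1 + q • T) * altProd (r + 1) T S)
        = ∑ r ∈ Finset.range n, q ^ 2 • q ^ r • ((1 + q • T) * altProd r S T) := by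
      refine Finset.sum_congr rfl fun r _ => ?_
      rw [h2, smul_smul, smul_smul]
      congr 1
      ring
    rw [h4]
    simp only [altProd]
    abel

/-- All shorter alternating products occur symmetrically in the two elements, so their difference
telescopes to `q^n` times the difference of the two sides of the braid relation. -/
theorem altProd_comm_of_dihedralKL {q q' : K} (hq : q * q' = 1) {T S : A}
    (hT : T * T = (q - q') • T + 1) (hS : S * S = (q - q') • S + 1) {n : ℕ}
    (h : dihedralKL (q ^ 2) n (1 + q • T) (1 + q • S)
      = dihedralKL (q ^ 2) n (1 + q • S) (1 + q • T)) : altProd n T S = altProd n S T := by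
  rw [dihedralKL_eq_sum hq hT hS, dihedralKL_eq_sum hq hS hT, ← sub_eq_zero,
    ← Finset.sum_sub_distrib] at h
  have h1 : ∀ r, q ^ r • ((1 + q • T) * altProd r S T) - q ^ r • ((1 + q • S) * altProd r T S)
      = q ^ (r + 1) • (altProd (r + 1) T S - altProd (r + 1) S T)
        - q ^ r • (altProd r T S - altProd r S T) := by
    intro r
    simp only [altProd, add_mul, one_mul, smul_mul_assoc, smul_add, smul_sub, smul_smul, pow_succ]
    abel
  simp_rw [h1] at h
  rw [Finset.sum_range_sub (fun r => q ^ r • (altProd r T S - altProd r S T))] at h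
  simp only [altProd, sub_self, smul_zero, sub_zero] at h
  have h2 : q' ^ n • q ^ n • (altProd n T S - altProd n S T) = 0 := by rw [h, smul_zero]
  rw [smul_smul, ← mul_pow, mul_comm, hq, one_pow, one_smul] at h2
  exact sub_eq_zero.1 h2

end KazhdanLusztig

/-! ### Expansion of the dihedral elements for symmetrizing operators. -/

section Dihedral

variable {K F : Type*} [CommRing K] [Field F] [Algebra K F]

/-- The operator `f ↦ p f + s (p f)`. -/
def symmOp (s : F →ₐ[K] F) (p : F) : Module.End K F :=
  (LinearMap.id + s.toLinearMap) ∘ₗ LinearMap.mulLeft K p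

theorem symmOp_apply (s : F →ₐ[K] F) (p f : F) : symmOp s p f = p * f + s (p * f) := rfl

variable (Q : K) {s t : F →ₐ[K] F} (hs : ∀ x, s (s x) = x) (ht : ∀ x, t (t x) = x)

theorem dihedralKL_two_apply (p r f : F) :
    dihedralKL Q 2 (symmOp s p) (symmOp t r) f
      = p * symmOp t r f + s (p * symmOp t r f) := by
  simp [dihedralKL, symmOp_apply]

include ht in
theorem symmOp_invariant (r f : F) : t (symmOp t r f) = symmOp t r f := by
  simp only [symmOp_apply, map_add, ht]
  exact add_comm _ _

-- Everything is expressed through `symmOp t r f`, which `t` fixes, so words in `s` and `t` applied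
-- to it may be taken to end in `s`. In lengths 4 and 6 the coefficients are parameters, so that
-- simplified closed forms can be substituted.
include ht in
theorem dihedralKL_three_apply (p r f : F) :
    dihedralKL Q 3 (symmOp t r) (symmOp s p) f
      = (r * p + t (r * p) - algebraMap K F Q) * symmOp t r f
        + r * s p * s (symmOp t r f) + t (r * s p * s (symmOp t r f)) := by
  rw [dihedralKL, LinearMap.sub_apply, Module.End.mul_apply, LinearMap.smul_apply,
    dihedralKL_two_apply]
  rw [symmOp_apply t r (_ + _)]
  simp only [dihedralKL, Algebra.smul_def, map_add, map_mul, symmOp_invariant ht]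
  ring

include hs ht in
theorem dihedralKL_four_apply (p r f : F) {c₀ c₁ d₀ d₁ : F}
    (hc₀ : r * p + t (r * p) - algebraMap K F Q = c₀) (hc₁ : r * s p = c₁)
    (hd₀ : p * c₀ + s (p * c₁) - algebraMap K F Q * p = d₀) (hd₁ : p * t c₁ = d₁) :
    dihedralKL Q 4 (symmOp s p) (symmOp t r) f
      = d₀ * symmOp t r f + s (d₀ * symmOp t r f)
        + d₁ * t (s (symmOp t r f)) + s (d₁ * t (s (symmOp t r f))) := by
  have hQ : s (algebraMap K F Q) = algebraMap K F Q := s.commutes Q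
  rw [dihedralKL, LinearMap.sub_apply, Module.End.mul_apply, LinearMap.smul_apply,
    dihedralKL_two_apply, dihedralKL_three_apply Q ht, hc₀, hc₁, ← hd₀, ← hd₁, symmOp_apply s p]
  simp only [Algebra.smul_def, map_add, map_mul, map_sub, hs, hQ]
  ring

include hs ht in
theorem dihedralKL_six_apply (p r f : F) {c₀ c₁ d₀ d₁ e₀ e₁ e₂ g₀ g₁ g₂ : F}
    (hc₀ : r * p + t (r * p) - algebraMap K F Q = c₀) (hc₁ : r * s p = c₁)
    (hd₀ : p * c₀ + s (p * c₁) - algebraMap K F Q * p = d₀) (hd₁ : p * t c₁ = d₁)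
    (he₀ : r * d₀ + t (r * d₀) - algebraMap K F Q * c₀ = e₀)
    (he₁ : r * s d₀ + t (r * d₁) - algebraMap K F Q * c₁ = e₁) (he₂ : r * s d₁ = e₂)
    (hg₀ : p * e₀ + s (p * e₁) - algebraMap K F Q * d₀ = g₀)
    (hg₁ : p * t e₁ + s (p * e₂) - algebraMap K F Q * d₁ = g₁) (hg₂ : p * t e₂ = g₂) :
    dihedralKL Q 6 (symmOp s p) (symmOp t r) f
      = g₀ * symmOp t r f + s (g₀ * symmOp t r f)
        + g₁ * t (s (symmOp t r f)) + s (g₁ * t (s (symmOp t r f)))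
        + g₂ * t (s (t (s (symmOp t r f)))) + s (g₂ * t (s (t (s (symmOp t r f))))) := by
  have hQs : s (algebraMap K F Q) = algebraMap K F Q := s.commutes Q
  have hQt : t (algebraMap K F Q) = algebraMap K F Q := t.commutes Q
  have h5 : dihedralKL Q 5 (symmOp t r) (symmOp s p) f
      = e₀ * symmOp t r f + e₁ * s (symmOp t r f) + t (e₁ * s (symmOp t r f))
        + e₂ * s (t (s (symmOp t r f))) + t (e₂ * s (t (s (symmOp t r f)))) := by
    rw [dihedralKL, LinearMap.sub_apply, Module.End.mul_apply, LinearMap.smul_apply,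
      dihedralKL_four_apply Q hs ht p r f hc₀ hc₁ hd₀ hd₁, dihedralKL_three_apply Q ht, hc₀, hc₁,
      ← he₀, ← he₁, ← he₂, symmOp_apply t r]
    simp only [Algebra.smul_def, map_add, map_mul, map_sub, symmOp_invariant ht, ht, hQt]
    ring
  rw [dihedralKL, LinearMap.sub_apply, Module.End.mul_apply, LinearMap.smul_apply, h5,
    dihedralKL_four_apply Q hs ht p r f hc₀ hc₁ hd₀ hd₁, ← hg₀, ← hg₁, ← hg₂, symmOp_apply s p]
  simp only [Algebra.smul_def, map_add, map_mul, map_sub, hs, hQs]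
  ring

end Dihedral

/-! ### The rank-two identities for `A₁ × A₁`, `A₂`, `B₂` and `G₂`. -/

section DihedralBraid

variable {K F : Type*} [CommRing K] [Field F] [Algebra K F]

/-- The function `(Q - z) / (1 - z)`. -/
def kappa (Q z : F) : F := (Q - z) / (1 - z)

theorem kappa_inv {Q z : F} (hz : z ≠ 0) (h : 1 - z ≠ 0) : kappa Q z⁻¹ = 1 + Q - kappa Q z := by
  have h' : 1 - z⁻¹ ≠ 0 := by
    intro h0
    apply h
    field_simp at h0
    linear_combination -h0
  have h'' : z - 1 ≠ 0 := fun h0 => h (by linear_combination -h0)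
  unfold kappa
  field_simp
  ring

/-- Used with `x` and `y` the exponentials of two negative roots whose sum is a root. It turns the
recursion for the coefficients into products of values of `kappa`. -/
theorem kappa_mul_kappa {Q x y : F} (hx : 1 - x ≠ 0) (hy : 1 - y ≠ 0) (hxy : 1 - x * y ≠ 0) :
    kappa Q x * kappa Q y + (1 + Q) * kappa Q (x * y) - Q
      = kappa Q (x * y) * (kappa Q x + kappa Q y) := by
  unfold kappa
  field_simp
  ring

theorem map_kappa (s : F →ₐ[K] F) (Q : K) (z : F) :
    s (kappa (algebraMap K F Q) z) = kappa (algebraMap K F Q) (s z) := by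
  simp [kappa]

variable (Q : K) {s t : F →ₐ[K] F} (hs : ∀ x, s (s x) = x) (ht : ∀ x, t (t x) = x)
variable {a b : F} (ha : a ≠ 0) (hb : b ≠ 0) (h1a : 1 - a ≠ 0) (h1b : 1 - b ≠ 0)
variable (hsa : s a = a⁻¹) (htb : t b = b⁻¹)

include ha h1a hsa in
theorem map_kappa_of_inv : s (kappa (algebraMap K F Q) a)
    = 1 + algebraMap K F Q - kappa (algebraMap K F Q) a := by
  rw [map_kappa, hsa, kappa_inv ha h1a]

include hsa htb in
theorem dihedralKL_two_comm (hsb : s b = b) (hta : t a = a) (hst : ∀ x, s (t x) = t (s x)) :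
    dihedralKL Q 2 (symmOp s (kappa (algebraMap K F Q) a)) (symmOp t (kappa (algebraMap K F Q) b))
      = dihedralKL Q 2 (symmOp t (kappa (algebraMap K F Q) b))
        (symmOp s (kappa (algebraMap K F Q) a)) := by
  ext f
  rw [dihedralKL_two_apply, dihedralKL_two_apply]
  simp only [symmOp_apply, map_add, map_mul, map_kappa, hsa, htb, hsb, hta, hst,
    map_inv₀]
  ring

include hs ht ha hb h1a h1b hsa htb in
theorem dihedralKL_three_comm (hsb : s b = a * b) (hta : t a = a * b) (h1 : 1 - a * b ≠ 0)
    (hst : ∀ x, s (t (s x)) = t (s (t x))) :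
    dihedralKL Q 3 (symmOp s (kappa (algebraMap K F Q) a)) (symmOp t (kappa (algebraMap K F Q) b))
      = dihedralKL Q 3 (symmOp t (kappa (algebraMap K F Q) b))
        (symmOp s (kappa (algebraMap K F Q) a)) := by
  have s1 := map_kappa_of_inv Q ha h1a hsa
  have t2 := map_kappa_of_inv Q hb h1b htb
  have s2 : s (kappa (algebraMap K F Q) b) = kappa (algebraMap K F Q) (a * b) := by
    rw [map_kappa, hsb]
  have t1 : t (kappa (algebraMap K F Q) a) = kappa (algebraMap K F Q) (a * b) := by
    rw [map_kappa, hta]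
  have s3 : s (kappa (algebraMap K F Q) (a * b)) = kappa (algebraMap K F Q) b := by
    rw [← s2, hs]
  have t3 : t (kappa (algebraMap K F Q) (a * b)) = kappa (algebraMap K F Q) a := by
    rw [← t1, ht]
  obtain ⟨p₁, e1⟩ : ∃ p, p = kappa (algebraMap K F Q) a := ⟨_, rfl⟩
  obtain ⟨p₂, e2⟩ : ∃ p, p = kappa (algebraMap K F Q) b := ⟨_, rfl⟩
  obtain ⟨p₃, e3⟩ : ∃ p, p = kappa (algebraMap K F Q) (a * b) := ⟨_, rfl⟩
  have R : p₁ * p₂ + (1 + algebraMap K F Q) * p₃ - algebraMap K F Q = p₃ * (p₁ + p₂) := by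
    rw [e1, e2, e3]; exact kappa_mul_kappa h1a h1b h1
  simp only [← e1, ← e2, ← e3] at s1 s2 s3 t1 t2 t3 ⊢
  ext f
  rw [dihedralKL_three_apply Q hs, dihedralKL_three_apply Q ht]
  simp only [symmOp_apply, map_add, map_sub, map_mul, map_one, AlgHom.commutes, s1, s2, s3, t1, t2,
    t3, hst]
  linear_combination (p₁ * f + (1 + algebraMap K F Q - p₁) * s f) * R
    - (p₂ * f + (1 + algebraMap K F Q - p₂) * t f) * R

-- Both sides equal `f ↦ ∑_w w(π f)` over the dihedral group of order 8, where `π` is the product of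
-- `kappa` over the four positive roots `a`, `b`, `ab`, `a²b` of `B₂`. The coefficient `d₀` is `π`
-- without the factor already contained in the inner `symmOp`.
include hs ht ha hb h1a h1b hsa htb in
theorem dihedralKL_four_comm (hsb : s b = a ^ 2 * b) (hta : t a = a * b) (h1 : 1 - a * b ≠ 0)
    (h2 : 1 - a ^ 2 * b ≠ 0) (hst : ∀ x, s (t (s (t x))) = t (s (t (s x)))) :
    dihedralKL Q 4 (symmOp s (kappa (algebraMap K F Q) a)) (symmOp t (kappa (algebraMap K F Q) b))
      = dihedralKL Q 4 (symmOp t (kappa (algebraMap K F Q) b))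
        (symmOp s (kappa (algebraMap K F Q) a)) := by
  have s1 := map_kappa_of_inv Q ha h1a hsa
  have t2 := map_kappa_of_inv Q hb h1b htb
  have s2 : s (kappa (algebraMap K F Q) b) = kappa (algebraMap K F Q) (a ^ 2 * b) := by
    rw [map_kappa, hsb]
  have t1 : t (kappa (algebraMap K F Q) a) = kappa (algebraMap K F Q) (a * b) := by
    rw [map_kappa, hta]
  have s4 : s (kappa (algebraMap K F Q) (a ^ 2 * b)) = kappa (algebraMap K F Q) b := by
    rw [← s2, hs]
  have t3 : t (kappa (algebraMap K F Q) (a * b)) = kappa (algebraMap K F Q) a := by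
    rw [← t1, ht]
  have s3 : s (kappa (algebraMap K F Q) (a * b)) = kappa (algebraMap K F Q) (a * b) := by
    rw [map_kappa, map_mul, hsa, hsb]; congr 1; field_simp
  have t4 : t (kappa (algebraMap K F Q) (a ^ 2 * b)) = kappa (algebraMap K F Q) (a ^ 2 * b) := by
    rw [map_kappa, map_mul, map_pow, hta, htb]; congr 1; field_simp
  obtain ⟨p₁, e1⟩ : ∃ p, p = kappa (algebraMap K F Q) a := ⟨_, rfl⟩
  obtain ⟨p₂, e2⟩ : ∃ p, p = kappa (algebraMap K F Q) b := ⟨_, rfl⟩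
  obtain ⟨p₃, e3⟩ : ∃ p, p = kappa (algebraMap K F Q) (a * b) := ⟨_, rfl⟩
  obtain ⟨p₄, e4⟩ : ∃ p, p = kappa (algebraMap K F Q) (a ^ 2 * b) := ⟨_, rfl⟩
  have R₁ : p₁ * p₂ + (1 + algebraMap K F Q) * p₃ - algebraMap K F Q = p₃ * (p₁ + p₂) := by
    rw [e1, e2, e3]; exact kappa_mul_kappa h1a h1b h1
  have R₂ : p₁ * p₃ + (1 + algebraMap K F Q) * p₄ - algebraMap K F Q = p₄ * (p₁ + p₃) := by
    rw [e1, e3, e4, show a ^ 2 * b = a * (a * b) by ring]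
    exact kappa_mul_kappa h1a h1 (by rwa [show a * (a * b) = a ^ 2 * b by ring])
  simp only [← e1, ← e2, ← e3, ← e4] at s1 s2 s3 s4 t1 t2 t3 t4 ⊢
  ext f
  rw [dihedralKL_four_apply Q hs ht p₁ p₂ f (d₀ := p₁ * p₃ * p₄) (d₁ := t (s (p₁ * p₃ * p₄)))
      rfl rfl ?_ ?_,
    dihedralKL_four_apply Q ht hs p₂ p₁ f (d₀ := p₂ * p₃ * p₄) (d₁ := s (t (p₂ * p₃ * p₄)))
      rfl rfl ?_ ?_]
  · simp only [symmOp_apply, map_add, map_sub, map_mul, map_one, AlgHom.commutes, s1, s2, s3, s4,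
      t1, t2, t3, t4, hst]
    ring
  -- The first two identities belong to the expansion with the roles of `s` and `t` exchanged.
  all_goals
    simp only [map_add, map_sub, map_mul, map_one, AlgHom.commutes, s1, s2, s3, s4, t1, t2, t3, t4]
  · linear_combination p₂ * R₁ + p₂ * R₂
  · ring
  · linear_combination p₁ * R₁ + p₁ * R₂
  · ring

-- As for `B₂`, both sides are `∑_w w(π f)`, now over the dihedral group of order 12, with `π` the
-- product of `kappa` over the six positive roots of `G₂`.
set_option maxHeartbeats 1000000 in
set_option maxRecDepth 20000 in
include hs ht ha hb h1a h1b hsa htb in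
theorem dihedralKL_six_comm (hsb : s b = a ^ 3 * b) (hta : t a = a * b) (h1 : 1 - a * b ≠ 0)
    (h2 : 1 - a ^ 2 * b ≠ 0) (h3 : 1 - a ^ 3 * b ≠ 0) (h32 : 1 - a ^ 3 * b ^ 2 ≠ 0)
    (hst : ∀ x, s (t (s (t (s (t x))))) = t (s (t (s (t (s x)))))) :
    dihedralKL Q 6 (symmOp s (kappa (algebraMap K F Q) a)) (symmOp t (kappa (algebraMap K F Q) b))
      = dihedralKL Q 6 (symmOp t (kappa (algebraMap K F Q) b))
        (symmOp s (kappa (algebraMap K F Q) a)) := by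
  have s1 := map_kappa_of_inv Q ha h1a hsa
  have t2 := map_kappa_of_inv Q hb h1b htb
  have s2 : s (kappa (algebraMap K F Q) b) = kappa (algebraMap K F Q) (a ^ 3 * b) := by
    rw [map_kappa, hsb]
  have t1 : t (kappa (algebraMap K F Q) a) = kappa (algebraMap K F Q) (a * b) := by
    rw [map_kappa, hta]
  have s5 : s (kappa (algebraMap K F Q) (a ^ 3 * b)) = kappa (algebraMap K F Q) b := by
    rw [← s2, hs]
  have t3 : t (kappa (algebraMap K F Q) (a * b)) = kappa (algebraMap K F Q) a := by
    rw [← t1, ht]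
  have s3 : s (kappa (algebraMap K F Q) (a * b)) = kappa (algebraMap K F Q) (a ^ 2 * b) := by
    rw [map_kappa, map_mul, hsa, hsb]; congr 1; field_simp
  have s4 : s (kappa (algebraMap K F Q) (a ^ 2 * b)) = kappa (algebraMap K F Q) (a * b) := by
    rw [← s3, hs]
  have t4 : t (kappa (algebraMap K F Q) (a ^ 2 * b)) = kappa (algebraMap K F Q) (a ^ 2 * b) := by
    rw [map_kappa, map_mul, map_pow, hta, htb]; congr 1; field_simp
  have t5 : t (kappa (algebraMap K F Q) (a ^ 3 * b))
      = kappa (algebraMap K F Q) (a ^ 3 * b ^ 2) := by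
    rw [map_kappa, map_mul, map_pow, hta, htb]; congr 1; field_simp
  have t6 : t (kappa (algebraMap K F Q) (a ^ 3 * b ^ 2))
      = kappa (algebraMap K F Q) (a ^ 3 * b) := by
    rw [← t5, ht]
  have s6 : s (kappa (algebraMap K F Q) (a ^ 3 * b ^ 2))
      = kappa (algebraMap K F Q) (a ^ 3 * b ^ 2) := by
    rw [map_kappa, map_mul, map_pow, map_pow, hsa, hsb]; congr 1; field_simp
  obtain ⟨p₁, e1⟩ : ∃ p, p = kappa (algebraMap K F Q) a := ⟨_, rfl⟩
  obtain ⟨p₂, e2⟩ : ∃ p, p = kappa (algebraMap K F Q) b := ⟨_, rfl⟩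
  obtain ⟨p₃, e3⟩ : ∃ p, p = kappa (algebraMap K F Q) (a * b) := ⟨_, rfl⟩
  obtain ⟨p₄, e4⟩ : ∃ p, p = kappa (algebraMap K F Q) (a ^ 2 * b) := ⟨_, rfl⟩
  obtain ⟨p₅, e5⟩ : ∃ p, p = kappa (algebraMap K F Q) (a ^ 3 * b) := ⟨_, rfl⟩
  obtain ⟨p₆, e6⟩ : ∃ p, p = kappa (algebraMap K F Q) (a ^ 3 * b ^ 2) := ⟨_, rfl⟩
  simp only [← e1, ← e2, ← e3, ← e4, ← e5, ← e6] at s1 s2 s3 s4 s5 s6 t1 t2 t3 t4 t5 t6 ⊢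
  -- One relation for each of the five ways to write a positive root of `G₂` as a sum of two
  -- positive roots.
  have R₁ : p₁ * p₂ + (1 + algebraMap K F Q) * p₃ - algebraMap K F Q = p₃ * (p₁ + p₂) := by
    rw [e1, e2, e3]; exact kappa_mul_kappa h1a h1b h1
  have R₂ : p₁ * p₄ + (1 + algebraMap K F Q) * p₅ - algebraMap K F Q = p₅ * (p₁ + p₄) := by
    rw [e1, e4, e5, show a ^ 3 * b = a * (a ^ 2 * b) by ring]
    exact kappa_mul_kappa h1a h2 (by rwa [show a * (a ^ 2 * b) = a ^ 3 * b by ring])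
  have R₃ : p₁ * p₃ + (1 + algebraMap K F Q) * p₄ - algebraMap K F Q = p₄ * (p₁ + p₃) := by
    rw [e1, e3, e4, show a ^ 2 * b = a * (a * b) by ring]
    exact kappa_mul_kappa h1a h1 (by rwa [show a * (a * b) = a ^ 2 * b by ring])
  have R₄ : p₂ * p₅ + (1 + algebraMap K F Q) * p₆ - algebraMap K F Q = p₆ * (p₂ + p₅) := by
    rw [e2, e5, e6, show a ^ 3 * b ^ 2 = b * (a ^ 3 * b) by ring]
    exact kappa_mul_kappa h1b h3 (by rwa [show b * (a ^ 3 * b) = a ^ 3 * b ^ 2 by ring])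
  have R₅ : p₃ * p₄ + (1 + algebraMap K F Q) * p₆ - algebraMap K F Q = p₆ * (p₃ + p₄) := by
    rw [e3, e4, e6, show a ^ 3 * b ^ 2 = a * b * (a ^ 2 * b) by ring]
    exact kappa_mul_kappa h1 h2 (by rwa [show a * b * (a ^ 2 * b) = a ^ 3 * b ^ 2 by ring])
  ext f
  -- The intermediate `d₀` are not products of values of `kappa`: both contain the factor `p₁p₃ +
  -- p₄p₅ - p₁p₄`. Only the final `g₀` is a product, namely `π` without one simple factor.
  rw [dihedralKL_six_apply Q hs ht p₁ p₂ f (c₀ := p₁ * p₃)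
      (d₀ := p₁ * (p₁ * p₃ + p₄ * p₅ - p₁ * p₄))
      (g₀ := p₁ * p₃ * p₄ * p₅ * p₆)
      (g₁ := t (s (p₁ * p₃ * p₄ * p₅ * p₆))) (g₂ := t (s (t (s (p₁ * p₃ * p₄ * p₅ * p₆)))))
      ?_ rfl ?_ rfl rfl rfl rfl ?_ ?_ ?_,
    dihedralKL_six_apply Q ht hs p₂ p₁ f (c₀ := p₁ * p₂ + p₄ * p₅ - p₁ * p₄)
      (d₀ := p₂ * (p₁ * p₃ + p₄ * p₅ - p₁ * p₄)) (g₀ := p₂ * p₃ * p₄ * p₅ * p₆)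
      (g₁ := s (t (p₂ * p₃ * p₄ * p₅ * p₆))) (g₂ := s (t (s (t (p₂ * p₃ * p₄ * p₅ * p₆)))))
      ?_ rfl ?_ rfl rfl rfl rfl ?_ ?_ ?_]
  · simp only [symmOp_apply, map_add, map_sub, map_mul, map_one, AlgHom.commutes, s1, s2, s3, s4,
      s5, s6, t1, t2, t3, t4, t5, t6, hst]
    ring
  -- The first five identities belong to the expansion with `s` and `t` exchanged.
  all_goals
    simp only [map_add, map_sub, map_mul, map_one, AlgHom.commutes, s1, s2, s3, s4, s5, s6,
      t1, t2, t3, t4, t5, t6]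
  · linear_combination R₂
  · linear_combination p₂ * R₁
  · have hY : (1 + algebraMap K F Q - p₁) * p₄ + p₃ * p₂ - (1 + algebraMap K F Q - p₁) * p₃
        = p₃ * p₄ - p₁ * p₃ + p₁ * p₂ := by linear_combination R₃ - R₁
    -- The combination cancels the terms with `1 + Q` and leaves `Q` times a difference; `hE₂` is
    -- similar. Eliminating `Q` between the two gives the relation `hX`.
    have hE₁ : algebraMap K F Q * (p₅ - p₄)
        = p₁ * p₃ * p₅ - p₃ * p₄ * p₅ - p₁ * p₄ ^ 2 + p₄ ^ 2 * p₅ := by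
      linear_combination p₄ * R₂ - p₅ * R₃
    have hE₂ : algebraMap K F Q * (p₄ - p₃)
        = p₁ * p₂ * p₄ - p₂ * p₃ * p₄ - p₁ * p₃ ^ 2 + p₃ ^ 2 * p₄ := by
      linear_combination p₃ * R₃ - p₄ * R₁
    have hX : p₄ * (p₅ - p₄) * p₂ * (p₁ - p₃)
        = (p₄ - p₃) * (p₁ * p₃ * p₅ - p₃ * p₄ * p₅ - p₁ * p₄ ^ 2 + p₄ ^ 2 * p₅)
          + (p₅ - p₄) * p₃ ^ 2 * (p₁ - p₄) := by
      linear_combination (p₄ - p₃) * hE₁ - (p₅ - p₄) * hE₂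
    linear_combination p₂ * ((p₁ * p₃ + p₄ * p₅ - p₁ * p₄) * R₁
      + (1 + algebraMap K F Q - p₁) * p₅ * hY + (p₃ * p₄ - p₁ * p₃ + p₁ * p₂) * R₂
      + (1 + algebraMap K F Q - p₂) * p₃ * R₅ + p₃ * p₄ * R₄ - p₃ * p₄ * R₁
      + (p₁ - p₄) * hE₂ - p₄ * hE₁ + hX)
  · linear_combination
      p₂ * (1 + algebraMap K F Q - p₁) * (1 + algebraMap K F Q - p₅) * (R₁ + R₃)
  · ring
  · linear_combination R₁
  · linear_combination p₁ * R₂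
  · rw [e1, e2, e3, e4, e5, e6]
    unfold kappa
    field_simp
    ring
  · linear_combination
      p₁ * (1 + algebraMap K F Q - p₂) * (1 + algebraMap K F Q - p₃) * (R₂ + R₃)
  · ring

end DihedralBraid

/-! ### The coefficient ring, the group algebra and its field of fractions. -/

section CoefficientRing

variable {ι V V' : Type*} [AddCommGroup V] [Module ℝ V] [AddCommGroup V'] [Module ℝ V']
variable {R : RootPairing ι ℝ V V'} (b : R.Base)
variable [Finite ι] [R.IsRootSystem]

theorem map_poincare {A B : Type*} [CommRing A] [CommRing B] (f : A →+* B) (t : A) :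
    f (poincare b t) = poincare b (f t) := by
  simp [poincare]

/-- The specialization `q ↦ 1` of Laurent polynomials. -/
def laurentEvalOne : LaurentPolynomial ℤ →+* ℚ :=
  (AddMonoidAlgebra.lift ℤ ℚ ℤ 1).toRingHom

theorem laurentEvalOne_T (n : ℤ) : laurentEvalOne (LaurentPolynomial.T n) = 1 := by
  change AddMonoidAlgebra.lift ℤ ℚ ℤ 1 (AddMonoidAlgebra.single n 1) = 1
  rw [AddMonoidAlgebra.lift_single]
  simp

theorem laurentEvalOne_poincare : laurentEvalOne (poincare b (LaurentPolynomial.T 2)) =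
    Fintype.card R.weylGroup := by
  rw [map_poincare, laurentEvalOne_T]
  simp [poincare]

theorem poincare_ne_zero : poincare b (LaurentPolynomial.T 2 : LaurentPolynomial ℤ) ≠ 0 := by
  intro h
  have h1 := laurentEvalOne_poincare b
  rw [h, map_zero] at h1
  exact Fintype.card_ne_zero (α := R.weylGroup) (by exact_mod_cast h1.symm)

instance : IsDomain (Coeff b) :=
  IsLocalization.isDomain_localization
    (powers_le_nonZeroDivisors_of_noZeroDivisors (poincare_ne_zero b))

/-- The specialization `q ↦ 1` of the coefficient ring. -/
def coeffEvalOne : Coeff b →+* ℚ :=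
  IsLocalization.Away.lift (poincare b (LaurentPolynomial.T 2 : LaurentPolynomial ℤ))
    (g := laurentEvalOne) (by
      rw [laurentEvalOne_poincare, isUnit_iff_ne_zero]
      exact_mod_cast Fintype.card_ne_zero)

theorem coeffEvalOne_q : coeffEvalOne b (q b) = 1 := by
  rw [coeffEvalOne, q, IsLocalization.Away.lift_eq, laurentEvalOne_T]

theorem coeffEvalOne_qInv : coeffEvalOne b (qInv b) = 1 := by
  rw [coeffEvalOne, qInv, IsLocalization.Away.lift_eq, laurentEvalOne_T]

/-- The specialization `q ↦ 1` reaches `ℚ` because `W₀(q²)` becomes `|W| ≠ 0`. Characteristic zero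
is what later allows `|W|` to be cancelled. -/
instance : CharZero (Coeff b) := (coeffEvalOne b).charZero

theorem q_mul_qInv : q b * qInv b = 1 := by
  rw [q, qInv, ← map_mul, ← LaurentPolynomial.T_add]
  simp

theorem qInv_mul_q : qInv b * q b = 1 := by rw [mul_comm, q_mul_qInv]

theorem q_add_qInv_ne_zero : q b + qInv b ≠ 0 := by
  intro h
  have := congrArg (coeffEvalOne b) h
  rw [map_add, coeffEvalOne_q, coeffEvalOne_qInv, map_zero] at this
  norm_num at this

theorem isUnit_poincare_q : IsUnit (poincare b (q b ^ 2)) := by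
  have h : algebraMap _ (Coeff b) (poincare b (LaurentPolynomial.T 2 : LaurentPolynomial ℤ))
      = poincare b (q b ^ 2) := by
    rw [map_poincare, q, ← map_pow, LaurentPolynomial.T_pow]
    simp
  rw [← h]
  exact IsLocalization.Away.algebraMap_isUnit _

/-- Multiplication by the longest element gives `W₀(q²) = q^{2N} W₀(q⁻²)` with `N` the number of
positive roots, so inverting `W₀(q²)` suffices to define `ε₀` as well. -/
theorem isUnit_poincare_qInv [R.IsCrystallographic] [R.IsReduced] :
    IsUnit (poincare b (qInv b ^ 2)) := by
  obtain ⟨w₀, hw₀⟩ := exists_longest b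
  have h : poincare b (q b ^ 2) = (q b ^ 2) ^ {i | b.IsPos i}.ncard * poincare b (qInv b ^ 2) := by
    simp only [poincare]
    rw [← Equiv.sum_comp (Equiv.mulLeft w₀), Finset.mul_sum]
    refine Finset.sum_congr rfl fun w _ => ?_
    rw [Equiv.coe_mulLeft, ← hw₀ w, pow_add]
    have : (q b ^ 2) ^ length b w * (qInv b ^ 2) ^ length b w = 1 := by
      rw [← mul_pow, ← mul_pow, q_mul_qInv, one_pow, one_pow]
    linear_combination -(q b ^ 2) ^ length b (w₀ * w) * this
  have := isUnit_poincare_q b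
  rw [h] at this
  exact isUnit_of_mul_isUnit_right this

/-- The lattice embeds in a rational vector space; unique sums are what make `𝕂[P]` a domain. -/
instance : TwoUniqueSums (weightLattice R) :=
  letI : Module ℚ V := Module.compHom V (algebraMap ℚ ℝ)
  TwoUniqueSums.of_injective_addHom (weightLattice R).subtype.toAddHom
    (Subtype.val_injective) inferInstance

instance : IsDomain (GroupAlg b) := NoZeroDivisors.to_isDomain _

theorem monomial_add (μ ν : weightLattice R) :
    monomial b (μ + ν) = monomial b μ * monomial b ν := by
  simp [monomial, AddMonoidAlgebra.single_mul_single]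

theorem monomial_zero : monomial b (0 : weightLattice R) = 1 := rfl

theorem monomial_injective : Function.Injective (monomial b) :=
  AddMonoidAlgebra.single_left_injective one_ne_zero

theorem monomial_ne_zero (μ : weightLattice R) : monomial b μ ≠ 0 := by
  simp [monomial]

theorem groupAlg_induction {p : GroupAlg b → Prop} (h : ∀ μ, p (monomial b μ))
    (add : ∀ f g, p f → p g → p (f + g)) (smul : ∀ (r : Coeff b) f, p f → p (r • f))
    (f : GroupAlg b) : p f :=
  AddMonoidAlgebra.induction_on f (fun m => h m) add smul

variable [R.IsCrystallographic]

theorem weylAct_monomial (w : R.weylGroup) (μ : weightLattice R) :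
    weylAct b w (monomial b μ) = monomial b (w • μ) := by
  simp [weylAct, monomial]

theorem weylAct_mul (w w' : R.weylGroup) (f : GroupAlg b) :
    weylAct b (w * w') f = weylAct b w (weylAct b w' f) := by
  refine groupAlg_induction b (p := fun f => weylAct b (w * w') f = weylAct b w (weylAct b w' f))
    ?_ ?_ ?_ f
  · intro μ; simp only [weylAct_monomial, mul_smul]
  · intro f g hf hg; simp only [map_add, hf, hg]
  · intro r f hf; simp only [map_smul, hf]

theorem weylAct_one (f : GroupAlg b) : weylAct b 1 f = f := by
  refine groupAlg_induction b (p := fun f => weylAct b 1 f = f) ?_ ?_ ?_ f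
  · intro μ; simp only [weylAct_monomial, one_smul]
  · intro f g hf hg; simp only [map_add, hf, hg]
  · intro r f hf; simp only [map_smul, hf]

theorem weylAct_injective (w : R.weylGroup) : Function.Injective (weylAct b w) := by
  intro f g h
  have := congrArg (weylAct b w⁻¹) h
  rwa [← weylAct_mul, ← weylAct_mul, inv_mul_cancel, weylAct_one, weylAct_one] at this

theorem coeff_weylAct (w : R.weylGroup) (f : GroupAlg b) (μ : weightLattice R) :
    (weylAct b w f).coeff (w • μ) = f.coeff μ := by
  classical
  refine groupAlg_induction b (p := fun f => (weylAct b w f).coeff (w • μ) = f.coeff μ) ?_ ?_ ?_ f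
  · intro ν
    rw [weylAct_monomial]
    simp only [monomial, AddMonoidAlgebra.coeff_single, Finsupp.single_apply,
      smul_left_cancel_iff]
  · intro f g hf hg; simp [hf, hg]
  · intro r f hf; simp [hf]

/-- A function invariant under the simple reflections is symmetric. -/
theorem mem_symmetric_of_simple [R.IsReduced] {f : GroupAlg b}
    (h : ∀ i, weylAct b (simpleReflection b i) f = f) : f ∈ symmetric b := by
  intro w
  refine length_induction b (p := fun w => weylAct b w f = f) (weylAct_one b f) ?_ w
  intro i w _ hw
  rw [weylAct_mul, hw, h]

theorem rootWeight_ne_zero (i : ι) : rootWeight R i ≠ 0 := by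
  intro h
  exact R.ne_zero i (congrArg Subtype.val h)

theorem one_sub_monomial_ne_zero {μ : weightLattice R} (hμ : μ ≠ 0) : 1 - monomial b μ ≠ 0 := by
  intro h
  rw [← monomial_zero, sub_eq_zero] at h
  exact hμ (monomial_injective b h).symm

/-- The field of fractions of `𝕂[P]`. -/
abbrev RatFun : Type _ := FractionRing (GroupAlg b)

theorem toAlgHom_comp_weylAct_injective (w : R.weylGroup) : Function.Injective
    ⇑((IsScalarTower.toAlgHom (Coeff b) (GroupAlg b) (RatFun b)).comp (weylAct b w)) :=
  fun _ _ h => weylAct_injective b w (IsFractionRing.injective (GroupAlg b) (RatFun b) h)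

/-- The action of `w ∈ W` on the fractions. -/
def weylFrac (w : R.weylGroup) : RatFun b →ₐ[Coeff b] RatFun b :=
  IsFractionRing.liftAlgHom
    (g := (IsScalarTower.toAlgHom (Coeff b) (GroupAlg b) (RatFun b)).comp (weylAct b w))
    (toAlgHom_comp_weylAct_injective b w)

theorem weylFrac_algebraMap (w : R.weylGroup) (f : GroupAlg b) :
    weylFrac b w (algebraMap _ _ f) = algebraMap _ _ (weylAct b w f) := by
  rw [weylFrac, IsFractionRing.liftAlgHom_apply]
  exact IsFractionRing.lift_algebraMap _ _

theorem weylFrac_mul (w w' : R.weylGroup) (f : RatFun b) :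
    weylFrac b (w * w') f = weylFrac b w (weylFrac b w' f) := by
  obtain ⟨x, y, hy, rfl⟩ := IsFractionRing.div_surjective (A := GroupAlg b) f
  simp only [map_div₀, weylFrac_algebraMap, weylAct_mul]

theorem weylFrac_one (f : RatFun b) : weylFrac b 1 f = f := by
  obtain ⟨x, y, hy, rfl⟩ := IsFractionRing.div_surjective (A := GroupAlg b) f
  simp only [map_div₀, weylFrac_algebraMap, weylAct_one]

theorem weylFrac_simple_simple (i : b.support) (f : RatFun b) :
    weylFrac b (simpleReflection b i) (weylFrac b (simpleReflection b i) f) = f := by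
  rw [← weylFrac_mul, simpleReflection_mul_self, weylFrac_one]

end CoefficientRing

/-! ### Orders of products of two simple reflections. -/

section RankTwo

variable {ι V V' : Type*} [AddCommGroup V] [Module ℝ V] [AddCommGroup V'] [Module ℝ V']
variable {R : RootPairing ι ℝ V V'} (b : R.Base)
variable [Finite ι] [R.IsRootSystem] [R.IsCrystallographic] [R.IsReduced]

theorem simpleReflection_smul (i : b.support) (v : V) :
    simpleReflection b i • v = v - R.coroot' i v • R.root i :=
  R.reflection_apply i v

theorem weylGroup_eq_one_of_smul {w : R.weylGroup} (h : ∀ v : V, w • v = v) : w = 1 := by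
  refine weylGroup_ext fun i => R.root.injective ?_
  rw [root_weylGroupToPerm, h, map_one]
  rfl

theorem root_ne_neg_self (i : ι) : R.root i ≠ -R.root i := by
  intro h
  have h1 : (2 : ℝ) • R.root i = 0 := by
    rw [two_smul]
    nth_rewrite 1 [h]
    exact neg_add_cancel _
  exact R.ne_zero i ((smul_eq_zero.1 h1).resolve_left two_ne_zero)

/-- The pairings of two distinct simple roots, up to exchanging the two. -/
theorem simple_pairing_cases {i j : b.support} (hij : i ≠ j) :
    (R.pairingIn ℤ i j = 0 ∧ R.pairingIn ℤ j i = 0) ∨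
    (R.pairingIn ℤ i j = -1 ∧ R.pairingIn ℤ j i ∈ ({-1, -2, -3} : Set ℤ)) ∨
    (R.pairingIn ℤ j i = -1 ∧ R.pairingIn ℤ i j ∈ ({-1, -2, -3} : Set ℤ)) := by
  have hij' : (i : ι) ≠ j := fun h => hij (Subtype.ext h)
  have h1 : R.root i ≠ R.root j := fun h => hij' (R.root.injective h)
  have h2 : R.root i ≠ -R.root j := by
    intro h
    have h3 : (i : ι) = R.reflectionPerm j j := R.root.injective (by rw [h, root_reflectionPerm_self])
    have := isPos_simple b i
    rw [h3, isPos_reflectionPerm_self_iff] at this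
    exact this (isPos_simple b j)
  have h3 := R.pairingIn_pairingIn_mem_set_of_isCrystal_of_isRed' i j h1 h2
  have h4 := b.pairingIn_le_zero_of_ne hij' i.2 j.2
  simp only [Set.mem_insert_iff, Set.mem_singleton_iff, Prod.mk.injEq] at h3 ⊢
  omega

section

variable {i j : b.support} {k : ℤ} (hij : R.pairingIn ℤ i j = -1) (hji : R.pairingIn ℤ j i = -k)

theorem coroot'_root_eq (i j : ι) : R.coroot' i (R.root j) = R.pairingIn ℤ j i := by
  rw [R.root_coroot'_eq_pairing]
  exact (R.algebraMap_pairingIn ℤ j i).symm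

/-- The product moves every vector by an element of the plane of `αᵢ` and `αⱼ`, so its order can be
computed from its action on this plane, even if `V` is larger. -/
theorem exists_simple_mul_simple_smul (i j : b.support) (v : V) : ∃ c d : ℝ,
    (simpleReflection b i * simpleReflection b j) • v = v - c • R.root i - d • R.root j := by
  refine ⟨R.coroot' i v - R.coroot' j v * R.coroot' i (R.root j), R.coroot' j v, ?_⟩
  rw [mul_smul, simpleReflection_smul, simpleReflection_smul, map_sub, map_smul, smul_eq_mul]
  module

include hij hji

theorem simple_mul_simple_smul_left :
    (simpleReflection b i * simpleReflection b j) • R.root i =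
      ((k : ℝ) - 1) • R.root i + R.root j := by
  rw [mul_smul, simpleReflection_smul, simpleReflection_smul, map_sub, map_smul, smul_eq_mul]
  simp only [coroot'_root_eq, hij, hji, pairingIn_same]
  push_cast
  module

theorem simple_mul_simple_smul_right :
    (simpleReflection b i * simpleReflection b j) • R.root j =
      -(k : ℝ) • R.root i - R.root j := by
  rw [mul_smul, simpleReflection_smul, simpleReflection_smul, map_sub, map_smul, smul_eq_mul]
  simp only [coroot'_root_eq, hji, pairingIn_same]
  push_cast
  module

end

theorem orderOf_simple_mul_simple_of_orthogonal {i j : b.support}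
    (hij : R.pairingIn ℤ i j = 0) (hji : R.pairingIn ℤ j i = 0) :
    orderOf (simpleReflection b i * simpleReflection b j) = 2 := by
  have hα : (simpleReflection b i * simpleReflection b j) • R.root i = -R.root i := by
    rw [mul_smul, simpleReflection_smul, simpleReflection_smul, map_sub, map_smul, smul_eq_mul]
    simp only [coroot'_root_eq, hij, hji, pairingIn_same]
    push_cast
    module
  have hβ : (simpleReflection b i * simpleReflection b j) • R.root j = -R.root j := by
    rw [mul_smul, simpleReflection_smul, simpleReflection_smul, map_sub, map_smul, smul_eq_mul]
    simp only [coroot'_root_eq, hji, pairingIn_same]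
    push_cast
    module
  have hv := exists_simple_mul_simple_smul b i j
  generalize simpleReflection b i * simpleReflection b j = x at *
  refine orderOf_eq_prime ?_ ?_
  · refine weylGroup_eq_one_of_smul fun v => ?_
    obtain ⟨c, d, h⟩ := hv v
    simp only [pow_succ, pow_zero, one_mul, mul_smul, h, smul_sub, smul_comm x c, smul_comm x d,
      hα, hβ]
    module
  · rintro rfl
    rw [one_smul] at hα
    exact root_ne_neg_self _ hα

theorem simple_root_ne {i j : b.support} (hij : i ≠ j) : R.root j ≠ R.root i :=
  fun h => hij (Subtype.ext (R.root.injective h)).symm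

theorem orderOf_simple_mul_simple_three {i j : b.support} (hne : i ≠ j)
    (hij : R.pairingIn ℤ i j = -1) (hji : R.pairingIn ℤ j i = -1) :
    orderOf (simpleReflection b i * simpleReflection b j) = 3 := by
  have hα := simple_mul_simple_smul_left b hij hji
  have hβ := simple_mul_simple_smul_right b hij hji
  have hv := exists_simple_mul_simple_smul b i j
  generalize simpleReflection b i * simpleReflection b j = x at *
  have : Fact (Nat.Prime 3) := ⟨Nat.prime_three⟩
  refine orderOf_eq_prime ?_ ?_
  · refine weylGroup_eq_one_of_smul fun v => ?_
    obtain ⟨c, d, h⟩ := hv v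
    simp only [pow_succ, pow_zero, one_mul, mul_smul, h, smul_sub, smul_add, smul_comm x (_ : ℝ),
      hα, hβ]
    push_cast
    module
  · rintro rfl
    rw [one_smul] at hα
    apply simple_root_ne b hne
    rw [hα]
    simp

theorem orderOf_simple_mul_simple_four {i j : b.support}
    (hij : R.pairingIn ℤ i j = -1) (hji : R.pairingIn ℤ j i = -2) :
    orderOf (simpleReflection b i * simpleReflection b j) = 4 := by
  have hα := simple_mul_simple_smul_left b hij hji
  have hβ := simple_mul_simple_smul_right b hij hji
  have hv := exists_simple_mul_simple_smul b i j
  generalize simpleReflection b i * simpleReflection b j = x at *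
  refine orderOf_eq_prime_pow (p := 2) (n := 1) ?_ ?_
  · intro h
    have h1 : x ^ 2 • R.root i = -R.root i := by
      simp only [pow_succ, pow_zero, one_mul, mul_smul, smul_add, smul_comm x (_ : ℝ),
        hα, hβ]
      push_cast
      module
    rw [pow_one] at h
    rw [h, one_smul] at h1
    exact root_ne_neg_self _ h1
  · change x ^ 4 = 1
    refine weylGroup_eq_one_of_smul fun v => ?_
    obtain ⟨c, d, h⟩ := hv v
    simp only [pow_succ, pow_zero, one_mul, mul_smul, h, smul_sub,
      smul_add, smul_comm x (_ : ℝ), hα, hβ]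
    push_cast
    module

theorem orderOf_simple_mul_simple_six {i j : b.support}
    (hij : R.pairingIn ℤ i j = -1) (hji : R.pairingIn ℤ j i = -3) :
    orderOf (simpleReflection b i * simpleReflection b j) = 6 := by
  have hα := simple_mul_simple_smul_left b hij hji
  have hβ := simple_mul_simple_smul_right b hij hji
  have hv := exists_simple_mul_simple_smul b i j
  generalize simpleReflection b i * simpleReflection b j = x at *
  have h2 : x ^ 2 • R.root i = R.root i + R.root j := by
    simp only [pow_succ, pow_zero, one_mul, mul_smul, smul_add, smul_comm x (_ : ℝ), hα, hβ]
    push_cast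
    module
  have h3 : x ^ 3 • R.root i = -R.root i := by
    rw [pow_succ', mul_smul, h2, smul_add, hα, hβ]
    push_cast
    module
  have h3' : x ^ 3 • R.root j = -R.root j := by
    simp only [pow_succ, pow_zero, one_mul, mul_smul, smul_sub, smul_add,
      smul_comm x (_ : ℝ), hα, hβ]
    push_cast
    module
  refine orderOf_eq_of_pow_and_pow_div_prime (by norm_num) ?_ ?_
  · refine weylGroup_eq_one_of_smul fun v => ?_
    obtain ⟨c, d, h⟩ := hv v
    -- The coefficients are those of `(1 + x + x²)(cαᵢ + dαⱼ)`. As `x³` is `-1` on the plane,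
    -- applying it twice cancels the displacement.
    have h4 : ∃ c d : ℝ, x ^ 3 • v = v - c • R.root i - d • R.root j := by
      refine ⟨c * 4 - d * 6, c * 2 - d * 2, ?_⟩
      simp only [pow_succ, pow_zero, one_mul, mul_smul, h, smul_sub, smul_add,
        smul_comm x (_ : ℝ), hα, hβ]
      push_cast
      module
    obtain ⟨c, d, h4⟩ := h4
    rw [show 6 = 3 + 3 from rfl, pow_add, mul_smul, h4, smul_sub, smul_sub, smul_comm _ c,
      smul_comm _ d, h3, h3', h4]
    module
  · intro p hp hpd h
    have : p = 2 ∨ p = 3 := by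
      have : p ≤ 6 := Nat.le_of_dvd (by norm_num) hpd
      interval_cases p <;> revert hp hpd <;> norm_num
    rcases this with rfl | rfl
    · rw [show 6 / 2 = 3 from rfl] at h
      rw [h, one_smul] at h3
      exact root_ne_neg_self _ h3
    · rw [show 6 / 3 = 2 from rfl] at h
      rw [h, one_smul, left_eq_add] at h2
      exact R.ne_zero _ h2

end RankTwo

/-- For `C = 1 + qT` the quadratic relation of `T` takes the form `C² = (1 + q²)C`. -/
theorem smul_sub_one_mul_self {K A : Type*} [CommRing K] [Ring A] [Algebra K A] {q q' : K}
    (h : q' * q = 1) {C : A} (hC : C * C = (1 + q ^ 2) • C) :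
    (q' • (C - 1)) * (q' • (C - 1)) = (q - q') • (q' • (C - 1)) + 1 := by
  have e1 : q' * q' * q ^ 2 = 1 := by linear_combination (q' * q + 1) * h
  rw [smul_mul_smul_comm, sub_mul, mul_sub, mul_sub, hC, one_mul, mul_one, one_mul]
  have e2 : (q' * q') • ((1 + q ^ 2) • C - C - (C - 1))
      = (q' * q' * q ^ 2 - q' * q') • C + (q' * q') • (1 : A) := by
    module
  have e3 : (q - q') • q' • (C - 1) + 1 =
      (q' * q - q' * q') • C + (1 + q' * q' - q' * q) • (1 : A) := by
    module
  rw [e2, e3, e1, h]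
  module

/-! ### Quadratic and braid relations for the Demazure–Lusztig operators. -/

section PolynomialRepresentation

variable {ι V V' : Type*} [AddCommGroup V] [Module ℝ V] [AddCommGroup V'] [Module ℝ V']
variable {R : RootPairing ι ℝ V V'} (b : R.Base)
variable [Finite ι] [R.IsRootSystem] [R.IsCrystallographic] [R.IsReduced]

theorem weightPairing_eq_of_coroot' {μ : weightLattice R} {i : ι} {n : ℤ}
    (h : R.coroot' i (μ : V) = n) : weightPairing μ i = n := by
  rw [weightPairing_spec] at h
  exact_mod_cast h

theorem weightPairing_rootWeight (i j : ι) :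
    weightPairing (rootWeight R i) j = R.pairingIn ℤ i j :=
  weightPairing_eq_of_coroot' (coroot'_root_eq j i)

theorem simpleReflection_smul_weight (i : b.support) (μ : weightLattice R) :
    simpleReflection b i • μ = μ - weightPairing μ i • rootWeight R i :=
  ofIdx_smul_weight _ _

/-- `x^{-αᵢ}`, as a fraction. -/
def zFrac (i : ι) : RatFun b := algebraMap (GroupAlg b) _ (monomial b (-rootWeight R i))

theorem algebraMap_ne_zero_iff (f : GroupAlg b) : algebraMap _ (RatFun b) f ≠ 0 ↔ f ≠ 0 :=
  (map_ne_zero_iff _ (IsFractionRing.injective (GroupAlg b) (RatFun b)))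

theorem zFrac_ne_zero (i : ι) : zFrac b i ≠ 0 :=
  (algebraMap_ne_zero_iff b _).2 (monomial_ne_zero b _)

theorem one_sub_zFrac_ne_zero (i : ι) : 1 - zFrac b i ≠ 0 := by
  rw [zFrac, ← map_one (algebraMap (GroupAlg b) (RatFun b)), ← map_sub, algebraMap_ne_zero_iff]
  exact one_sub_monomial_ne_zero b (neg_ne_zero.2 (rootWeight_ne_zero i))

theorem weylFrac_zFrac_self (i : b.support) :
    weylFrac b (simpleReflection b i) (zFrac b i) = (zFrac b i)⁻¹ := by
  apply eq_inv_of_mul_eq_one_left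
  rw [zFrac, weylFrac_algebraMap, weylAct_monomial, ← map_mul, ← monomial_add, smul_neg,
    simpleReflection_smul_weight, weightPairing_rootWeight, pairingIn_same,
    show -(rootWeight R i - (2 : ℤ) • rootWeight R i) + -rootWeight R i = 0 by abel,
    monomial_zero, map_one]

theorem zFrac_pow_mul (i j : ι) (k l : ℕ) : zFrac b i ^ k * zFrac b j ^ l =
    algebraMap _ _ (monomial b (-(k • rootWeight R i + l • rootWeight R j))) := by
  have h : ∀ (i : ι) (k : ℕ), monomial b (-rootWeight R i) ^ k
      = monomial b (-(k • rootWeight R i)) := by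
    intro i k
    induction k with
    | zero => simp [monomial_zero]
    | succ k ih =>
      rw [pow_succ, ih, ← monomial_add]
      congr 1
      rw [succ_nsmul]
      abel
  rw [zFrac, zFrac, ← map_pow, ← map_pow, ← map_mul, h, h, ← monomial_add, neg_add]

theorem weylFrac_zFrac {i j : b.support} {k : ℕ} (h : R.pairingIn ℤ j i = -(k : ℤ)) :
    weylFrac b (simpleReflection b i) (zFrac b j) = zFrac b i ^ k * zFrac b j := by
  have := zFrac_pow_mul b i j k 1
  rw [pow_one] at this
  rw [this, zFrac, weylFrac_algebraMap, weylAct_monomial, smul_neg, simpleReflection_smul_weight,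
    weightPairing_rootWeight, h]
  congr 3
  simp only [neg_smul, one_smul, natCast_zsmul]
  abel

/-- The operator `1 + q Tᵢ` of the polynomial representation. -/
def opC (i : b.support) : Module.End (Coeff b) (RatFun b) :=
  symmOp (weylFrac b (simpleReflection b i)) (kappa (algebraMap (Coeff b) _ (q b ^ 2)) (zFrac b i))

/-- The operator `Tᵢ` of the polynomial representation. -/
def opT (i : b.support) : Module.End (Coeff b) (RatFun b) := qInv b • (opC b i - 1)

theorem one_add_q_smul_opT (i : b.support) : 1 + q b • opT b i = opC b i := by
  rw [opT, smul_smul, q_mul_qInv, one_smul, add_sub_cancel]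

/-- The image of `opC` consists of `sᵢ`-invariants, and on these it multiplies by `κ(z) + κ(z⁻¹) = 1
+ q²`. -/
theorem opC_mul_self (i : b.support) : opC b i * opC b i = (1 + q b ^ 2) • opC b i := by
  ext f
  rw [Module.End.mul_apply, LinearMap.smul_apply]
  have h := symmOp_invariant (K := Coeff b) (weylFrac_simple_simple b i)
    (kappa (algebraMap (Coeff b) _ (q b ^ 2)) (zFrac b i)) f
  change weylFrac b (simpleReflection b i) (opC b i f) = opC b i f at h
  generalize opC b i f = g at h
  rw [opC, symmOp_apply, map_mul, h, map_kappa_of_inv _ (zFrac_ne_zero b i)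
    (one_sub_zFrac_ne_zero b i) (weylFrac_zFrac_self b i), Algebra.smul_def, map_add, map_one]
  ring

theorem opT_mul_self (i : b.support) :
    opT b i * opT b i = (q b - qInv b) • opT b i + 1 :=
  smul_sub_one_mul_self (qInv_mul_q b) (opC_mul_self b i)

theorem weylFrac_altProd_comm (i j : b.support) (m : ℕ)
    (h : (simpleReflection b i * simpleReflection b j) ^ m = 1) (x : RatFun b) :
    weylFrac b (altProd m (simpleReflection b i) (simpleReflection b j)) x =
    weylFrac b (altProd m (simpleReflection b j) (simpleReflection b i)) x := by
  rw [altProd_eq_pow_mul (simpleReflection_mul_self b i) (simpleReflection_mul_self b j), h,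
    one_mul]

theorem one_sub_zFrac_pow_mul_ne_zero {i j : b.support} (hij : i ≠ j) (k l : ℕ) (h : l ≠ 0) :
    1 - zFrac b i ^ k * zFrac b j ^ l ≠ 0 := by
  classical
  rw [zFrac_pow_mul, ← map_one (algebraMap (GroupAlg b) (RatFun b)), ← map_sub,
    algebraMap_ne_zero_iff]
  refine one_sub_monomial_ne_zero b (neg_ne_zero.2 fun h0 => ?_)
  have h1 : (k : ℝ) • R.root i + (l : ℝ) • R.root j = 0 := by
    have := congrArg Subtype.val h0
    simpa [rootWeight, Nat.cast_smul_eq_nsmul] using this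
  have h2 := congrArg (fun v => b.toWeightBasis.repr v j) h1
  simp [hij] at h2
  exact h h2

/-- The values `k = 1, 2, 3` are the types `A₂`, `B₂`, `G₂`, with `αᵢ` the short root when `k > 1`.
-/
theorem opC_braid_of_pairing {i j : b.support} (hij : i ≠ j) {k : ℕ}
    (h1 : R.pairingIn ℤ i j = -1) (h2 : R.pairingIn ℤ j i = -(k : ℤ))
    (hk : k = 1 ∨ k = 2 ∨ k = 3) :
    dihedralKL (q b ^ 2) (orderOf (simpleReflection b i * simpleReflection b j))
      (opC b i) (opC b j)
    = dihedralKL (q b ^ 2) (orderOf (simpleReflection b i * simpleReflection b j))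
      (opC b j) (opC b i) := by
  have hx := weylFrac_altProd_comm b i j _ (pow_orderOf_eq_one _)
  have hb := weylFrac_zFrac b h2
  have ha : weylFrac b (simpleReflection b j) (zFrac b i) = zFrac b i * zFrac b j := by
    rw [weylFrac_zFrac b (k := 1) (by simpa using h1), pow_one, mul_comm]
  have n1 := one_sub_zFrac_pow_mul_ne_zero b hij 1 1 one_ne_zero
  have n2 := one_sub_zFrac_pow_mul_ne_zero b hij 2 1 one_ne_zero
  have n3 := one_sub_zFrac_pow_mul_ne_zero b hij 3 1 one_ne_zero
  have n4 := one_sub_zFrac_pow_mul_ne_zero b hij 3 2 two_ne_zero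
  rw [pow_one] at n1 n2 n3
  rw [pow_one] at n1
  rcases hk with rfl | rfl | rfl
  · have ho := orderOf_simple_mul_simple_three b hij h1 (by simpa using h2)
    rw [ho] at hx ⊢
    simp only [altProd, weylFrac_mul, mul_one] at hx
    rw [pow_one] at hb
    exact dihedralKL_three_comm _ (weylFrac_simple_simple b i) (weylFrac_simple_simple b j)
      (zFrac_ne_zero b i) (zFrac_ne_zero b j) (one_sub_zFrac_ne_zero b i)
      (one_sub_zFrac_ne_zero b j) (weylFrac_zFrac_self b i) (weylFrac_zFrac_self b j) hb ha n1 hx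
  · have ho := orderOf_simple_mul_simple_four b h1 (by simpa using h2)
    rw [ho] at hx ⊢
    simp only [altProd, weylFrac_mul, mul_one] at hx
    exact dihedralKL_four_comm _ (weylFrac_simple_simple b i) (weylFrac_simple_simple b j)
      (zFrac_ne_zero b i) (zFrac_ne_zero b j) (one_sub_zFrac_ne_zero b i)
      (one_sub_zFrac_ne_zero b j) (weylFrac_zFrac_self b i) (weylFrac_zFrac_self b j) hb ha n1 n2 hx
  · have ho := orderOf_simple_mul_simple_six b h1 (by simpa using h2)
    rw [ho] at hx ⊢
    simp only [altProd, weylFrac_mul, mul_one] at hx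
    exact dihedralKL_six_comm _ (weylFrac_simple_simple b i) (weylFrac_simple_simple b j)
      (zFrac_ne_zero b i) (zFrac_ne_zero b j) (one_sub_zFrac_ne_zero b i)
      (one_sub_zFrac_ne_zero b j) (weylFrac_zFrac_self b i) (weylFrac_zFrac_self b j) hb ha
      n1 n2 n3 n4 hx

theorem orderOf_simple_mul_comm (i j : b.support) :
    orderOf (simpleReflection b i * simpleReflection b j)
      = orderOf (simpleReflection b j * simpleReflection b i) := by
  rw [← orderOf_inv, mul_inv_rev, simpleReflection_inv, simpleReflection_inv]

theorem opC_braid {i j : b.support} (hij : i ≠ j) :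
    dihedralKL (q b ^ 2) (orderOf (simpleReflection b i * simpleReflection b j))
      (opC b i) (opC b j)
    = dihedralKL (q b ^ 2) (orderOf (simpleReflection b i * simpleReflection b j))
      (opC b j) (opC b i) := by
  have key : ∀ {i j : b.support}, i ≠ j → R.pairingIn ℤ i j = -1 →
      R.pairingIn ℤ j i ∈ ({-1, -2, -3} : Set ℤ) →
      dihedralKL (q b ^ 2) (orderOf (simpleReflection b i * simpleReflection b j))
        (opC b i) (opC b j)
      = dihedralKL (q b ^ 2) (orderOf (simpleReflection b i * simpleReflection b j))
        (opC b j) (opC b i) := by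
    intro i j hij h1 h2
    refine opC_braid_of_pairing b hij (k := (-R.pairingIn ℤ j i).toNat) h1 ?_ ?_ <;>
    · simp only [Set.mem_insert_iff, Set.mem_singleton_iff] at h2
      omega
  rcases simple_pairing_cases b hij with ⟨h1, h2⟩ | ⟨h1, h2⟩ | ⟨h1, h2⟩
  · have hx := weylFrac_altProd_comm b i j _ (pow_orderOf_eq_one _)
    have hb := weylFrac_zFrac b (k := 0) (by simpa using h2)
    have ha := weylFrac_zFrac b (k := 0) (by simpa using h1)
    rw [pow_zero, one_mul] at ha hb
    rw [orderOf_simple_mul_simple_of_orthogonal b h1 h2] at hx ⊢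
    simp only [altProd, weylFrac_mul, mul_one] at hx
    exact dihedralKL_two_comm _ (weylFrac_zFrac_self b i) (weylFrac_zFrac_self b j) hb ha hx
  · exact key hij h1 h2
  · rw [orderOf_simple_mul_comm]
    exact (key hij.symm h1 h2).symm

theorem opT_braid {i j : b.support} (hij : i ≠ j) :
    altProd (orderOf (simpleReflection b i * simpleReflection b j)) (opT b i) (opT b j)
    = altProd (orderOf (simpleReflection b i * simpleReflection b j)) (opT b j) (opT b i) := by
  refine altProd_comm_of_dihedralKL (q_mul_qInv b) (opT_mul_self b i) (opT_mul_self b j) ?_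
  rw [one_add_q_smul_opT, one_add_q_smul_opT]
  exact opC_braid b hij

end PolynomialRepresentation

/-! ### The polynomial representation of the affine Hecke algebra. -/

section Representation

variable {ι V V' : Type*} [AddCommGroup V] [Module ℝ V] [AddCommGroup V'] [Module ℝ V']
variable {R : RootPairing ι ℝ V V'} (b : R.Base)
variable [Finite ι] [R.IsRootSystem] [R.IsCrystallographic]

theorem map_altProd {M N F : Type*} [Monoid M] [Monoid N] [FunLike F M N] [MonoidHomClass F M N]
    (f : F) (n : ℕ) (x y : M) : f (altProd n x y) = altProd n (f x) (f y) := by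
  induction n generalizing x y with
  | zero => exact map_one f
  | succ n ih => rw [altProd, altProd, map_mul, ih]

theorem map_divDiff {A B F : Type*} [Ring A] [Ring B] [FunLike F A B] [AddMonoidHomClass F A B]
    (f : F) (x : weightLattice R → A) (i : ι) (μ : weightLattice R) :
    f (divDiff x i μ) = divDiff (fun ν => f (x ν)) i μ := by
  unfold divDiff
  split_ifs
  · rw [map_sum]
  · rw [map_neg, map_sum]

variable [R.IsReduced]

/-- The coefficient of the identity in the operator `Tᵢ`. -/
def opA (i : b.support) : RatFun b :=
  algebraMap (Coeff b) _ (q b - qInv b) / (1 - zFrac b i)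

/-- The coefficient of `sᵢ` in the operator `Tᵢ`. -/
def opB (i : b.support) : RatFun b := algebraMap (Coeff b) _ (q b) - opA b i

theorem opA_add_opB (i : b.support) : opA b i + opB b i = algebraMap (Coeff b) _ (q b) :=
  add_sub_cancel _ _

theorem opA_mul (i : b.support) :
    opA b i * (1 - zFrac b i) = algebraMap (Coeff b) _ (q b - qInv b) :=
  div_mul_cancel₀ _ (one_sub_zFrac_ne_zero b i)

theorem opB_mul (i : b.support) : opB b i * (1 - zFrac b i) =
    algebraMap (Coeff b) _ (qInv b) - algebraMap (Coeff b) _ (q b) * zFrac b i := by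
  rw [opB, sub_mul, opA_mul, map_sub]
  ring

theorem qInv_sub_q_mul_monomial_ne_zero (i : b.support) :
    algebraMap (Coeff b) (GroupAlg b) (qInv b)
      - algebraMap (Coeff b) _ (q b) * monomial b (-rootWeight R i) ≠ 0 := by
  intro h
  have h1 := congrArg (fun f : GroupAlg b => f.coeff 0) h
  rw [← Algebra.smul_def, Algebra.algebraMap_eq_smul_one, ← monomial_zero] at h1
  simp [monomial, AddMonoidAlgebra.coeff_single, rootWeight_ne_zero] at h1
  have := qInv_mul_q b
  rw [h1, zero_mul] at this
  exact zero_ne_one this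

/-- Both the triangularity of `T_w` and the criterion for `sᵢ`-invariance rest on this nonvanishing.
-/
theorem opB_ne_zero (i : b.support) : opB b i ≠ 0 := by
  intro h
  have h1 := opB_mul b i
  rw [h, zero_mul, eq_comm, zFrac, IsScalarTower.algebraMap_apply (Coeff b) (GroupAlg b) (RatFun b),
    IsScalarTower.algebraMap_apply (Coeff b) (GroupAlg b) (RatFun b), ← map_mul, ← map_sub] at h1
  exact (algebraMap_ne_zero_iff b _).2 (qInv_sub_q_mul_monomial_ne_zero b i) h1

theorem opT_apply (i : b.support) (f : RatFun b) :
    opT b i f = opA b i * f + opB b i * weylFrac b (simpleReflection b i) f := by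
  have h1 : kappa (algebraMap (Coeff b) (RatFun b) (q b ^ 2)) (zFrac b i) =
      1 + algebraMap (Coeff b) _ (q b) * opA b i := by
    have h2 : algebraMap (Coeff b) (RatFun b) (q b ^ 2 - 1) = algebraMap (Coeff b) (RatFun b) (q b)
        * algebraMap (Coeff b) (RatFun b) (q b - qInv b) := by
      rw [← map_mul, mul_sub, q_mul_qInv, sq]
    rw [map_sub, map_one] at h2
    have := one_sub_zFrac_ne_zero b i
    rw [kappa, opA, mul_div_assoc', ← h2]
    field_simp
    ring
  have h3 : algebraMap (Coeff b) (RatFun b) (qInv b) * algebraMap (Coeff b) (RatFun b) (q b) = 1 := by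
    rw [← map_mul, qInv_mul_q, map_one]
  rw [opT, LinearMap.smul_apply, LinearMap.sub_apply, opC, symmOp_apply, map_mul,
    map_kappa_of_inv _ (zFrac_ne_zero b i) (one_sub_zFrac_ne_zero b i) (weylFrac_zFrac_self b i), h1,
    Algebra.smul_def, map_pow, opB, Module.End.one_apply]
  linear_combination (opA b i * f + (algebraMap (Coeff b) (RatFun b) (q b) - opA b i) *
    weylFrac b (simpleReflection b i) f) * h3

/-- Multiplication by elements of `𝕂[P]` on the fractions. -/
def mulOp : GroupAlg b →ₐ[Coeff b] Module.End (Coeff b) (RatFun b) :=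
  (Algebra.lmul (Coeff b) (RatFun b)).comp
    (IsScalarTower.toAlgHom (Coeff b) (GroupAlg b) (RatFun b))

theorem mulOp_apply (f : GroupAlg b) (g : RatFun b) : mulOp b f g = algebraMap _ _ f * g := rfl

/-- The `sᵢ`-terms agree. The identity terms differ by `opA` times `x^μ - x^{sᵢμ}`, and the
denominator `1 - x^{-αᵢ}` of `opA` divides this difference with quotient `divDiff`. -/
theorem mulOp_mul_opT (i : b.support) (μ : weightLattice R) :
    mulOp b (monomial b μ) * opT b i = opT b i * mulOp b (monomial b (simpleReflection b i • μ)) +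
      (q b - qInv b) • mulOp b (divDiff (monomial b) (i : ι) μ) := by
  refine LinearMap.ext fun f => ?_
  have h := congrArg (algebraMap (GroupAlg b) (RatFun b))
    (divDiff_mul (monomial b) (monomial_add b) (i : ι) μ)
  rw [map_mul, map_sub, map_sub, map_one] at h
  change algebraMap _ _ (divDiff (monomial b) (i : ι) μ) * (1 - zFrac b i)
    = _ - algebraMap _ _ (monomial b (simpleReflection b i • μ)) at h
  rw [LinearMap.add_apply, LinearMap.smul_apply, Module.End.mul_apply, Module.End.mul_apply,
    mulOp_apply, mulOp_apply, mulOp_apply, opT_apply, opT_apply, map_mul (weylFrac b _),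
    weylFrac_algebraMap, weylAct_monomial, smul_smul, simpleReflection_mul_self, one_smul,
    Algebra.smul_def, ← opA_mul b i]
  linear_combination (- opA b i * f) * h

/-- The operators of the generators in the polynomial representation. -/
def genOp : Gen b → Module.End (Coeff b) (RatFun b)
  | Gen.T i => opT b i
  | Gen.X μ => mulOp b (monomial b μ)

theorem lift_genOp_rel ⦃x y : FreeAlgebra (Coeff b) (Gen b)⦄ (h : Rel b x y) :
    FreeAlgebra.lift (Coeff b) (genOp b) x = FreeAlgebra.lift (Coeff b) (genOp b) y := by
  have hT : ∀ i, FreeAlgebra.lift (Coeff b) (genOp b) (freeT b i) = opT b i :=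
    fun i => FreeAlgebra.lift_ι_apply _ _
  have hX : ∀ μ, FreeAlgebra.lift (Coeff b) (genOp b) (freeX b μ) =
      mulOp b (monomial b μ) :=
    fun i => FreeAlgebra.lift_ι_apply _ _
  induction h with
  | braid i j hij => rw [map_altProd, map_altProd, hT, hT, opT_braid b hij]
  | quadratic i => rw [map_mul, map_add, map_smul, hT, opT_mul_self, map_one]
  | x_zero => rw [hX, monomial_zero, map_one, map_one]
  | x_add μ ν => rw [map_mul, hX, hX, hX, monomial_add, map_mul]
  | cross i μ =>
    rw [map_mul, map_add, map_mul, map_smul, hT, hX, hX, map_divDiff]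
    simp only [hX]
    rw [← map_divDiff (mulOp b)]
    exact mulOp_mul_opT b i μ

/-- The polynomial representation of the affine Hecke algebra. -/
def rep : AffineHecke b →ₐ[Coeff b] Module.End (Coeff b) (RatFun b) :=
  RingQuot.liftAlgHom (Coeff b) ⟨FreeAlgebra.lift (Coeff b) (genOp b), lift_genOp_rel b⟩

theorem rep_mkHecke (x : FreeAlgebra (Coeff b) (Gen b)) :
    rep b (mkHecke b x) = FreeAlgebra.lift (Coeff b) (genOp b) x :=
  RingQuot.liftAlgHom_mkAlgHom_apply _ _ _ _

theorem rep_heckeT (i : b.support) : rep b (heckeT b i) = opT b i := by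
  rw [heckeT, rep_mkHecke, freeT, FreeAlgebra.lift_ι_apply]
  rfl

theorem heckeX_monomial (μ : weightLattice R) :
    heckeX b (monomial b μ) = mkHecke b (freeX b μ) := by
  rw [heckeX, monomial, AddMonoidAlgebra.lift_single, one_smul]
  rfl

theorem rep_heckeX (f : GroupAlg b) (g : RatFun b) :
    rep b (heckeX b f) g = algebraMap _ _ f * g := by
  refine groupAlg_induction b (p := fun f => rep b (heckeX b f) g = algebraMap _ _ f * g) ?_ ?_ ?_ f
  · intro μ
    rw [heckeX_monomial, rep_mkHecke, freeX, FreeAlgebra.lift_ι_apply]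
    rfl
  · intro f f' hf hf'
    rw [map_add, map_add, LinearMap.add_apply, hf, hf', map_add, add_mul]
  · intro r f hf
    rw [map_smul, map_smul, LinearMap.smul_apply, hf, ← smul_mul_assoc]
    congr 1
    exact (map_smul (IsScalarTower.toAlgHom (Coeff b) (GroupAlg b) (RatFun b)) r f).symm

theorem heckeX_injective : Function.Injective (heckeX b) := by
  intro f g h
  have h1 := congrArg (fun x => rep b x 1) h
  simp only [rep_heckeX, mul_one] at h1
  exact IsFractionRing.injective _ _ h1

end Representation

/-! ### Relations in the affine Hecke algebra and the elements `T_w`. -/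

section HeckeRelations

variable {ι V V' : Type*} [AddCommGroup V] [Module ℝ V] [AddCommGroup V'] [Module ℝ V']
variable {R : RootPairing ι ℝ V V'} (b : R.Base)
variable [Finite ι] [R.IsRootSystem] [R.IsCrystallographic] [R.IsReduced]

theorem mkHecke_rel {x y : FreeAlgebra (Coeff b) (Gen b)} (h : Rel b x y) :
    mkHecke b x = mkHecke b y := RingQuot.mkAlgHom_rel (Coeff b) h

theorem heckeT_mul_self (i : b.support) :
    heckeT b i * heckeT b i = (q b - qInv b) • heckeT b i + 1 := by
  unfold heckeT
  simpa only [map_mul, map_add, map_smul, map_one] using mkHecke_rel b (Rel.quadratic i)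

theorem heckeT_braid {i j : b.support} (hij : i ≠ j) :
    altProd (orderOf (simpleReflection b i * simpleReflection b j)) (heckeT b i) (heckeT b j)
    = altProd (orderOf (simpleReflection b i * simpleReflection b j)) (heckeT b j) (heckeT b i) := by
  unfold heckeT
  simpa only [map_altProd] using mkHecke_rel b (Rel.braid i j hij)

theorem heckeX_monomial_mul_heckeT (i : b.support) (μ : weightLattice R) :
    heckeX b (monomial b μ) * heckeT b i =
      heckeT b i * heckeX b (monomial b (simpleReflection b i • μ)) +
      (q b - qInv b) • heckeX b (divDiff (monomial b) (i : ι) μ) := by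
  have h := mkHecke_rel b (Rel.cross i μ)
  rw [map_mul, map_add, map_mul, map_smul, map_divDiff] at h
  simp only [← heckeX_monomial] at h
  rwa [← map_divDiff (heckeX b)] at h

/-- The commutation relation between `f ∈ 𝕂[P]` and `Tᵢ`. -/
theorem heckeX_mul_heckeT (i : b.support) (f : GroupAlg b) :
    ∃ g, g * (1 - monomial b (-rootWeight R i)) = f - weylAct b (simpleReflection b i) f ∧
      heckeX b f * heckeT b i = heckeT b i * heckeX b (weylAct b (simpleReflection b i) f) +
        (q b - qInv b) • heckeX b g := by
  refine groupAlg_induction b (p := fun f => ∃ g, g * (1 - monomial b (-rootWeight R i))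
    = f - weylAct b (simpleReflection b i) f ∧ heckeX b f * heckeT b i = heckeT b i *
      heckeX b (weylAct b (simpleReflection b i) f) + (q b - qInv b) • heckeX b g) ?_ ?_ ?_ f
  · intro μ
    refine ⟨divDiff (monomial b) (i : ι) μ, ?_, ?_⟩
    · rw [weylAct_monomial]
      exact divDiff_mul (monomial b) (monomial_add b) (i : ι) μ
    · rw [weylAct_monomial, heckeX_monomial_mul_heckeT]
  · rintro f f' ⟨g, h1, h2⟩ ⟨g', h1', h2'⟩
    refine ⟨g + g', ?_, ?_⟩
    · rw [add_mul, h1, h1', map_add]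
      ring
    · rw [map_add, add_mul, h2, h2', map_add, map_add, map_add, mul_add, smul_add]
      abel
  · rintro r f ⟨g, h1, h2⟩
    refine ⟨r • g, ?_, ?_⟩
    · rw [smul_mul_assoc, h1, map_smul, smul_sub]
    · rw [map_smul, smul_mul_assoc, h2, map_smul, map_smul, map_smul, smul_add, mul_smul_comm,
        smul_comm r]

theorem heckeX_mul_heckeT_of_invariant {i : b.support} {f : GroupAlg b}
    (hf : weylAct b (simpleReflection b i) f = f) :
    heckeX b f * heckeT b i = heckeT b i * heckeX b f := by
  obtain ⟨g, h1, h2⟩ := heckeX_mul_heckeT b i f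
  rw [hf, sub_self] at h1
  have hg : g = 0 := (mul_eq_zero.1 h1).resolve_right
    (one_sub_monomial_ne_zero b (neg_ne_zero.2 (rootWeight_ne_zero _)))
  rw [h2, hf, hg, map_zero, smul_zero, add_zero]

/-- By Matsumoto's theorem the chosen `reducedWord` may be replaced by any reduced word, which is
what the multiplication rules for `T_w` need. -/
theorem heckeTw_wordProd {l : List b.support} (hl : l.length = length b (wordProd b l)) :
    heckeTw b (wordProd b l) = (l.map (heckeT b)).prod := by
  refine prod_map_eq_of_reduced b (heckeT b) (fun i j hij => heckeT_braid b hij) ?_ ?_ hl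
  · exact wordProd_reducedWord b _
  · rw [length_reducedWord, wordProd_reducedWord]

theorem heckeTw_one : heckeTw b 1 = 1 := by
  have := heckeTw_wordProd b (l := []) (by simp [wordProd, length_one])
  simpa [wordProd] using this

theorem heckeT_mul_heckeTw_of_pos {i : b.support} {w : R.weylGroup}
    (h : b.IsPos (R.weylGroupToPerm w⁻¹ i)) :
    heckeT b i * heckeTw b w = heckeTw b (simpleReflection b i * w) := by
  have h1 : wordProd b (i :: reducedWord b w) = simpleReflection b i * w := by
    rw [wordProd_cons, wordProd_reducedWord]
  have := heckeTw_wordProd b (l := i :: reducedWord b w) (by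
    rw [h1, List.length_cons, length_reducedWord, length_simple_mul_of_pos b w i h])
  rw [h1] at this
  rw [this, List.map_cons, List.prod_cons, heckeTw]

theorem heckeTw_mul_heckeT_of_pos {i : b.support} {w : R.weylGroup}
    (h : b.IsPos (R.weylGroupToPerm w i)) :
    heckeTw b w * heckeT b i = heckeTw b (w * simpleReflection b i) := by
  have h1 : wordProd b (reducedWord b w ++ [i]) = w * simpleReflection b i := by
    rw [wordProd_append, wordProd_reducedWord, wordProd_singleton]
  have := heckeTw_wordProd b (l := reducedWord b w ++ [i]) (by
    rw [h1, List.length_append, length_reducedWord, length_mul_simple_of_pos b w i h]; rfl)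
  rw [h1] at this
  rw [this, List.map_append, List.prod_append, heckeTw]
  simp

theorem heckeT_mul_heckeTw_of_neg {i : b.support} {w : R.weylGroup}
    (h : ¬ b.IsPos (R.weylGroupToPerm w⁻¹ i)) :
    heckeT b i * heckeTw b w =
      heckeTw b (simpleReflection b i * w) + (q b - qInv b) • heckeTw b w := by
  have h1 : heckeT b i * heckeTw b (simpleReflection b i * w) = heckeTw b w := by
    have := heckeT_mul_heckeTw_of_pos b (i := i) (w := simpleReflection b i * w) (by
      rwa [mul_inv_rev, simpleReflection_inv, weylGroupToPerm_mul, simpleReflection_apply_self,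
        weylGroupToPerm_reflectionPerm_self, isPos_reflectionPerm_self_iff])
    rwa [simpleReflection_mul_cancel_left] at this
  nth_rewrite 1 [← h1]
  rw [← mul_assoc, heckeT_mul_self, add_mul, smul_mul_assoc, h1, one_mul, add_comm]

theorem heckeTw_mul_heckeT_of_neg {i : b.support} {w : R.weylGroup}
    (h : ¬ b.IsPos (R.weylGroupToPerm w i)) :
    heckeTw b w * heckeT b i =
      heckeTw b (w * simpleReflection b i) + (q b - qInv b) • heckeTw b w := by
  have h1 : heckeTw b (w * simpleReflection b i) * heckeT b i = heckeTw b w := by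
    have := heckeTw_mul_heckeT_of_pos b (i := i) (w := w * simpleReflection b i) (by
      rwa [weylGroupToPerm_mul, simpleReflection_apply_self,
        weylGroupToPerm_reflectionPerm_self, isPos_reflectionPerm_self_iff])
    rwa [mul_assoc, simpleReflection_mul_self, mul_one] at this
  nth_rewrite 1 [← h1]
  rw [mul_assoc, heckeT_mul_self, mul_add, mul_smul_comm, h1, mul_one, add_comm]

/-- The algebra is generated by the `Tᵢ` and `x^μ`. -/
theorem affineHecke_induction {p : AffineHecke b → Prop}
    (scalar : ∀ r, p (algebraMap (Coeff b) _ r)) (T : ∀ i, p (heckeT b i))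
    (X : ∀ μ, p (heckeX b (monomial b μ))) (add : ∀ x y, p x → p y → p (x + y))
    (mul : ∀ x y, p x → p y → p (x * y)) (x : AffineHecke b) : p x := by
  obtain ⟨x, rfl⟩ := RingQuot.mkAlgHom_surjective (Coeff b) (Rel b) x
  induction x using FreeAlgebra.induction with
  | grade0 r =>
    have := scalar r
    rwa [← AlgHom.commutes (mkHecke b)] at this
  | grade1 x =>
    cases x with
    | T i => exact T i
    | X μ =>
      have := X μ
      rwa [heckeX_monomial] at this
  | mul x y hx hy =>
    have := mul _ _ hx hy
    rwa [map_mul]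
  | add x y hx hy =>
    have := add _ _ hx hy
    rwa [map_add]

end HeckeRelations

/-! ### The elements `T_w f` span the affine Hecke algebra. -/

section Spanning

variable {ι V V' : Type*} [AddCommGroup V] [Module ℝ V] [AddCommGroup V'] [Module ℝ V']
variable {R : RootPairing ι ℝ V V'} (b : R.Base)
variable [Finite ι] [R.IsRootSystem] [R.IsCrystallographic] [R.IsReduced]

/-- The span of the elements `T_w f` with `f ∈ 𝕂[P]`. -/
def spanTX : Submodule (Coeff b) (AffineHecke b) :=
  Submodule.span _ {h | ∃ w f, h = heckeTw b w * heckeX b f}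

theorem heckeTw_mul_heckeX_mem (w : R.weylGroup) (f : GroupAlg b) :
    heckeTw b w * heckeX b f ∈ spanTX b :=
  Submodule.subset_span ⟨w, f, rfl⟩

theorem heckeTw_mul_heckeT_mul_heckeX_mem (w : R.weylGroup) (i : b.support) (f : GroupAlg b) :
    heckeTw b w * heckeT b i * heckeX b f ∈ spanTX b := by
  by_cases h : b.IsPos (R.weylGroupToPerm w i)
  · rw [heckeTw_mul_heckeT_of_pos b h]
    exact heckeTw_mul_heckeX_mem b _ _
  · rw [heckeTw_mul_heckeT_of_neg b h, add_mul, smul_mul_assoc]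
    exact add_mem (heckeTw_mul_heckeX_mem b _ _)
      (Submodule.smul_mem _ _ (heckeTw_mul_heckeX_mem b _ _))

/-- A factor `x^μ` is absorbed into `f`. A factor `Tᵢ` is moved to the left of `f` at the cost of a
correction in `𝕂[P]`, after which `T_w Tᵢ` is expanded in the `T_v`. -/
theorem mul_mem_spanTX (y : AffineHecke b) : ∀ x ∈ spanTX b, x * y ∈ spanTX b := by
  have key : ∀ y, (∀ w f, heckeTw b w * heckeX b f * y ∈ spanTX b) →
      ∀ x ∈ spanTX b, x * y ∈ spanTX b := by
    intro y hy x hx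
    induction hx using Submodule.span_induction with
    | mem x hx =>
      obtain ⟨w, f, rfl⟩ := hx
      exact hy w f
    | zero => rw [zero_mul]; exact zero_mem _
    | add x x' _ _ hx hx' => rw [add_mul]; exact add_mem hx hx'
    | smul r x _ hx => rw [smul_mul_assoc]; exact Submodule.smul_mem _ _ hx
  refine affineHecke_induction b (p := fun y => ∀ x ∈ spanTX b, x * y ∈ spanTX b) ?_ ?_ ?_ ?_ ?_ y
  · intro r x hx
    rw [← Algebra.commutes, ← Algebra.smul_def]
    exact Submodule.smul_mem _ _ hx
  · intro i
    refine key _ fun w f => ?_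
    obtain ⟨g, -, h⟩ := heckeX_mul_heckeT b i f
    rw [mul_assoc, h, mul_add, ← mul_assoc, mul_smul_comm]
    exact add_mem (heckeTw_mul_heckeT_mul_heckeX_mem b _ _ _)
      (Submodule.smul_mem _ _ (heckeTw_mul_heckeX_mem b _ _))
  · intro μ
    refine key _ fun w f => ?_
    rw [mul_assoc, ← map_mul]
    exact heckeTw_mul_heckeX_mem b _ _
  · intro y y' hy hy' x hx
    rw [mul_add]
    exact add_mem (hy x hx) (hy' x hx)
  · intro y y' hy hy' x hx
    rw [← mul_assoc]
    exact hy' _ (hy x hx)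

theorem mem_spanTX (h : AffineHecke b) : h ∈ spanTX b := by
  have h1 := heckeTw_mul_heckeX_mem b 1 1
  rw [heckeTw_one, map_one, mul_one] at h1
  simpa using mul_mem_spanTX b h 1 h1

/-- Every element of the affine Hecke algebra is `∑_w T_w f_w` with `f_w ∈ 𝕂[P]`. -/
theorem exists_eq_sum_heckeTw_mul_heckeX (h : AffineHecke b) :
    ∃ f : R.weylGroup → GroupAlg b, h = ∑ w, heckeTw b w * heckeX b (f w) := by
  classical
  have := mem_spanTX b h
  unfold spanTX at this
  induction this using Submodule.span_induction with
  | mem x hx =>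
    obtain ⟨w, f, rfl⟩ := hx
    refine ⟨Pi.single w f, ?_⟩
    rw [Finset.sum_eq_single w]
    · rw [Pi.single_eq_same]
    · intro v _ hv
      rw [Pi.single_eq_of_ne hv, map_zero, mul_zero]
    · simp
  | zero => exact ⟨0, by simp⟩
  | add x y _ _ hx hy =>
    obtain ⟨f, rfl⟩ := hx
    obtain ⟨g, rfl⟩ := hy
    exact ⟨f + g, by simp [mul_add, Finset.sum_add_distrib]⟩
  | smul r x _ hx =>
    obtain ⟨f, rfl⟩ := hx
    exact ⟨r • f, by simp [Finset.smul_sum]⟩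

end Spanning

/-! ### Triangularity and faithfulness of the representation. -/

section Faithful

variable {ι V V' : Type*} [AddCommGroup V] [Module ℝ V] [AddCommGroup V'] [Module ℝ V']
variable {R : RootPairing ι ℝ V V'} (b : R.Base)
variable [Finite ι] [R.IsRootSystem] [R.IsCrystallographic] [R.IsReduced]

theorem exists_smul_weight_ne {w w' : R.weylGroup} (h : w ≠ w') :
    ∃ μ : weightLattice R, w • μ ≠ w' • μ := by
  by_contra! H
  refine h (weylGroup_ext fun i => R.root.injective ?_)
  rw [root_weylGroupToPerm, root_weylGroupToPerm]
  exact congrArg Subtype.val (H (rootWeight R i))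

/-- The Weyl group elements are linearly independent as maps from `𝕂[P]` to its field of
fractions. -/
theorem eq_zero_of_sum_mul_weylAct {c : R.weylGroup → RatFun b}
    (h : ∀ g : GroupAlg b, ∑ w, c w * algebraMap _ _ (weylAct b w g) = 0) (w : R.weylGroup) :
    c w = 0 := by
  let φ : R.weylGroup → (GroupAlg b →* RatFun b) := fun w =>
    (algebraMap (GroupAlg b) (RatFun b) : GroupAlg b →* RatFun b).comp
      (weylAct b w : GroupAlg b →* GroupAlg b)
  have hφ : Function.Injective φ := by
    intro w w' hw
    by_contra hne
    obtain ⟨μ, hμ⟩ := exists_smul_weight_ne hne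
    have h1 := DFunLike.congr_fun hw (monomial b μ)
    change algebraMap (GroupAlg b) (RatFun b) (weylAct b w (monomial b μ))
      = algebraMap (GroupAlg b) (RatFun b) (weylAct b w' (monomial b μ)) at h1
    rw [weylAct_monomial, weylAct_monomial] at h1
    exact hμ (monomial_injective b (IsFractionRing.injective _ _ h1))
  -- Dedekind: distinct multiplicative maps into a field are linearly independent.
  have hli := (linearIndependent_monoidHom (GroupAlg b) (RatFun b)).comp φ hφ
  refine Fintype.linearIndependent_iff.1 hli c ?_ w
  funext g
  rw [Finset.sum_apply]
  exact h g

/-- `T_w` acts as `∑_v c_v v` with `c_w ≠ 0` and `c_v = 0` for the other `v` with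
`ℓ(v) ≥ ℓ(w)`. -/
theorem exists_rep_heckeTw (w : R.weylGroup) : ∃ c : R.weylGroup → RatFun b,
    (∀ g, rep b (heckeTw b w) g = ∑ v, c v * weylFrac b v g) ∧ c w ≠ 0 ∧
    ∀ v, v ≠ w → length b w ≤ length b v → c v = 0 := by
  classical
  refine length_induction b (p := fun w => ∃ c : R.weylGroup → RatFun b,
    (∀ g, rep b (heckeTw b w) g = ∑ v, c v * weylFrac b v g) ∧ c w ≠ 0 ∧
    ∀ v, v ≠ w → length b w ≤ length b v → c v = 0) ?_ ?_ w
  · refine ⟨Pi.single 1 1, ?_, ?_, ?_⟩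
    · intro g
      rw [heckeTw_one, map_one, Finset.sum_eq_single 1]
      · rw [Pi.single_eq_same, weylFrac_one, one_mul]
        rfl
      · intro v _ hv
        rw [Pi.single_eq_of_ne hv, zero_mul]
      · simp
    · rw [Pi.single_eq_same]
      exact one_ne_zero
    · intro v hv _
      rw [Pi.single_eq_of_ne hv]
  · rintro i w hpos ⟨c, h1, h2, h3⟩
    have hl := length_simple_mul_of_pos b w i hpos
    -- Coefficients of `(opA + opB sᵢ) ∑ c_v v`. Since `ℓ(v)` and `ℓ(sᵢ v)` differ by one, the
    -- vanishing of `c` in length at least `ℓ(w)`, away from `w`, passes on to `sᵢ w`.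
    refine ⟨fun u => opA b i * c u + opB b i *
      weylFrac b (simpleReflection b i) (c (simpleReflection b i * u)), ?_, ?_, ?_⟩
    · intro g
      rw [← heckeT_mul_heckeTw_of_pos b hpos, map_mul, rep_heckeT]
      change opT b i (rep b (heckeTw b w) g) = _
      rw [h1, opT_apply, map_sum, Finset.mul_sum, Finset.mul_sum,
        ← Equiv.sum_comp (Equiv.mulLeft (simpleReflection b i))
          (fun v => opB b i * weylFrac b _ (c v * weylFrac b v g)), ← Finset.sum_add_distrib]
      refine Finset.sum_congr rfl fun v _ => ?_
      rw [Equiv.coe_mulLeft, map_mul, weylFrac_mul, weylFrac_simple_simple]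
      ring
    · dsimp only
      rw [simpleReflection_mul_cancel_left, h3 (simpleReflection b i * w), mul_zero, zero_add]
      · exact mul_ne_zero (opB_ne_zero b i) ((map_ne_zero _).2 h2)
      · intro h
        rw [h] at hl
        omega
      · omega
    · intro v hv hlv
      rw [hl] at hlv
      have h4 : c v = 0 := by
        refine h3 v ?_ (by omega)
        rintro rfl
        omega
      have h5 : c (simpleReflection b i * v) = 0 := by
        refine h3 _ ?_ ?_
        · rintro rfl
          rw [simpleReflection_mul_cancel_left] at hv
          exact hv rfl
        · by_cases h : b.IsPos (R.weylGroupToPerm v⁻¹ i)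
          · rw [length_simple_mul_of_pos b v i h]
            omega
          · rw [length_simple_mul_of_neg b v i h] at hlv
            omega
      dsimp only
      rw [h4, h5, map_zero, mul_zero, mul_zero, add_zero]

/-- The coefficient of `v` in the operator of `T_w`. -/
def repCoeff (w v : R.weylGroup) : RatFun b := (exists_rep_heckeTw b w).choose v

theorem rep_heckeTw (w : R.weylGroup) (g : RatFun b) :
    rep b (heckeTw b w) g = ∑ v, repCoeff b w v * weylFrac b v g :=
  (exists_rep_heckeTw b w).choose_spec.1 g

theorem repCoeff_self_ne_zero (w : R.weylGroup) : repCoeff b w w ≠ 0 :=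
  (exists_rep_heckeTw b w).choose_spec.2.1

theorem repCoeff_eq_zero {w v : R.weylGroup} (h : v ≠ w) (hl : length b w ≤ length b v) :
    repCoeff b w v = 0 :=
  (exists_rep_heckeTw b w).choose_spec.2.2 v h hl

theorem rep_sum_heckeTw_mul_heckeX (f : R.weylGroup → GroupAlg b) (g : RatFun b) :
    rep b (∑ w, heckeTw b w * heckeX b (f w)) g =
      ∑ v, (∑ w, repCoeff b w v * weylFrac b v (algebraMap _ _ (f w))) * weylFrac b v g := by
  rw [map_sum, LinearMap.sum_apply]
  simp only [map_mul, Module.End.mul_apply, rep_heckeX, rep_heckeTw, Finset.sum_mul, mul_assoc]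
  rw [Finset.sum_comm]

/-- Triangularity: if the operator of `∑_w T_w f_w` involves no `v` with `ℓ(v) ≥ n`, then
`f_w = 0` for all `w` with `ℓ(w) ≥ n`. -/
theorem eq_zero_of_coeff_eq_zero {f : R.weylGroup → GroupAlg b} {n : ℕ}
    (h : ∀ v, n ≤ length b v →
      ∑ w, repCoeff b w v * weylFrac b v (algebraMap _ _ (f w)) = 0)
    (w : R.weylGroup) (hw : n ≤ length b w) : f w = 0 := by
  classical
  by_contra hf
  -- For `u` of maximal length among the `w` with `n ≤ ℓ(w)` and `f_w ≠ 0`, only `T_u f_u`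
  -- contributes to the coefficient of `u`.
  obtain ⟨u, hu, hmax⟩ := Finset.exists_max_image
    (Finset.univ.filter fun w => n ≤ length b w ∧ f w ≠ 0) (length b)
    ⟨w, by simp [hw, hf]⟩
  simp only [Finset.mem_filter, Finset.mem_univ, true_and] at hu hmax
  have h1 := h u hu.1
  rw [Finset.sum_eq_single u] at h1
  · rcases mul_eq_zero.1 h1 with h2 | h2
    · exact repCoeff_self_ne_zero b u h2
    · rw [map_eq_zero] at h2
      exact (algebraMap_ne_zero_iff b _).2 hu.2 h2
  · intro v _ hv
    by_cases hlv : length b v ≤ length b u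
    · rw [repCoeff_eq_zero b hv.symm hlv, zero_mul]
    · have : f v = 0 := by
        by_contra hfv
        exact hlv (hmax v ⟨by omega, hfv⟩)
      rw [this, map_zero, map_zero, mul_zero]
  · simp

/-- The polynomial representation is faithful, already on `𝕂[P]`. -/
theorem eq_zero_of_rep_eq_zero {h : AffineHecke b}
    (H : ∀ g : GroupAlg b, rep b h (algebraMap _ _ g) = 0) : h = 0 := by
  obtain ⟨f, rfl⟩ := exists_eq_sum_heckeTw_mul_heckeX b h
  have h1 := eq_zero_of_sum_mul_weylAct b
    (c := fun v => ∑ w, repCoeff b w v * weylFrac b v (algebraMap _ _ (f w))) (by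
      intro g
      have := H g
      rw [rep_sum_heckeTw_mul_heckeX] at this
      simpa only [weylFrac_algebraMap] using this)
  refine Finset.sum_eq_zero fun w _ => ?_
  rw [eq_zero_of_coeff_eq_zero b (n := 0) (fun v _ => h1 v) w (Nat.zero_le _), map_zero, mul_zero]

end Faithful

/-! ### The idempotent `𝟏₀` and the eigenvector `ε₀` of the finite Hecke algebra. -/

section Idempotents

variable {ι V V' : Type*} [AddCommGroup V] [Module ℝ V] [AddCommGroup V'] [Module ℝ V']
variable {R : RootPairing ι ℝ V V'} (b : R.Base)
variable [Finite ι] [R.IsRootSystem] [R.IsCrystallographic] [R.IsReduced]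

/-- `∑_w c^{ℓ(w)} T_w`. -/
def eigenSum (c : Coeff b) : AffineHecke b := ∑ w : R.weylGroup, c ^ length b w • heckeTw b w

variable {c : Coeff b} (hc : c ^ 2 = (q b - qInv b) * c + 1)

include hc

/-- Pairing `w` with `sᵢ w` reduces the claim to the quadratic equation for `c`, which is satisfied
by `q` (giving `𝟏₀`) and `-q⁻¹` (giving `ε₀`). -/
theorem heckeT_mul_eigenSum (i : b.support) :
    heckeT b i * eigenSum b c = c • eigenSum b c := by
  classical
  have h1 : ∀ w : R.weylGroup, heckeT b i * heckeTw b w = heckeTw b (simpleReflection b i * w) +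
      (if b.IsPos (R.weylGroupToPerm w⁻¹ i) then 0 else q b - qInv b) • heckeTw b w := by
    intro w
    split_ifs with h
    · rw [heckeT_mul_heckeTw_of_pos b h, zero_smul, add_zero]
    · rw [heckeT_mul_heckeTw_of_neg b h]
  simp only [eigenSum, Finset.mul_sum, Finset.smul_sum, mul_smul_comm, h1, smul_add,
    Finset.sum_add_distrib]
  rw [← Equiv.sum_comp (Equiv.mulLeft (simpleReflection b i)), ← Finset.sum_add_distrib]
  refine Finset.sum_congr rfl fun w _ => ?_
  rw [Equiv.coe_mulLeft, simpleReflection_mul_cancel_left, smul_smul, smul_smul, ← add_smul]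
  congr 1
  split_ifs with h
  · rw [length_simple_mul_of_pos b w i h]
    ring
  · rw [length_simple_mul_of_neg b w i h]
    linear_combination -c ^ length b (simpleReflection b i * w) * hc

theorem eigenSum_mul_heckeT (i : b.support) :
    eigenSum b c * heckeT b i = c • eigenSum b c := by
  classical
  have h1 : ∀ w : R.weylGroup, heckeTw b w * heckeT b i = heckeTw b (w * simpleReflection b i) +
      (if b.IsPos (R.weylGroupToPerm w i) then 0 else q b - qInv b) • heckeTw b w := by
    intro w
    split_ifs with h
    · rw [heckeTw_mul_heckeT_of_pos b h, zero_smul, add_zero]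
    · rw [heckeTw_mul_heckeT_of_neg b h]
  simp only [eigenSum, Finset.sum_mul, Finset.smul_sum, smul_mul_assoc, h1, smul_add,
    Finset.sum_add_distrib]
  rw [← Equiv.sum_comp (Equiv.mulRight (simpleReflection b i)), ← Finset.sum_add_distrib]
  refine Finset.sum_congr rfl fun w _ => ?_
  rw [Equiv.coe_mulRight, mul_assoc w, simpleReflection_mul_self, mul_one, smul_smul, smul_smul,
    ← add_smul]
  congr 1
  split_ifs with h
  · rw [length_mul_simple_of_pos b w i h]
    ring
  · rw [length_mul_simple_of_neg b w i h]
    linear_combination -c ^ length b (w * simpleReflection b i) * hc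

theorem heckeTw_mul_eigenSum (w : R.weylGroup) :
    heckeTw b w * eigenSum b c = c ^ length b w • eigenSum b c := by
  refine length_induction b (p := fun w => heckeTw b w * eigenSum b c
    = c ^ length b w • eigenSum b c) ?_ ?_ w
  · rw [heckeTw_one, length_one, one_mul, pow_zero, one_smul]
  · intro i w h ih
    rw [← heckeT_mul_heckeTw_of_pos b h, mul_assoc, ih, mul_smul_comm, heckeT_mul_eigenSum b hc,
      smul_smul, length_simple_mul_of_pos b w i h, pow_succ]

theorem eigenSum_mul_self : eigenSum b c * eigenSum b c = poincare b (c ^ 2) • eigenSum b c := by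
  nth_rewrite 1 [eigenSum]
  simp only [Finset.sum_mul, poincare, Finset.sum_smul]
  refine Finset.sum_congr rfl fun w _ => ?_
  rw [smul_mul_assoc, heckeTw_mul_eigenSum b hc, smul_smul, ← mul_pow, sq]

omit hc

theorem q_sq : q b ^ 2 = (q b - qInv b) * q b + 1 := by
  linear_combination qInv_mul_q b

theorem neg_qInv_sq : (-qInv b) ^ 2 = (q b - qInv b) * (-qInv b) + 1 := by
  linear_combination q_mul_qInv b

theorem one0_eq : one0 b = Ring.inverse (poincare b (q b ^ 2)) • eigenSum b (q b) := rfl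

theorem eps0_eq : eps0 b = Ring.inverse (poincare b (qInv b ^ 2)) • eigenSum b (-qInv b) := rfl

theorem heckeT_mul_one0 (i : b.support) : heckeT b i * one0 b = q b • one0 b := by
  rw [one0_eq, mul_smul_comm, heckeT_mul_eigenSum b (q_sq b), smul_comm]

theorem eps0_mul_heckeT (i : b.support) : eps0 b * heckeT b i = (-qInv b) • eps0 b := by
  rw [eps0_eq, smul_mul_assoc, eigenSum_mul_heckeT b (neg_qInv_sq b), smul_comm]

theorem one0_mul_one0 : one0 b * one0 b = one0 b := by
  rw [one0_eq, smul_mul_smul_comm, eigenSum_mul_self b (q_sq b), smul_smul, mul_assoc,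
    Ring.inverse_mul_cancel _ (isUnit_poincare_q b), mul_one]

theorem rep_heckeT_one (i : b.support) : rep b (heckeT b i) 1 = q b • 1 := by
  rw [rep_heckeT, opT_apply, map_one, mul_one, mul_one, opA_add_opB, Algebra.smul_def, mul_one]

theorem rep_heckeTw_one (w : R.weylGroup) : rep b (heckeTw b w) 1 = q b ^ length b w • 1 := by
  refine length_induction b (p := fun w => rep b (heckeTw b w) 1 = q b ^ length b w • 1) ?_ ?_ w
  · rw [heckeTw_one, length_one, map_one (rep b), pow_zero, one_smul]
    rfl
  · intro i w h ih
    rw [← heckeT_mul_heckeTw_of_pos b h, map_mul, Module.End.mul_apply, ih, map_smul,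
      rep_heckeT_one, smul_smul, length_simple_mul_of_pos b w i h, pow_succ]

/-- The constant `1` is an eigenvector of every `T_w` with eigenvalue `q^{ℓ(w)}`. Acting on it
therefore recovers `f` from `f 𝟏₀`. -/
theorem rep_one0_one : rep b (one0 b) 1 = 1 := by
  rw [one0_eq, eigenSum, map_smul, map_sum, LinearMap.smul_apply, LinearMap.sum_apply]
  simp only [map_smul, LinearMap.smul_apply, rep_heckeTw_one, smul_smul]
  rw [← Finset.sum_smul, smul_smul]
  have : ∑ w : R.weylGroup, q b ^ length b w * q b ^ length b w = poincare b (q b ^ 2) := by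
    simp only [poincare]
    refine Finset.sum_congr rfl fun w _ => ?_
    rw [← mul_pow, sq]
  rw [this, Ring.inverse_mul_cancel _ (isUnit_poincare_q b), one_smul]

/-- Triangularity makes the `T_w` independent over `𝕂[P]`, and up to a unit the coefficient of `T_1`
in `ε₀` is `1`. -/
theorem eps0_ne_zero : eps0 b ≠ 0 := by
  intro h
  have h1 : eigenSum b (-qInv b) = 0 := by
    rw [eps0_eq] at h
    have := congrArg (fun x => poincare b (qInv b ^ 2) • x) h
    simpa only [smul_smul, Ring.mul_inverse_cancel _ (isUnit_poincare_qInv b), one_smul,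
      smul_zero] using this
  have h2 : eigenSum b (-qInv b) = ∑ w : R.weylGroup, heckeTw b w *
      heckeX b (algebraMap (Coeff b) _ ((-qInv b) ^ length b w)) := by
    rw [eigenSum]
    refine Finset.sum_congr rfl fun w _ => ?_
    rw [AlgHom.commutes, ← Algebra.commutes, Algebra.smul_def]
  have h3 := eq_zero_of_sum_mul_weylAct b
    (c := fun v => ∑ w : R.weylGroup, repCoeff b w v * weylFrac b v (algebraMap _ _
      (algebraMap (Coeff b) (GroupAlg b) ((-qInv b) ^ length b w)))) (by
      intro g
      have h4 := rep_sum_heckeTw_mul_heckeX b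
        (fun w => algebraMap (Coeff b) (GroupAlg b) ((-qInv b) ^ length b w)) (algebraMap _ _ g)
      rw [← h2, h1, map_zero, LinearMap.zero_apply] at h4
      simpa only [weylFrac_algebraMap] using h4.symm)
  have h5 := eq_zero_of_coeff_eq_zero b (n := 0)
    (f := fun w => algebraMap (Coeff b) (GroupAlg b) ((-qInv b) ^ length b w))
    (fun v _ => h3 v) 1 (Nat.zero_le _)
  rw [length_one, pow_zero, map_one] at h5
  exact one_ne_zero h5

end Idempotents

/-! ### The center and the Satake isomorphism. -/

section Center

variable {ι V V' : Type*} [AddCommGroup V] [Module ℝ V] [AddCommGroup V'] [Module ℝ V']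
variable {R : RootPairing ι ℝ V V'} (b : R.Base)
variable [Finite ι] [R.IsRootSystem] [R.IsCrystallographic] [R.IsReduced]

theorem heckeX_mul_comm_of_mem_symmetric {f : GroupAlg b} (hf : f ∈ symmetric b)
    (h : AffineHecke b) : heckeX b f * h = h * heckeX b f := by
  refine affineHecke_induction b (p := fun h => heckeX b f * h = h * heckeX b f) ?_ ?_ ?_ ?_ ?_ h
  · intro r
    exact (Algebra.commutes r _).symm
  · intro i
    exact heckeX_mul_heckeT_of_invariant b (hf _)
  · intro μ
    rw [← map_mul, ← map_mul, mul_comm]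
  · intro x y hx hy
    rw [mul_add, add_mul, hx, hy]
  · intro x y hx hy
    rw [← mul_assoc, hx, mul_assoc, hy, mul_assoc]

/-- As the two coefficients of the operator add up to `q`, one has `Tᵢ f - q f = opB (sᵢ f - f)`. -/
theorem rep_heckeT_algebraMap_eq_iff (i : b.support) (f : GroupAlg b) :
    rep b (heckeT b i) (algebraMap _ _ f) = q b • algebraMap _ _ f ↔
      weylAct b (simpleReflection b i) f = f := by
  rw [rep_heckeT, opT_apply, weylFrac_algebraMap, Algebra.smul_def, ← opA_add_opB b i, add_mul,
    add_right_inj, mul_right_inj' (opB_ne_zero b i)]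
  exact (IsFractionRing.injective (GroupAlg b) (RatFun b)).eq_iff

/-- Commuting with `x^μ` forces `C_v (x^{vμ} - x^μ) = 0`, so only `v = 1` survives and triangularity
puts `z` in `𝕂[P]`. Commuting with `Tᵢ`, evaluated at `1`, then makes it `sᵢ`-invariant. -/
theorem exists_symmetric_of_mem_center {z : AffineHecke b}
    (hz : ∀ h, z * h = h * z) : ∃ f ∈ symmetric b, heckeX b f = z := by
  obtain ⟨f, hf⟩ := exists_eq_sum_heckeTw_mul_heckeX b z
  let C : R.weylGroup → RatFun b := fun v =>
    ∑ w, repCoeff b w v * weylFrac b v (algebraMap _ _ (f w))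
  have hC : ∀ g, rep b z g = ∑ v, C v * weylFrac b v g := by
    intro g
    rw [hf, rep_sum_heckeTw_mul_heckeX]
  have h0 : ∀ v, 1 ≤ length b v → C v = 0 := by
    intro v hv
    have hv1 : v ≠ 1 := by
      rintro rfl
      rw [length_one] at hv
      omega
    obtain ⟨μ, hμ⟩ := exists_smul_weight_ne hv1
    rw [one_smul] at hμ
    have h1 := eq_zero_of_sum_mul_weylAct b (c := fun v => C v *
      (algebraMap _ _ (monomial b (v • μ)) - algebraMap _ _ (monomial b μ))) (by
        intro g
        have h2 := congrArg (fun h => rep b h (algebraMap _ _ g)) (hz (heckeX b (monomial b μ)))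
        simp only [map_mul, Module.End.mul_apply] at h2
        rw [rep_heckeX, hC, rep_heckeX, hC, ← sub_eq_zero, Finset.mul_sum,
          ← Finset.sum_sub_distrib] at h2
        rw [← h2]
        refine Finset.sum_congr rfl fun v _ => ?_
        rw [map_mul, weylFrac_algebraMap, weylFrac_algebraMap, weylAct_monomial]
        ring) v
    refine (mul_eq_zero.1 h1).resolve_right fun h2 => hμ ?_
    exact monomial_injective b (IsFractionRing.injective _ _ (sub_eq_zero.1 h2))
  have h1 := eq_zero_of_coeff_eq_zero b (n := 1) h0
  have h2 : z = heckeX b (f 1) := by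
    rw [hf, Finset.sum_eq_single 1]
    · rw [heckeTw_one, one_mul]
    · intro w _ hw
      rw [h1 w (Nat.one_le_iff_ne_zero.2 fun h => hw ((length_eq_zero_iff b).1 h)), map_zero,
        mul_zero]
    · simp
  refine ⟨f 1, mem_symmetric_of_simple b fun i => ?_, h2.symm⟩
  rw [← rep_heckeT_algebraMap_eq_iff]
  have h3 := congrArg (fun h => rep b h 1) (hz (heckeT b i))
  simp only [h2, map_mul, Module.End.mul_apply] at h3
  rw [rep_heckeT_one, map_smul, rep_heckeX, mul_one] at h3
  exact h3.symm

theorem center_eq :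
    Subalgebra.center (Coeff b) (AffineHecke b) = (symmetric b).map (heckeX b) := by
  ext z
  rw [Subalgebra.mem_center_iff, Subalgebra.mem_map]
  constructor
  · intro h
    exact exists_symmetric_of_mem_center b fun x => (h x).symm
  · rintro ⟨f, hf, rfl⟩ h
    exact (heckeX_mul_comm_of_mem_symmetric b hf h).symm

theorem rep_heckeX_mul_one0_one (f : GroupAlg b) :
    rep b (heckeX b f * one0 b) 1 = algebraMap _ _ f := by
  rw [map_mul, Module.End.mul_apply, rep_one0_one, rep_heckeX, mul_one]

theorem exists_heckeT_mul_heckeX (i : b.support) (f : GroupAlg b) : ∃ g, heckeT b i * heckeX b f =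
    heckeX b (weylAct b (simpleReflection b i) f) * heckeT b i + heckeX b g := by
  obtain ⟨g, -, h⟩ := heckeX_mul_heckeT b i (weylAct b (simpleReflection b i) f)
  rw [← weylAct_mul, simpleReflection_mul_self, weylAct_one] at h
  refine ⟨-((q b - qInv b) • g), ?_⟩
  rw [h, map_neg, map_smul, add_neg_cancel_right]

/-- `H̃ 𝟏₀ = 𝕂[P] 𝟏₀`. -/
theorem exists_mul_one0_eq (h : AffineHecke b) : ∃ f, h * one0 b = heckeX b f * one0 b := by
  have key : ∀ f, ∃ g, h * heckeX b f * one0 b = heckeX b g * one0 b := by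
    refine affineHecke_induction b
      (p := fun h => ∀ f, ∃ g, h * heckeX b f * one0 b = heckeX b g * one0 b) ?_ ?_ ?_ ?_ ?_ h
    · intro r f
      refine ⟨r • f, ?_⟩
      rw [map_smul, Algebra.smul_def]
    · intro i f
      obtain ⟨g, hg⟩ := exists_heckeT_mul_heckeX b i f
      refine ⟨q b • weylAct b (simpleReflection b i) f + g, ?_⟩
      rw [hg, add_mul, mul_assoc, heckeT_mul_one0, map_add, add_mul, map_smul, mul_smul_comm,
        smul_mul_assoc]
    · intro μ f
      exact ⟨monomial b μ * f, by rw [map_mul]⟩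
    · intro x y hx hy f
      obtain ⟨g, hg⟩ := hx f
      obtain ⟨g', hg'⟩ := hy f
      exact ⟨g + g', by rw [add_mul, add_mul, hg, hg', map_add, add_mul]⟩
    · intro x y hx hy f
      obtain ⟨g, hg⟩ := hy f
      obtain ⟨g', hg'⟩ := hx g
      exact ⟨g', by rw [mul_assoc x, mul_assoc, hg, ← mul_assoc, hg']⟩
  obtain ⟨g, hg⟩ := key 1
  exact ⟨g, by rw [← hg, map_one, mul_one]⟩

/-- `𝟏₀ H̃ 𝟏₀ ⊆ 𝕂[P]^W 𝟏₀`. -/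
theorem exists_symmetric_one0_mul_mul_one0 (h : AffineHecke b) :
    ∃ f ∈ symmetric b, one0 b * h * one0 b = heckeX b f * one0 b := by
  obtain ⟨f, hf⟩ := exists_mul_one0_eq b (one0 b * h)
  refine ⟨f, mem_symmetric_of_simple b fun i => ?_, hf⟩
  -- Acting on `1` turns `Tᵢ 𝟏₀ = q 𝟏₀` into `Tᵢ f = q f`.
  rw [← rep_heckeT_algebraMap_eq_iff, ← rep_heckeX_mul_one0_one, ← hf, ← Module.End.mul_apply,
    ← map_mul, ← mul_assoc, ← mul_assoc, heckeT_mul_one0, smul_mul_assoc, smul_mul_assoc, map_smul]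
  rfl

theorem mem_corner {e f x : AffineHecke b} : x ∈ corner b e f ↔ ∃ h, e * h * f = x := by
  rw [corner, LinearMap.mem_range]
  rfl

theorem heckeX_mul_one0_mem_corner {f : GroupAlg b} (hf : f ∈ symmetric b) :
    heckeX b f * one0 b ∈ corner b (one0 b) (one0 b) := by
  rw [mem_corner]
  refine ⟨heckeX b f, ?_⟩
  rw [← heckeX_mul_comm_of_mem_symmetric b hf, mul_assoc, one0_mul_one0]

theorem center_mul_one0 :
    {h | ∃ z ∈ Subalgebra.center (Coeff b) (AffineHecke b), h = z * one0 b} =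
      (corner b (one0 b) (one0 b) : Set (AffineHecke b)) := by
  ext h
  rw [Set.mem_ofPred_eq, SetLike.mem_coe, center_eq]
  constructor
  · rintro ⟨z, ⟨f, hf, rfl⟩, rfl⟩
    exact heckeX_mul_one0_mem_corner b hf
  · intro hh
    obtain ⟨h, rfl⟩ := (mem_corner b).1 hh
    obtain ⟨f, hf, h1⟩ := exists_symmetric_one0_mul_mul_one0 b h
    exact ⟨heckeX b f, ⟨f, hf, rfl⟩, h1⟩

/-- The map `f ↦ f 𝟏₀` from `𝕂[P]^W` to `𝟏₀ H̃ 𝟏₀`. -/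
def satakeHom : symmetric b →ₗ[Coeff b] corner b (one0 b) (one0 b) :=
  LinearMap.codRestrict _
    (LinearMap.mulRight (Coeff b) (one0 b) ∘ₗ (heckeX b).toLinearMap ∘ₗ
      (symmetric b).val.toLinearMap)
    fun f => heckeX_mul_one0_mem_corner b f.2

theorem satakeHom_apply (f : symmetric b) :
    (satakeHom b f : AffineHecke b) = heckeX b f * one0 b := rfl

theorem satakeHom_bijective : Function.Bijective (satakeHom b) := by
  constructor
  · intro f g h
    have h1 := congrArg (fun x : corner b (one0 b) (one0 b) => rep b x 1) h
    simp only [satakeHom_apply, rep_heckeX_mul_one0_one] at h1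
    exact Subtype.ext (IsFractionRing.injective _ _ h1)
  · rintro ⟨x, hx⟩
    obtain ⟨h, rfl⟩ := (mem_corner b).1 hx
    obtain ⟨f, hf, h1⟩ := exists_symmetric_one0_mul_mul_one0 b h
    exact ⟨⟨f, hf⟩, Subtype.ext h1.symm⟩

/-- The Satake isomorphism. -/
def satakeEquiv : symmetric b ≃ₗ[Coeff b] corner b (one0 b) (one0 b) :=
  LinearEquiv.ofBijective (satakeHom b) (satakeHom_bijective b)

theorem satakeEquiv_apply (f : symmetric b) :
    (satakeEquiv b f : AffineHecke b) = heckeX b f * one0 b := rfl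

end Center

/-! ### Dominant weights and the height `⟨μ, 2ρ^∨⟩`. -/

section Height

variable {ι V V' : Type*} [AddCommGroup V] [Module ℝ V] [AddCommGroup V'] [Module ℝ V']
variable {R : RootPairing ι ℝ V V'} (b : R.Base)

theorem weightPairing_add (μ ν : weightLattice R) (i : ι) :
    weightPairing (μ + ν) i = weightPairing μ i + weightPairing ν i := by
  have h := weightPairing_spec R (μ + ν) i
  rw [AddSubgroup.coe_add, map_add, weightPairing_spec, weightPairing_spec] at h
  exact_mod_cast h.symm

theorem weightPairing_reflectionPerm_self (μ : weightLattice R) (i : ι) :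
    weightPairing μ (R.reflectionPerm i i) = -weightPairing μ i := by
  have h := weightPairing_spec R μ (R.reflectionPerm i i)
  have h1 : R.coroot' (R.reflectionPerm i i) = -R.coroot' i := by
    ext v
    simp [RootPairing.coroot']
  rw [h1, LinearMap.neg_apply, weightPairing_spec] at h
  exact_mod_cast h.symm

variable [Finite ι] [R.IsRootSystem] [R.IsCrystallographic] [R.IsReduced]

/-- A weight is dominant if its pairings with the simple coroots are nonnegative. -/
def IsDominant (μ : weightLattice R) : Prop := ∀ i : b.support, 0 ≤ weightPairing μ i

/-- Induction on the height of the root: reflecting it in a simple root with positive pairing keeps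
it positive and lowers its height, while the pairing with `μ` drops by a nonnegative amount. -/
theorem IsDominant.weightPairing_nonneg {μ : weightLattice R} (hμ : IsDominant b μ) {j : ι}
    (hj : b.IsPos j) : 0 ≤ weightPairing μ j := by
  induction hN : (b.height j).natAbs using Nat.strongRecOn generalizing j with
  | ind n ih =>
    obtain ⟨k, hk, hkj⟩ := hj.exists_mem_support_pos_pairingIn
    rcases eq_or_ne j k with rfl | hne
    · exact hμ ⟨j, hk⟩
    have hpos := hj.reflectionPerm hk hne
    have hlt : b.height (R.reflectionPerm k j) < b.height j := by
      have h1 := R.reflection_apply_root' ℤ (i := k) (j := j)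
      rw [← root_reflectionPerm, sub_eq_add_neg, ← neg_smul] at h1
      rw [b.height_add_zsmul h1]
      have h2 : 0 < b.height k := Base.isPos_of_mem_support hk
      have h3 : 0 < R.pairingIn ℤ j k := (R.zero_lt_pairingIn_iff' (S := ℤ)).1 hkj
      have := mul_pos h3 h2
      simp only [smul_eq_mul]
      linarith
    have h1 : 0 ≤ weightPairing μ (R.reflectionPerm k j) := by
      have h4 : 0 < b.height (R.reflectionPerm k j) := hpos
      have h5 : 0 < b.height j := hj
      exact ih _ (by omega) hpos rfl
    have h2 : weightPairing μ (R.reflectionPerm k j)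
        = weightPairing μ j - weightPairing μ k * R.pairingIn ℤ k j := by
      rw [← weylGroupToPerm_ofIdx, ← weightPairing_smul (weylGroup.ofIdx R k),
        ← weylGroupToPerm_mul, ofIdx_mul_self, map_one, Equiv.Perm.one_apply]
      apply weightPairing_eq_of_coroot'
      rw [ofIdx_smul_weight]
      simp only [AddSubgroup.coe_sub, AddSubgroup.coe_zsmul, map_sub, map_zsmul, weightPairing_spec,
        rootWeight, coroot'_root_eq, zsmul_eq_mul]
      push_cast
      ring
    have := mul_nonneg (hμ ⟨k, hk⟩) hkj.le
    simp only at this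
    linarith

/-- The positive roots. -/
def posRoots : Finset ι := (Set.toFinite {i | b.IsPos i}).toFinset

theorem mem_posRoots {i : ι} : i ∈ posRoots b ↔ b.IsPos i := by simp [posRoots]

/-- The pairing of a weight with the sum of the positive coroots. -/
def ht (μ : weightLattice R) : ℤ := ∑ j ∈ posRoots b, weightPairing μ j

theorem ht_add (μ ν : weightLattice R) : ht b (μ + ν) = ht b μ + ht b ν := by
  simp only [ht, weightPairing_add, Finset.sum_add_distrib]

theorem IsDominant.ht_nonneg {μ : weightLattice R} (hμ : IsDominant b μ) : 0 ≤ ht b μ :=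
  Finset.sum_nonneg fun _ hj => hμ.weightPairing_nonneg b ((mem_posRoots b).1 hj)

theorem ht_simpleReflection (i : b.support) (μ : weightLattice R) :
    ht b (simpleReflection b i • μ) = ht b μ - 2 * weightPairing μ i := by
  classical
  have hi : (i : ι) ∈ posRoots b := (mem_posRoots b).2 (isPos_simple b i)
  have hss : ∀ j, R.weylGroupToPerm (simpleReflection b i)
      (R.weylGroupToPerm (simpleReflection b i) j) = j := by
    intro j
    rw [← weylGroupToPerm_mul, simpleReflection_mul_self, map_one]
    rfl
  have hmem : ∀ j ∈ (posRoots b).erase i,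
      R.weylGroupToPerm (simpleReflection b i) j ∈ (posRoots b).erase i := by
    intro j hj
    obtain ⟨hji, hj⟩ := Finset.mem_erase.1 hj
    refine Finset.mem_erase.2 ⟨?_, (mem_posRoots b).2
      (isPos_simpleReflection b i ((mem_posRoots b).1 hj) hji)⟩
    intro h
    have h1 := hss j
    rw [h, simpleReflection_apply_self] at h1
    rw [mem_posRoots, ← h1, isPos_reflectionPerm_self_iff] at hj
    exact hj (isPos_simple b i)
  have h1 : ∑ j ∈ (posRoots b).erase i, weightPairing (simpleReflection b i • μ) j
      = ∑ j ∈ (posRoots b).erase i, weightPairing μ j := by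
    refine Finset.sum_nbij' (R.weylGroupToPerm (simpleReflection b i))
      (R.weylGroupToPerm (simpleReflection b i)) hmem hmem (fun j _ => hss j) (fun j _ => hss j) ?_
    intro j _
    rw [weightPairing_smul_left, simpleReflection_inv]
  rw [ht, ht, ← Finset.add_sum_erase _ _ hi, ← Finset.add_sum_erase _ _ hi, h1,
    weightPairing_smul_left, simpleReflection_inv, simpleReflection_apply_self,
    weightPairing_reflectionPerm_self]
  ring

/-- Along a length-increasing chain `⟨wμ, αᵢ^∨⟩ = ⟨μ, (w⁻¹αᵢ)^∨⟩ ≥ 0`, so each reflection either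
fixes the weight or lowers its height. -/
theorem IsDominant.smul_eq_or_ht_lt {μ : weightLattice R} (hμ : IsDominant b μ)
    (w : R.weylGroup) : w • μ = μ ∨ ht b (w • μ) < ht b μ := by
  refine length_induction b (p := fun w => w • μ = μ ∨ ht b (w • μ) < ht b μ)
    (Or.inl (one_smul _ _)) ?_ w
  intro i w hw ih
  have h1 : 0 ≤ weightPairing (w • μ) i := by
    rw [weightPairing_smul_left]
    exact hμ.weightPairing_nonneg b hw
  rw [mul_smul]
  rcases h1.eq_or_lt with h2 | h2
  · rw [simpleReflection_smul_weight, ← h2, zero_smul, sub_zero]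
    exact ih
  · right
    rw [ht_simpleReflection]
    rcases ih with ih | ih
    · rw [ih] at h2 ⊢
      linarith
    · linarith

theorem weightPairing_rho (i : b.support) : weightPairing (rho b) i = 1 :=
  weightPairing_eq_of_coroot' (by rw [rho, coroot_halfSum b i i.2]; norm_num)

theorem isDominant_rho : IsDominant b (rho b) := fun i => by
  rw [weightPairing_rho]
  norm_num

theorem ht_smul_rho_lt {w : R.weylGroup} (hw : w ≠ 1) : ht b (w • rho b) < ht b (rho b) := by
  refine ((isDominant_rho b).smul_eq_or_ht_lt b w).resolve_left fun h => ?_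
  obtain ⟨i, hi⟩ := exists_descent b hw
  have h1 := weightPairing_smul w (rho b) i
  rw [h, weightPairing_rho] at h1
  rw [← isPos_reflectionPerm_self_iff] at hi
  have h2 := (isDominant_rho b).weightPairing_nonneg b hi
  rw [weightPairing_reflectionPerm_self, h1] at h2
  norm_num at h2

end Height

/-! ### The height filtration of the group algebra. -/

section Filtration

variable {ι V V' : Type*} [AddCommGroup V] [Module ℝ V] [AddCommGroup V'] [Module ℝ V']
variable {R : RootPairing ι ℝ V V'} (b : R.Base)
variable [Finite ι] [R.IsRootSystem] [R.IsCrystallographic] [R.IsReduced]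

/-- The elements of `𝕂[P]` all of whose exponents have height less than `n`. -/
def htLT (n : ℤ) : Submodule (Coeff b) (GroupAlg b) where
  carrier := {f | ∀ μ, n ≤ ht b μ → f.coeff μ = 0}
  add_mem' := by
    intro f g hf hg μ hμ
    rw [AddMonoidAlgebra.coeff_add, Finsupp.add_apply, hf μ hμ, hg μ hμ, add_zero]
  zero_mem' := by
    intro μ _
    rw [AddMonoidAlgebra.coeff_zero, Finsupp.zero_apply]
  smul_mem' := by
    intro r f hf μ hμ
    rw [AddMonoidAlgebra.coeff_smul, Finsupp.smul_apply, hf μ hμ, smul_zero]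

theorem coeff_monomial [DecidableEq (weightLattice R)] (μ ν : weightLattice R) :
    (monomial b μ).coeff ν = if μ = ν then 1 else 0 := by
  rw [monomial, AddMonoidAlgebra.coeff_single, Finsupp.single_apply]

theorem monomial_mem_htLT {n : ℤ} {μ : weightLattice R} (h : ht b μ < n) :
    monomial b μ ∈ htLT b n := by
  classical
  intro ν hν
  rw [coeff_monomial, if_neg]
  rintro rfl
  omega

/-- Heights are integers, so bounds `< m` and `< n` add up to `< m + n - 1`. The gain of one makes
products of leading terms and lower terms strictly lower. -/
theorem mul_mem_htLT {m n : ℤ} {f g : GroupAlg b} (hf : f ∈ htLT b m) (hg : g ∈ htLT b n) :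
    f * g ∈ htLT b (m + n - 1) := by
  classical
  intro μ hμ
  by_contra h
  have h1 := AddMonoidAlgebra.support_coeff_mul_subset f g (Finsupp.mem_support_iff.2 h)
  obtain ⟨α, hα, β, hβ, rfl⟩ := Finset.mem_add.1 h1
  rw [Finsupp.mem_support_iff] at hα hβ
  have h2 : ht b α < m := by
    by_contra h3
    exact hα (hf α (not_lt.1 h3))
  have h3 : ht b β < n := by
    by_contra h3
    exact hβ (hg β (not_lt.1 h3))
  rw [ht_add] at hμ
  omega

theorem htLT_mono {m n : ℤ} (h : m ≤ n) : htLT b m ≤ htLT b n :=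
  fun _ hf μ hμ => hf μ (h.trans hμ)

theorem exists_mem_htLT (f : GroupAlg b) : ∃ n : ℕ, f ∈ htLT b n := by
  refine groupAlg_induction b (p := fun f => ∃ n : ℕ, f ∈ htLT b n) ?_ ?_ ?_ f
  · intro μ
    exact ⟨(ht b μ + 1).toNat, monomial_mem_htLT b (by omega)⟩
  · rintro f g ⟨m, hm⟩ ⟨n, hn⟩
    exact ⟨m + n, add_mem (htLT_mono b (by push_cast; omega) hm)
      (htLT_mono b (by push_cast; omega) hn)⟩
  · rintro r f ⟨n, hn⟩
    exact ⟨n, Submodule.smul_mem _ _ hn⟩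

end Filtration

/-! ### Orbit sums and freeness of the symmetric functions. -/

section OrbitSums

variable {ι V V' : Type*} [AddCommGroup V] [Module ℝ V] [AddCommGroup V'] [Module ℝ V']
variable {R : RootPairing ι ℝ V V'} (b : R.Base)
variable [Finite ι] [R.IsRootSystem] [R.IsCrystallographic] [R.IsReduced]

open Classical in
/-- The Weyl group orbit of a weight. -/
def weightOrbit (μ : weightLattice R) : Finset (weightLattice R) :=
  Finset.univ.image fun w : R.weylGroup => w • μ

theorem mem_weightOrbit {μ ν : weightLattice R} :
    ν ∈ weightOrbit μ ↔ ∃ w : R.weylGroup, w • μ = ν := by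
  simp [weightOrbit]

theorem self_mem_weightOrbit (μ : weightLattice R) : μ ∈ weightOrbit μ :=
  mem_weightOrbit.2 ⟨1, one_smul _ _⟩

theorem smul_mem_weightOrbit_iff (w : R.weylGroup) {μ ν : weightLattice R} :
    w • ν ∈ weightOrbit μ ↔ ν ∈ weightOrbit μ := by
  simp only [mem_weightOrbit]
  constructor
  · rintro ⟨v, hv⟩
    exact ⟨w⁻¹ * v, by rw [mul_smul, hv, inv_smul_smul]⟩
  · rintro ⟨v, hv⟩
    exact ⟨w * v, by rw [mul_smul, hv]⟩

/-- The orbit sum `∑_{ν ∈ Wμ} x^ν`. -/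
def orbitSum (μ : weightLattice R) : GroupAlg b := ∑ ν ∈ weightOrbit μ, monomial b ν

theorem orbitSum_mem_symmetric (μ : weightLattice R) : orbitSum b μ ∈ symmetric b := by
  intro w
  rw [orbitSum, map_sum]
  exact Finset.sum_bijective (w • ·) (MulAction.bijective w)
    (fun ν => (smul_mem_weightOrbit_iff w).symm) fun ν _ => weylAct_monomial b w ν

theorem coeff_orbitSum [DecidableEq (weightLattice R)] (μ ν : weightLattice R) :
    (orbitSum b μ).coeff ν = if ν ∈ weightOrbit μ then 1 else 0 := by
  rw [orbitSum, AddMonoidAlgebra.coeff_sum, Finsupp.finsetSum_apply]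
  simp only [coeff_monomial]
  exact Finset.sum_ite_eq' _ _ _

theorem IsDominant.orbitSum_sub_mem {μ : weightLattice R} (hμ : IsDominant b μ) :
    orbitSum b μ - monomial b μ ∈ htLT b (ht b μ) := by
  classical
  rw [orbitSum, ← Finset.add_sum_erase _ _ (self_mem_weightOrbit μ), add_sub_cancel_left]
  refine sum_mem fun ν hν => monomial_mem_htLT b ?_
  obtain ⟨hne, hν⟩ := Finset.mem_erase.1 hν
  obtain ⟨w, rfl⟩ := mem_weightOrbit.1 hν
  exact (hμ.smul_eq_or_ht_lt b w).resolve_left hne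

/-- The coefficients of a symmetric function on representatives of the orbits. -/
def orbitCoeff : symmetric b →ₗ[Coeff b]
    (MulAction.orbitRel.Quotient R.weylGroup (weightLattice R) →₀ Coeff b) where
  toFun f := (f : GroupAlg b).coeff.comapDomain Quotient.out Quotient.out_injective.injOn
  map_add' f g := by
    ext ω
    simp
  map_smul' r f := by
    ext ω
    simp

theorem orbitCoeff_apply (f : symmetric b)
    (ω : MulAction.orbitRel.Quotient R.weylGroup (weightLattice R)) :
    orbitCoeff b f ω = (f : GroupAlg b).coeff ω.out := rfl

theorem orbitCoeff_bijective : Function.Bijective (orbitCoeff b) := by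
  classical
  constructor
  · rw [injective_iff_map_eq_zero]
    intro f hf
    apply Subtype.ext
    refine AddMonoidAlgebra.ext (Finsupp.ext fun μ => ?_)
    obtain ⟨w, hw⟩ : ∃ w : R.weylGroup,
        w • μ = (Quotient.mk (MulAction.orbitRel R.weylGroup (weightLattice R)) μ).out :=
      MulAction.orbitRel_apply.1 (Quotient.mk_out (s := MulAction.orbitRel _ _) μ)
    have h1 := DFunLike.congr_fun hf (Quotient.mk _ μ)
    rw [orbitCoeff_apply, ← hw, ← f.2 w, coeff_weylAct] at h1
    exact h1
  · rw [← LinearMap.range_eq_top, eq_top_iff]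
    rintro c -
    induction c using Finsupp.induction_linear with
    | zero => exact zero_mem _
    | add c d hc hd => exact add_mem hc hd
    | single ω r =>
      refine ⟨r • ⟨orbitSum b ω.out, orbitSum_mem_symmetric b _⟩, ?_⟩
      rw [map_smul]
      ext ω'
      rw [Finsupp.smul_apply, orbitCoeff_apply, coeff_orbitSum, Finsupp.single_apply]
      have : (ω'.out ∈ weightOrbit ω.out) ↔ ω = ω' := by
        rw [mem_weightOrbit]
        constructor
        · rintro ⟨w, hw⟩
          rw [← Quotient.out_eq ω, ← Quotient.out_eq ω']
          exact (Quotient.sound (MulAction.orbitRel_apply.2 ⟨w, hw⟩)).symm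
        · rintro rfl
          exact ⟨1, one_smul _ _⟩
      simp only [this]
      split_ifs <;> simp

theorem free_symmetric : Module.Free (Coeff b) (symmetric b) :=
  Module.Free.of_equiv (LinearEquiv.ofBijective _ (orbitCoeff_bijective b)).symm

end OrbitSums

/-! ### Division of alternating functions by `a_ρ`. -/

section Alternating

variable {ι V V' : Type*} [AddCommGroup V] [Module ℝ V] [AddCommGroup V'] [Module ℝ V']
variable {R : RootPairing ι ℝ V V'} (b : R.Base)
variable [Finite ι] [R.IsRootSystem] [R.IsCrystallographic] [R.IsReduced]

theorem neg_one_pow_length_mul {A : Type*} [Ring A] (w v : R.weylGroup) :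
    (-1 : A) ^ length b (w * v) = (-1) ^ length b w * (-1) ^ length b v := by
  refine length_induction b (p := fun w => (-1 : A) ^ length b (w * v)
    = (-1) ^ length b w * (-1) ^ length b v) ?_ ?_ w
  · rw [one_mul, length_one, pow_zero, one_mul]
  · intro i w _ ih
    rw [mul_assoc, neg_one_pow_length_simple_mul, ih, neg_one_pow_length_simple_mul, neg_mul]

theorem neg_one_pow_length_mul_self {A : Type*} [Ring A] (w : R.weylGroup) :
    (-1 : A) ^ length b w * (-1) ^ length b w = 1 := by
  rw [← pow_add, ← two_mul, pow_mul, neg_one_sq, one_pow]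

theorem altSum_mem_alternating (μ : weightLattice R) : altSum b μ ∈ alternating b := by
  intro w
  rw [altSum, map_sum, Finset.smul_sum, ← Equiv.sum_comp (Equiv.mulLeft w)
    (fun v => (-1 : Coeff b) ^ length b w • (-1 : Coeff b) ^ length b v • weylAct b v _)]
  refine Finset.sum_congr rfl fun v _ => ?_
  rw [map_smul, ← weylAct_mul, Equiv.coe_mulLeft, smul_smul, neg_one_pow_length_mul, ← mul_assoc,
    neg_one_pow_length_mul_self, one_mul]

theorem mul_mem_alternating {f g : GroupAlg b} (hf : f ∈ alternating b) (hg : g ∈ symmetric b) :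
    f * g ∈ alternating b := by
  intro w
  rw [map_mul, hf w, hg w, smul_mul_assoc]

theorem altSum_rho_sub_mem :
    altSum b (rho b) - monomial b (rho b) ∈ htLT b (ht b (rho b)) := by
  classical
  rw [altSum, ← Finset.add_sum_erase _ _ (Finset.mem_univ 1), length_one, pow_zero, one_smul,
    weylAct_one, add_sub_cancel_left]
  refine sum_mem fun w hw => Submodule.smul_mem _ _ ?_
  rw [weylAct_monomial]
  exact monomial_mem_htLT b (ht_smul_rho_lt b (Finset.mem_erase.1 hw).1)

theorem altSum_rho_ne_zero : altSum b (rho b) ≠ 0 := by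
  classical
  intro h
  have h1 := altSum_rho_sub_mem b (rho b) le_rfl
  rw [h, zero_sub, AddMonoidAlgebra.coeff_neg, Finsupp.neg_apply, coeff_monomial, if_pos rfl] at h1
  exact one_ne_zero (neg_eq_zero.1 h1)

/-- Both factors have leading coefficient `1`, so division by `a_ρ` needs no denominators. -/
theorem IsDominant.altSum_mul_orbitSum_sub_mem {μ : weightLattice R} (hμ : IsDominant b μ) :
    altSum b (rho b) * orbitSum b μ - monomial b (μ + rho b) ∈ htLT b (ht b (μ + rho b)) := by
  have h1 := altSum_rho_sub_mem b
  have h2 := hμ.orbitSum_sub_mem b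
  have h3 : orbitSum b μ ∈ htLT b (ht b μ + 1) := by
    rw [← sub_add_cancel (orbitSum b μ) (monomial b μ)]
    exact add_mem (htLT_mono b (by omega) h2) (monomial_mem_htLT b (by omega))
  have h4 : altSum b (rho b) * orbitSum b μ - monomial b (μ + rho b) =
      (altSum b (rho b) - monomial b (rho b)) * orbitSum b μ +
        monomial b (rho b) * (orbitSum b μ - monomial b μ) := by
    rw [monomial_add]
    ring
  rw [h4, ht_add]
  refine add_mem (htLT_mono b ?_ (mul_mem_htLT b h1 h3))
    (htLT_mono b ?_ (mul_mem_htLT b (monomial_mem_htLT b (lt_add_one _)) h2)) <;> omega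

theorem coeff_simple_of_mem_alternating {f : GroupAlg b} (hf : f ∈ alternating b) (i : b.support)
    (μ : weightLattice R) : f.coeff (simpleReflection b i • μ) = -f.coeff μ := by
  have h := coeff_weylAct b (simpleReflection b i) f μ
  rw [hf, length_simpleReflection, pow_one, neg_one_smul, AddMonoidAlgebra.coeff_neg,
    Finsupp.neg_apply] at h
  rw [← h, neg_neg]

/-- The exponents of maximal height of an alternating function are dominant and regular. -/
theorem one_le_weightPairing_of_alternating {f : GroupAlg b} (hf : f ∈ alternating b) {n : ℤ}
    (hn : f ∈ htLT b (n + 1)) {μ : weightLattice R} (hμ : n ≤ ht b μ) (h : f.coeff μ ≠ 0)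
    (i : b.support) : 1 ≤ weightPairing μ i := by
  have h1 := coeff_simple_of_mem_alternating b hf i μ
  -- The weight `sᵢμ` is also an exponent, hence not higher than `μ`, so the pairing is nonnegative.
  -- If it were zero, the coefficient would equal its own negative.
  have h2 : ht b (simpleReflection b i • μ) < n + 1 := by
    by_contra h2
    rw [hn _ (not_lt.1 h2), eq_comm, neg_eq_zero] at h1
    exact h h1
  rw [ht_simpleReflection] at h2
  have h3 : weightPairing μ i ≠ 0 := by
    intro h3
    rw [simpleReflection_smul_weight, h3, zero_smul, sub_zero] at h1
    exact h (self_eq_neg.1 h1)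
  omega

theorem eq_sum_coeff_smul_monomial (f : GroupAlg b) :
    f = ∑ μ ∈ f.coeff.support, f.coeff μ • monomial b μ := by
  classical
  refine AddMonoidAlgebra.ext (Finsupp.ext fun ν => ?_)
  rw [AddMonoidAlgebra.coeff_sum, Finsupp.finsetSum_apply]
  simp only [AddMonoidAlgebra.coeff_smul, Finsupp.smul_apply, coeff_monomial, smul_eq_mul,
    mul_ite, mul_one, mul_zero]
  rw [Finset.sum_ite_eq']
  split_ifs with h
  · rfl
  · exact Finsupp.notMem_support_iff.1 h

theorem exists_symmetric_mul_eq_of_mem_htLT (n : ℕ) : ∀ g ∈ alternating b, g ∈ htLT b n →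
    ∃ f ∈ symmetric b, altSum b (rho b) * f = g := by
  classical
  induction n with
  | zero =>
    -- An exponent of maximal height of a nonzero alternating function is dominant, so its height
    -- cannot be negative.
    intro g hg h0
    refine ⟨0, zero_mem _, ?_⟩
    rw [mul_zero]
    by_contra hne
    obtain ⟨ν, hν⟩ : g.coeff.support.Nonempty := by
      rw [Finsupp.support_nonempty_iff]
      intro h
      exact hne (AddMonoidAlgebra.ext h.symm)
    obtain ⟨μ, hμ, hmax⟩ := Finset.exists_max_image g.coeff.support (ht b) ⟨ν, hν⟩
    rw [Finsupp.mem_support_iff] at hμ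
    have h1 : g ∈ htLT b (ht b μ + 1) := by
      intro κ hκ
      by_contra h2
      have := hmax κ (Finsupp.mem_support_iff.2 h2)
      omega
    have hdom : IsDominant b μ := fun i =>
      zero_le_one.trans (one_le_weightPairing_of_alternating b hg h1 le_rfl hμ i)
    exact hμ (h0 μ (hdom.ht_nonneg b))
  | succ n ih =>
    intro g hg hn
    -- The exponents of top height are dominant and regular, so subtracting `ρ` leaves them
    -- dominant. The matching combination of orbit sums, times `a_ρ`, cancels the top layer.
    set S := g.coeff.support.filter fun μ => (n : ℤ) ≤ ht b μ with hS
    have hdom : ∀ μ ∈ S, IsDominant b (μ - rho b) := by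
      intro μ hμ i
      obtain ⟨h1, h2⟩ := Finset.mem_filter.1 hμ
      have h3 := one_le_weightPairing_of_alternating b hg (by exact_mod_cast hn) h2
        (Finsupp.mem_support_iff.1 h1) i
      have h4 := weightPairing_add (μ - rho b) (rho b) i
      rw [sub_add_cancel, weightPairing_rho] at h4
      omega
    have hht : ∀ μ ∈ S, ht b μ = n := by
      intro μ hμ
      obtain ⟨h1, h2⟩ := Finset.mem_filter.1 hμ
      by_contra h3
      refine Finsupp.mem_support_iff.1 h1 (hn μ ?_)
      push_cast
      omega
    set F := ∑ μ ∈ S, g.coeff μ • orbitSum b (μ - rho b) with hF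
    have hFs : F ∈ symmetric b :=
      sum_mem fun μ _ => Subalgebra.smul_mem _ (orbitSum_mem_symmetric b _) _
    have hlow : g - altSum b (rho b) * F ∈ htLT b n := by
      have h1 : g - altSum b (rho b) * F =
          ∑ μ ∈ g.coeff.support.filter (fun μ => ¬ (n : ℤ) ≤ ht b μ), g.coeff μ • monomial b μ -
          ∑ μ ∈ S, g.coeff μ •
            (altSum b (rho b) * orbitSum b (μ - rho b) - monomial b (μ - rho b + rho b)) := by
        nth_rewrite 1 [eq_sum_coeff_smul_monomial b g]
        rw [← Finset.sum_filter_add_sum_filter_not _ (fun μ => (n : ℤ) ≤ ht b μ), ← hS, hF,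
          Finset.mul_sum]
        simp only [smul_sub, sub_add_cancel, Finset.sum_sub_distrib, mul_smul_comm]
        abel
      rw [h1]
      refine sub_mem (sum_mem fun μ hμ => Submodule.smul_mem _ _ (monomial_mem_htLT b ?_))
        (sum_mem fun μ hμ => Submodule.smul_mem _ _ ?_)
      · exact not_le.1 (Finset.mem_filter.1 hμ).2
      · have := (hdom μ hμ).altSum_mul_orbitSum_sub_mem b
        rw [sub_add_cancel, hht μ hμ] at this
        rwa [sub_add_cancel]
    obtain ⟨f, hf, h⟩ := ih _
      (sub_mem hg (mul_mem_alternating b (altSum_mem_alternating b _) hFs)) hlow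
    exact ⟨f + F, add_mem hf hFs, by rw [mul_add, h, sub_add_cancel]⟩

theorem exists_symmetric_mul_eq {g : GroupAlg b} (hg : g ∈ alternating b) :
    ∃ f ∈ symmetric b, altSum b (rho b) * f = g := by
  obtain ⟨n, hn⟩ := exists_mem_htLT b g
  exact exists_symmetric_mul_eq_of_mem_htLT b n g hg hn

/-- The map `f ↦ a_ρ f` from symmetric to alternating functions. -/
def altHom : symmetric b →ₗ[Coeff b] alternating b :=
  LinearMap.codRestrict _
    (LinearMap.mulLeft (Coeff b) (altSum b (rho b)) ∘ₗ (symmetric b).val.toLinearMap)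
    fun f => mul_mem_alternating b (altSum_mem_alternating b _) f.2

theorem altHom_apply (f : symmetric b) :
    (altHom b f : GroupAlg b) = altSum b (rho b) * f := rfl

theorem altHom_bijective : Function.Bijective (altHom b) := by
  constructor
  · intro f g h
    have h1 := congrArg (fun x : alternating b => (x : GroupAlg b)) h
    simp only [altHom_apply] at h1
    exact Subtype.ext (mul_left_cancel₀ (altSum_rho_ne_zero b) h1)
  · rintro ⟨g, hg⟩
    obtain ⟨f, hf, h⟩ := exists_symmetric_mul_eq b hg
    exact ⟨⟨f, hf⟩, Subtype.ext h⟩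

/-- The isomorphism `f ↦ a_ρ f` from symmetric to alternating functions. -/
def altEquiv : symmetric b ≃ₗ[Coeff b] alternating b :=
  LinearEquiv.ofBijective (altHom b) (altHom_bijective b)

theorem altEquiv_apply (f : symmetric b) :
    (altEquiv b f : GroupAlg b) = altSum b (rho b) * f := rfl

end Alternating

/-! ### Weyl characters and the isomorphism with `ε₀ H̃ 𝟏₀`. -/

section Character

variable {ι V V' : Type*} [AddCommGroup V] [Module ℝ V] [AddCommGroup V'] [Module ℝ V']
variable {R : RootPairing ι ℝ V V'} (b : R.Base)
variable [Finite ι] [R.IsRootSystem] [R.IsCrystallographic] [R.IsReduced]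

theorem algebraMap_coeff_ratFun_injective :
    Function.Injective (algebraMap (Coeff b) (RatFun b)) := by
  rw [IsScalarTower.algebraMap_eq (Coeff b) (GroupAlg b) (RatFun b), RingHom.coe_comp]
  refine (IsFractionRing.injective (GroupAlg b) (RatFun b)).comp fun r r' h => ?_
  rw [Algebra.algebraMap_eq_smul_one, Algebra.algebraMap_eq_smul_one, ← monomial_zero] at h
  have h1 := congrArg (fun f : GroupAlg b => f.coeff 0) h
  simpa [monomial, AddMonoidAlgebra.coeff_single] using h1

/-- The affine Hecke algebra is torsion-free over `𝕂`. -/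
theorem eq_of_smul_eq_smul {r : Coeff b} (hr : r ≠ 0) {h h' : AffineHecke b}
    (H : r • h = r • h') : h = h' := by
  rw [← sub_eq_zero]
  refine eq_zero_of_rep_eq_zero b fun g => ?_
  have h1 : rep b (r • (h - h')) (algebraMap _ _ g) = 0 := by
    rw [smul_sub, H, sub_self, map_zero, LinearMap.zero_apply]
  rw [map_smul, LinearMap.smul_apply, Algebra.smul_def] at h1
  exact (mul_eq_zero.1 h1).resolve_left
    ((map_ne_zero_iff _ (algebraMap_coeff_ratFun_injective b)).2 hr)

/-- The map `f ↦ ε₀ f 𝟏₀`. -/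
def sandwich : GroupAlg b →ₗ[Coeff b] AffineHecke b :=
  LinearMap.mulLeftRight (Coeff b) (eps0 b, one0 b) ∘ₗ (heckeX b).toLinearMap

theorem sandwich_apply (f : GroupAlg b) :
    sandwich b f = eps0 b * heckeX b f * one0 b := rfl

/-- Here `Tᵢ` commutes with `f`. Absorbed into `𝟏₀` it gives `q`, absorbed into `ε₀` it gives
`-q⁻¹`, and `q + q⁻¹` can be cancelled. -/
theorem sandwich_eq_zero_of_invariant {i : b.support} {f : GroupAlg b}
    (hf : weylAct b (simpleReflection b i) f = f) : sandwich b f = 0 := by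
  refine eq_of_smul_eq_smul b (q_add_qInv_ne_zero b) ?_
  have h1 : eps0 b * (heckeX b f * heckeT b i) * one0 b = q b • sandwich b f := by
    rw [← mul_assoc, mul_assoc _ (heckeT b i), heckeT_mul_one0, mul_smul_comm, sandwich_apply]
  have h2 : eps0 b * (heckeT b i * heckeX b f) * one0 b = -qInv b • sandwich b f := by
    rw [← mul_assoc, eps0_mul_heckeT, smul_mul_assoc, smul_mul_assoc, sandwich_apply]
  rw [heckeX_mul_heckeT_of_invariant b hf, h2, neg_smul] at h1
  rw [add_smul, ← h1, neg_add_cancel, smul_zero]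

theorem sandwich_simpleReflection (i : b.support) (f : GroupAlg b) :
    sandwich b (weylAct b (simpleReflection b i) f) = -sandwich b f := by
  have h := sandwich_eq_zero_of_invariant b (i := i)
    (f := weylAct b (simpleReflection b i) f + f) (by
      rw [map_add, ← weylAct_mul, simpleReflection_mul_self, weylAct_one, add_comm])
  rw [map_add] at h
  exact eq_neg_of_add_eq_zero_left h

theorem sandwich_weylAct (w : R.weylGroup) (f : GroupAlg b) :
    sandwich b (weylAct b w f) = (-1 : Coeff b) ^ length b w • sandwich b f := by
  refine length_induction b (p := fun w => sandwich b (weylAct b w f)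
    = (-1 : Coeff b) ^ length b w • sandwich b f) ?_ ?_ w
  · rw [weylAct_one, length_one, pow_zero, one_smul]
  · intro i w _ ih
    rw [weylAct_mul, sandwich_simpleReflection, ih, neg_one_pow_length_simple_mul, neg_smul]

theorem bigA_mul_heckeX_mul_one0 (μ : weightLattice R) {f : GroupAlg b} (hf : f ∈ symmetric b) :
    bigA b μ * (heckeX b f * one0 b) = sandwich b (monomial b μ * f) := by
  rw [bigA, sandwich_apply, map_mul, heckeX_mul_comm_of_mem_symmetric b hf, mul_assoc (_ * _),
    ← mul_assoc (one0 b), one0_mul_one0, ← heckeX_mul_comm_of_mem_symmetric b hf]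
  simp only [mul_assoc]

/-- Each of the `|W|` terms of `a_μ f` contributes equally: the sign of `w` in `a_μ` cancels the
sign that `sandwich` acquires under `w`. -/
theorem sandwich_altSum_mul (μ : weightLattice R) {f : GroupAlg b} (hf : f ∈ symmetric b) :
    sandwich b (altSum b μ * f) =
      (Fintype.card R.weylGroup : Coeff b) • sandwich b (monomial b μ * f) := by
  rw [altSum, Finset.sum_mul, map_sum, Finset.sum_congr rfl
    (g := fun _ => sandwich b (monomial b μ * f))]
  · rw [Finset.sum_const, Finset.card_univ, Nat.cast_smul_eq_nsmul]
  · intro w _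
    nth_rewrite 1 [← hf w]
    rw [smul_mul_assoc, map_smul, ← map_mul, sandwich_weylAct, smul_smul,
      neg_one_pow_length_mul_self, one_smul]

theorem bigA_eq_sandwich (μ : weightLattice R) : bigA b μ = sandwich b (monomial b μ) := rfl

theorem card_ne_zero : (Fintype.card R.weylGroup : Coeff b) ≠ 0 :=
  Nat.cast_ne_zero.2 Fintype.card_ne_zero

/-- The Weyl character `s_μ = a_{μ+ρ} / a_ρ`. -/
def weylCharacter (μ : weightLattice R) : symmetric b :=
  (altEquiv b).symm ⟨altSum b (μ + rho b), altSum_mem_alternating b _⟩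

theorem altEquiv_weylCharacter (μ : weightLattice R) :
    (altEquiv b (weylCharacter b μ) : GroupAlg b) = altSum b (μ + rho b) := by
  rw [weylCharacter, LinearEquiv.apply_symm_apply]

theorem altSum_rho_mul_weylCharacter (μ : weightLattice R) :
    altSum b (rho b) * weylCharacter b μ = altSum b (μ + rho b) := by
  rw [← altEquiv_apply, altEquiv_weylCharacter]

/-- After multiplication by `|W|` both sides become `ε₀ a_{μ+ρ} 𝟏₀`, and `H̃` is torsion-free. -/
theorem bigA_rho_mul_weylCharacter (μ : weightLattice R) :
    bigA b (rho b) * (heckeX b (weylCharacter b μ) * one0 b) = bigA b (μ + rho b) := by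
  refine eq_of_smul_eq_smul b (card_ne_zero b) ?_
  rw [bigA_mul_heckeX_mul_one0 b _ (weylCharacter b μ).2,
    ← sandwich_altSum_mul b _ (weylCharacter b μ).2, altSum_rho_mul_weylCharacter,
    bigA_eq_sandwich, ← mul_one (monomial b (μ + rho b)),
    ← sandwich_altSum_mul b _ (one_mem (symmetric b)), mul_one]

theorem bigA_mul_one0 (μ : weightLattice R) : bigA b μ * one0 b = bigA b μ := by
  rw [bigA, mul_assoc, one0_mul_one0]

theorem rep_bigA_one (μ : weightLattice R) :
    rep b (bigA b μ) 1 = rep b (eps0 b) (algebraMap _ _ (monomial b μ)) := by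
  rw [bigA, map_mul, map_mul, Module.End.mul_apply, Module.End.mul_apply, rep_one0_one, rep_heckeX,
    mul_one]

theorem rep_bigA_mul_one (μ : weightLattice R) {f : GroupAlg b} (hf : f ∈ symmetric b) :
    rep b (bigA b μ * (heckeX b f * one0 b)) 1 = algebraMap _ _ f * rep b (bigA b μ) 1 := by
  rw [← mul_assoc, ← heckeX_mul_comm_of_mem_symmetric b hf, mul_assoc, bigA_mul_one0, map_mul,
    Module.End.mul_apply, rep_heckeX]

/-- Every `A_μ` is `A_ρ s_{μ-ρ} 𝟏₀`, so if `A_ρ` killed `1`, then `ε₀` would kill every `x^μ` and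
vanish by faithfulness. -/
theorem rep_bigA_rho_one_ne_zero : rep b (bigA b (rho b)) 1 ≠ 0 := by
  intro h
  have h1 : ∀ μ, rep b (eps0 b) (algebraMap _ _ (monomial b μ)) = 0 := by
    intro μ
    have h2 := bigA_rho_mul_weylCharacter b (μ - rho b)
    rw [sub_add_cancel] at h2
    rw [← rep_bigA_one, ← h2, rep_bigA_mul_one b _ (weylCharacter b _).2, h, mul_zero]
  refine eps0_ne_zero b (eq_zero_of_rep_eq_zero b fun g => ?_)
  refine groupAlg_induction b (p := fun g => rep b (eps0 b) (algebraMap _ _ g) = 0) h1 ?_ ?_ g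
  · intro f g hf hg
    rw [map_add, map_add, hf, hg, add_zero]
  · intro r f hf
    have h2 : algebraMap (GroupAlg b) (RatFun b) (r • f) = r • algebraMap _ _ f :=
      map_smul (IsScalarTower.toAlgHom (Coeff b) (GroupAlg b) (RatFun b)) r f
    rw [h2, map_smul, hf, smul_zero]

/-- The map `h ↦ A_ρ h` from `𝟏₀ H̃ 𝟏₀` to `ε₀ H̃ 𝟏₀`. -/
def cornerHom : corner b (one0 b) (one0 b) →ₗ[Coeff b] corner b (eps0 b) (one0 b) :=
  LinearMap.codRestrict _
    (LinearMap.mulLeft (Coeff b) (bigA b (rho b)) ∘ₗ (corner b (one0 b) (one0 b)).subtype) (by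
      rintro ⟨x, hx⟩
      obtain ⟨h, rfl⟩ := (mem_corner b).1 hx
      rw [mem_corner]
      refine ⟨heckeX b (monomial b (rho b)) * one0 b * (one0 b * h), ?_⟩
      change _ = bigA b (rho b) * (one0 b * h * one0 b)
      rw [bigA]
      simp only [mul_assoc])

theorem cornerHom_apply (h : corner b (one0 b) (one0 b)) :
    (cornerHom b h : AffineHecke b) = bigA b (rho b) * h := rfl

theorem cornerHom_bijective : Function.Bijective (cornerHom b) := by
  constructor
  · rw [injective_iff_map_eq_zero]
    intro x hx
    obtain ⟨f, rfl⟩ := (satakeEquiv b).surjective x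
    have h1 := congrArg (fun y : corner b (eps0 b) (one0 b) => rep b (y : AffineHecke b) 1) hx
    simp only [cornerHom_apply, satakeEquiv_apply] at h1
    rw [rep_bigA_mul_one b _ f.2, ZeroMemClass.coe_zero, map_zero, LinearMap.zero_apply] at h1
    have h2 := (mul_eq_zero.1 h1).resolve_right (rep_bigA_rho_one_ne_zero b)
    rw [← map_zero (algebraMap (GroupAlg b) (RatFun b))] at h2
    rw [show f = 0 from Subtype.ext (IsFractionRing.injective _ _ h2), map_zero]
  · rintro ⟨x, hx⟩
    -- As `H̃ 𝟏₀ = 𝕂[P] 𝟏₀`, the `A_μ` span the target. Since `s_λ` is available for every weight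
    -- `λ`, not only dominant ones, each `A_μ` is hit by `s_{μ-ρ} 𝟏₀`.
    have key : ∀ f, ∃ y, (cornerHom b y : AffineHecke b) = sandwich b f := by
      refine groupAlg_induction b ?_ ?_ ?_
      · intro μ
        refine ⟨satakeEquiv b (weylCharacter b (μ - rho b)), ?_⟩
        rw [cornerHom_apply, satakeEquiv_apply, bigA_rho_mul_weylCharacter, sub_add_cancel]
        rfl
      · rintro f g ⟨y, hy⟩ ⟨z, hz⟩
        exact ⟨y + z, by rw [map_add, map_add, Submodule.coe_add, hy, hz]⟩
      · rintro r f ⟨y, hy⟩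
        exact ⟨r • y, by rw [map_smul, map_smul, Submodule.coe_smul, hy]⟩
    obtain ⟨h, rfl⟩ := (mem_corner b).1 hx
    obtain ⟨f, hf⟩ := exists_mul_one0_eq b h
    obtain ⟨y, hy⟩ := key f
    refine ⟨y, Subtype.ext ?_⟩
    rw [hy, sandwich_apply, mul_assoc, ← hf, ← mul_assoc]

/-- The isomorphism `h ↦ A_ρ h` from `𝟏₀ H̃ 𝟏₀` to `ε₀ H̃ 𝟏₀`. -/
def cornerEquiv : corner b (one0 b) (one0 b) ≃ₗ[Coeff b] corner b (eps0 b) (one0 b) :=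
  LinearEquiv.ofBijective (cornerHom b) (cornerHom_bijective b)

theorem cornerEquiv_apply (h : corner b (one0 b) (one0 b)) :
    (cornerEquiv b h : AffineHecke b) = bigA b (rho b) * h := rfl

theorem card_smul_cornerEquiv_satakeEquiv (f : symmetric b) :
    (Fintype.card R.weylGroup : Coeff b) • (cornerEquiv b (satakeEquiv b f) : AffineHecke b) =
      eps0 b * heckeX b (altEquiv b f) * one0 b := by
  rw [cornerEquiv_apply, satakeEquiv_apply, bigA_mul_heckeX_mul_one0 b _ f.2,
    ← sandwich_altSum_mul b _ f.2, altEquiv_apply]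
  rfl

end Character

end Satake

end

open Satake in
/-- `R` is a reduced irreducible (crystallographic) root system with simple roots `b`, and `𝕂`,
`H̃`, `𝟏₀`, `ε₀` are attached to it.  The Weyl character `s_μ = a_{μ+ρ} / a_ρ` appears as the
unique solution `s ∈ 𝕂[P]` of `a_ρ s = a_{μ+ρ}`. -/
theorem theorem2p11 {ι V V' : Type*} [Finite ι] [AddCommGroup V] [Module ℝ V]
    [AddCommGroup V'] [Module ℝ V'] (R : RootPairing ι ℝ V V') [R.IsRootSystem]
    [R.IsCrystallographic] [R.IsReduced] [R.IsIrreducible] (b : R.Base) :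
    -- `𝕂[P]` is a subalgebra of `H̃`, and `Z(H̃) = 𝕂[P]^W`, a free `𝕂`-module
    Function.Injective (heckeX b) ∧
    Subalgebra.center (Coeff b) (AffineHecke b) = (symmetric b).map (heckeX b) ∧
    Module.Free (Coeff b) (symmetric b) ∧
    -- `Z(H̃) 𝟏₀ = 𝟏₀ H̃ 𝟏₀`
    {h | ∃ z ∈ Subalgebra.center (Coeff b) (AffineHecke b), h = z * one0 b} =
      (corner b (one0 b) (one0 b) : Set (AffineHecke b)) ∧
    ∃ (Φ : symmetric b ≃ₗ[Coeff b] alternating b)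
      (Φ₁ : symmetric b ≃ₗ[Coeff b] corner b (one0 b) (one0 b))
      (Φ₂ : corner b (one0 b) (one0 b) ≃ₗ[Coeff b] corner b (eps0 b) (one0 b)),
      (∀ f, (Φ f : GroupAlg b) = altSum b (rho b) * f) ∧
      (∀ f, (Φ₁ f : AffineHecke b) = heckeX b f * one0 b) ∧
      (∀ h, (Φ₂ h : AffineHecke b) = bigA b (rho b) * h) ∧
      (∀ μ : weightLattice R, ∃ s : symmetric b,
        (∀ f : GroupAlg b, altSum b (rho b) * f = altSum b (μ + rho b) ↔ f = s) ∧
        (Φ s : GroupAlg b) = altSum b (μ + rho b) ∧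
        (Φ₂ (Φ₁ s) : AffineHecke b) = bigA b (μ + rho b)) ∧
      -- `Φ₂ ∘ Φ₁` generalizes `Φ`: it is `|W|⁻¹ ε₀ Φ(·) 𝟏₀`
      (∀ f, (Fintype.card R.weylGroup : Coeff b) • (Φ₂ (Φ₁ f) : AffineHecke b) =
        eps0 b * heckeX b (Φ f) * one0 b) := by
  refine ⟨heckeX_injective b, center_eq b, free_symmetric b, center_mul_one0 b, altEquiv b,
    satakeEquiv b, cornerEquiv b, altEquiv_apply b, satakeEquiv_apply b, cornerEquiv_apply b, ?_,
    card_smul_cornerEquiv_satakeEquiv b⟩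
  intro μ
  refine ⟨weylCharacter b μ, fun f => ⟨fun h => ?_, ?_⟩, altEquiv_weylCharacter b μ, ?_⟩
  · exact mul_left_cancel₀ (altSum_rho_ne_zero b) (h.trans (altSum_rho_mul_weylCharacter b μ).symm)
  · rintro rfl
    exact altSum_rho_mul_weylCharacter b μ
  · rw [cornerEquiv_apply, satakeEquiv_apply, bigA_rho_mul_weylCharacter]
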